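/- **Theorem (probability difference theorem).** Assume GRH: every zero in $0<\Re s<1$ of every Dirichlet $L$-function has real part $\tfrac12$. *Notation.* For a positive integer $q$, let $a_1,a_2,a_3$ be distinct reduced residues modulo $q$ with $a_1^2\equiv a_2^2\equiv a_3^2 \pmod q$. For $i\in\{1,2,3\}$ let $H_i$ be the set of Dirichlet characters $\chi$ modulo $q$ such that $\chi(a_j)=\chi(a_k)=-\chi(a_i)$, where $\{i,j,k\}=\{1,2,3\}$, and put $$ b_+(\chi)=\sum_{\gamma>0,\ L(\frac12+i\gamma,\chi)=0}\frac1{\frac14+\gamma^2},\qquad V_i=32\sum_{\chi\in H_i}b_+(\chi). $$ Here and below, sums over zeros of $L(s,\chi)$ are taken with multiplicity. For every character $\chi$ modulo $q$ and every zero $\frac12+i\gamma$ of $L(s,\chi)$ with $\gamma>0$ (listed with multiplicity), let $Z_{\chi,\gamma}$ be a random variable uniformly distributed on the unit circle in $\mathbb C$, all of these variables (over all $\chi$ and all zeros) being independent, and let $$ Z_\chi=\sum_{\gamma>0,\ L(\frac12+i\gamma,\chi)=0}\frac{Z_{\chi,\gamma}}{\sqrt{\frac14+\gamma^2}}=\lim_{T\to\infty}\sum_{0<\gamma<T}\frac{Z_{\chi,\gamma}}{\sqrt{\frac14+\gamma^2}},\qquad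 X_i=8\sum_{\chi\in H_i}\Re Z_\chi . $$ Let $Y_1,Y_2,Y_3$ be independent normal random variables with mean $0$ and variances $V_1,V_2,V_3$. *Claim.* For $\chi\in H_1\cup H_2\cup H_3$ the series $b_+(\chi)$ converges and the limit defining $Z_\chi$ exists almost surely. There is a real number $q_0>0$ such that $V_i\ge\max\{2^{20},\phi(q)\}$ for all $q>q_0$, all $a_1,a_2,a_3$ as above and all $i$. Moreover there is an absolute constant $C>0$ such that for every modulus $q$ (in particular for every $q>q_0$), all $a_1,a_2,a_3$ as above, and every permutation $(i,j,k)$ of $(1,2,3)$, $$ \big|\Pr(X_i>X_j>X_k)-\Pr(Y_i>Y_j>Y_k)\big|\le\frac{C}{\phi(q)\log q}. $$ -/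

import Mathlib

open MeasureTheory ProbabilityTheory Filter Topology Complex

/-- The generalized Riemann hypothesis: every zero of every Dirichlet `L`-function in the open
strip `0 < Re s < 1` has real part `1/2`. -/
def GRH : Prop :=
  ∀ (q : ℕ) [NeZero q] (χ : DirichletCharacter ℂ q) (s : ℂ),
    DirichletCharacter.LFunction χ s = 0 → 0 < s.re → s.re < 1 → s.re = 1 / 2

/-- The order of vanishing of `L(s, χ)` at `s = 1/2 + iγ` (it is `0` if there is no zero). -/
noncomputable def zeroMultiplicity {q : ℕ} [NeZero q] (χ : DirichletCharacter ℂ q) (γ : ℝ) : ℕ :=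
  analyticOrderNatAt (DirichletCharacter.LFunction χ) (1 / 2 + γ * I)

/-- The multiset of ordinates `γ > 0` of zeros `1/2 + iγ` of `L(s, χ)`, as a type: an ordinate of
multiplicity `m` gives the `m` elements `(γ, 0), …, (γ, m - 1)`. -/
def UpperZero {q : ℕ} [NeZero q] (χ : DirichletCharacter ℂ q) : Type :=
  {p : ℝ × ℕ // 0 < p.1 ∧ p.2 < zeroMultiplicity χ p.1}

/-- The ordinate `γ` of a zero. -/
def UpperZero.ordinate {q : ℕ} [NeZero q] {χ : DirichletCharacter ℂ q} (z : UpperZero χ) : ℝ :=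
  z.1.1

/-- Only finitely many zeros (with multiplicity) have ordinate in `(0, T)`. -/
theorem UpperZero.finite_ordinate_lt {q : ℕ} [NeZero q] (χ : DirichletCharacter ℂ q) (T : ℝ) :
    {z : UpperZero χ | z.ordinate < T}.Finite := by
  classical
  set f := DirichletCharacter.LFunction χ with hf
  have han : AnalyticOnNhd ℂ f ({1}ᶜ : Set ℂ) := by
    refine DifferentiableOn.analyticOnNhd (fun s hs => ?_) isOpen_compl_singleton
    exact (DirichletCharacter.differentiableAt_LFunction χ s (.inl hs)).differentiableWithinAt
  have hconn : IsConnected ({1}ᶜ : Set ℂ) :=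
    isConnected_compl_singleton_of_one_lt_rank (by simp) 1
  have h2 : f 2 ≠ 0 := DirichletCharacter.LFunction_ne_zero_of_one_le_re χ
    (.inr (by norm_num)) (by norm_num)
  have hcod := han.preimage_zero_mem_codiscreteWithin h2 (by norm_num) hconn
  have hK : IsCompact ((fun t : ℝ => (1 / 2 + t * I : ℂ)) '' Set.Icc 0 T) :=
    isCompact_Icc.image (by fun_prop)
  have hre : ∀ t : ℝ, (1 / 2 + t * I : ℂ) ≠ 1 := by
    intro t h
    have := congrArg Complex.re h
    norm_num at this
  have hsub : (fun t : ℝ => (1 / 2 + t * I : ℂ)) '' Set.Icc 0 T ⊆ ({1}ᶜ : Set ℂ) := by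
    rintro _ ⟨t, -, rfl⟩
    exact hre t
  have hfin := hK.finite_sdiff_of_mem_codiscreteWithin (codiscreteWithin_mono hsub hcod)
  have hfin' : {t : ℝ | t ∈ Set.Icc 0 T ∧ f (1 / 2 + t * I) = 0}.Finite := by
    refine Set.Finite.of_finite_image (f := fun t : ℝ => (1 / 2 + t * I : ℂ))
      (hfin.subset ?_) ?_
    · rintro _ ⟨t, ⟨ht, h0⟩, rfl⟩
      exact ⟨⟨t, ht, rfl⟩, fun h => h h0⟩
    · intro s _ t _ h
      simpa using h
  have hpairs : (⋃ t ∈ {t : ℝ | t ∈ Set.Icc 0 T ∧ f (1 / 2 + t * I) = 0},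
      (fun n : ℕ => (t, n)) '' Set.Iio (zeroMultiplicity χ t)).Finite :=
    hfin'.biUnion fun t _ => (Set.finite_Iio _).image _
  refine Set.Finite.of_finite_image (f := fun z : UpperZero χ => z.1) (hpairs.subset ?_)
    (Subtype.val_injective.injOn)
  rintro _ ⟨z, hz, rfl⟩
  obtain ⟨⟨t, n⟩, ht, hn⟩ := z
  have hzero : f (1 / 2 + t * I) = 0 := by
    by_contra h
    have := (han _ (hre t)).analyticOrderAt_eq_zero.2 h
    simp only [zeroMultiplicity, analyticOrderNatAt, ← hf, this] at hn
    exact absurd hn (by simp)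
  simp only [Set.mem_iUnion]
  exact ⟨t, ⟨⟨ht.le, le_of_lt hz⟩, hzero⟩, n, hn, rfl⟩

/-- `b₊(χ) = ∑_{γ > 0} 1 / (1/4 + γ²)`, zeros counted with multiplicity. -/
noncomputable def bPlus {q : ℕ} [NeZero q] (χ : DirichletCharacter ℂ q) : ℝ :=
  ∑' z : UpperZero χ, 1 / (1 / 4 + z.ordinate ^ 2)

/-- Three distinct reduced residues modulo `q` with the same square. -/
def IsSpecialTriple {q : ℕ} (a : Fin 3 → (ZMod q)ˣ) : Prop :=
  Function.Injective a ∧ ∀ i j, a i ^ 2 = a j ^ 2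

open scoped Classical in
/-- `H_i`: the characters taking a common value at the two residues other than `a i`, and the
negative of that value at `a i`. -/
noncomputable def oddOneOut {q : ℕ} [NeZero q] (a : Fin 3 → (ZMod q)ˣ) (i : Fin 3) :
    Finset (DirichletCharacter ℂ q) :=
  {χ | ∀ j, j ≠ i → χ (a j : ZMod q) = -χ (a i : ZMod q)}

/-- `V_i = 32 ∑_{χ ∈ H_i} b₊(χ)`. -/
noncomputable def raceVariance {q : ℕ} [NeZero q] (a : Fin 3 → (ZMod q)ˣ) (i : Fin 3) : ℝ :=
  32 * ∑ χ ∈ oddOneOut a i, bPlus χ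

/-- The uniform probability distribution on the unit circle of `ℂ`: the law of `e^{iθ}` with `θ`
uniformly distributed on `[0, 2π)`. -/
noncomputable def uniformCircle : Measure ℂ :=
  (ProbabilityTheory.cond volume (Set.Ico (0 : ℝ) (2 * Real.pi))).map
    (fun θ : ℝ => Complex.exp (θ * I))

/-- The sum of `Z_γ / √(1/4 + γ²)` over the zeros with `0 < γ < T`. -/
noncomputable def charPartialSum {q : ℕ} [NeZero q] {Ω : Type*} {χ : DirichletCharacter ℂ q}
    (Z : UpperZero χ → Ω → ℂ) (T : ℝ) (ω : Ω) : ℂ :=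
  ∑ z ∈ (UpperZero.finite_ordinate_lt χ T).toFinset,
    Z z ω / (Real.sqrt (1 / 4 + z.ordinate ^ 2) : ℂ)

/-- `Z_χ = ∑_{γ > 0} Z_γ / √(1/4 + γ²)`, the limit of the partial sums over `0 < γ < T`. -/
noncomputable def charSum {q : ℕ} [NeZero q] {Ω : Type*} {χ : DirichletCharacter ℂ q}
    (Z : UpperZero χ → Ω → ℂ) (ω : Ω) : ℂ :=
  limUnder atTop (fun T : ℝ => charPartialSum Z T ω)

/-- `X_i = 8 ∑_{χ ∈ H_i} Re Z_χ`. -/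
noncomputable def raceVariable {q : ℕ} [NeZero q] {Ω : Type*} (a : Fin 3 → (ZMod q)ˣ)
    (Z : (χ : DirichletCharacter ℂ q) → UpperZero χ → Ω → ℂ) (i : Fin 3) (ω : Ω) : ℝ :=
  8 * ∑ χ ∈ oddOneOut a i, (charSum (Z χ) ω).re

/-!
The theorem has a probabilistic half and an arithmetic half.

*Probability.* Each `X_i` is an infinite sum of independent terms `λ Re ζ` with `ζ` uniform on the
unit circle and `0 ≤ λ ≤ 16`, and the sets `H_i` are pairwise disjoint, so `X_1, X_2, X_3` are
independent. The characteristic function of `Re ζ` is the Bessel function `J₀`, which agrees with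
`exp (-x²/4)` up to `x⁴` near `0` and stays away from `1` in modulus elsewhere. Multiplying over
all terms, the characteristic function of `X_i` is close to the Gaussian one with the same variance
`V_i`, with a relative error of order `V_i t⁴`. There is no term of order `t³` because the law is
symmetric, and this is what yields a Kolmogorov distance `O(1/V_i)` instead of the Berry–Esseen
rate `O(1/√V_i)`; the smoothing inequality uses a Gaussian kernel of variance `1/V_i`
(`abs_real_Iic_sub_gaussianReal_le`). Replacing `X_1, X_2, X_3` by `Y_1, Y_2, Y_3` one at a time
changes the probability of an ordering by at most a multiple of these distances
(`abs_measureReal_ordered_sub_le`).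

*Arithmetic.* It remains to see that `V_i` is at least of order `φ(q) log q`, which needs many low
zeros. Let `ψ` be primitive modulo `N > 1`. The product `Λ(s, ψ) Λ(s, ψ⁻¹)` satisfies a functional
equation relating `s` and `1 - s`, so on a circle of radius `R` about `2` its logarithm is large,
about `2 (1/2 - Re s) log N`, to the left of the critical line, and its mean over the circle is at
least about `(R/2) log N`. The loss where the circle crosses the critical strip is controlled by
averaging over `R` an area integral of `log⁺ (1/|L|)`, itself bounded by Jensen's formula. On the
other hand Jensen's formula expresses the mean through the zeros in the disc, each with a bounded
weight, while the order of a possible zero at `1/2` is `O(log N)` with a constant independent of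
`R`. Taking `R` about `1000` leaves at least a constant times `log N` zeros with `0 < γ ≤ 1001`, and
under GRH all of them count in `b₊(ψ) + b₊(ψ⁻¹)`
(`DirichletCharacter.exists_mul_log_sub_le_bPlus_add`). An imprimitive character has the same zeros
on the critical line as the primitive character inducing it. Finally `H_i` has `φ(q)/4` members, is
closed under inversion, and contains at most `q^{1/4}` characters of conductor at most `q^{1/8}`,
which is negligible against `φ(q)` (`exists_totient_mul_log_le_raceVariance`).

For bounded `q` the probability bound is trivial.
-/

/-! ### The characteristic function of the real part of a uniform point of the unit circle -/

/-- The Bessel function `J₀`, by its integral representation; it is the characteristic function of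
`cos θ` for a uniformly distributed angle `θ`. -/
noncomputable def besselJZero (x : ℝ) : ℝ :=
  Real.pi⁻¹ * ∫ θ in (0 : ℝ)..Real.pi, Real.cos (x * Real.cos θ)

theorem integral_uniformCircle {f : ℂ → ℂ} (hf : Continuous f) :
    ∫ z, f z ∂uniformCircle =
      ((2 * Real.pi)⁻¹ : ℝ) • ∫ θ in (0 : ℝ)..2 * Real.pi, f (Complex.exp (θ * I)) := by
  have h2 : (0 : ℝ) ≤ 2 * Real.pi := by positivity
  rw [uniformCircle, integral_map (by fun_prop) hf.aestronglyMeasurable, ProbabilityTheory.cond,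
    integral_smul_measure, intervalIntegral.integral_of_le h2, integral_Ico_eq_integral_Ioo,
    integral_Ioc_eq_integral_Ioo, Real.volume_Ico, sub_zero, ENNReal.toReal_inv,
    ENNReal.toReal_ofReal h2]

theorem ae_norm_eq_one_uniformCircle : ∀ᵐ z ∂uniformCircle, ‖z‖ = 1 := by
  rw [uniformCircle, ae_map_iff (by fun_prop) (measurableSet_eq_fun (by fun_prop) (by fun_prop))]
  exact Eventually.of_forall fun θ => Complex.norm_exp_ofReal_mul_I θ

theorem integral_id_uniformCircle : ∫ z, z ∂uniformCircle = 0 := by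
  rw [integral_uniformCircle (f := fun z => z) continuous_id]
  have h : ∀ θ : ℝ, Complex.exp (θ * I) = Complex.exp (I * θ) := fun θ => by rw [mul_comm]
  simp_rw [h]
  rw [integral_exp_mul_complex I_ne_zero]
  simp [mul_comm I, Complex.exp_two_pi_mul_I]

theorem integral_comp_cos_two_pi {g : ℝ → ℂ} (hg : Continuous g) :
    ∫ θ in (0 : ℝ)..2 * Real.pi, g (Real.cos θ) =
      2 * ∫ θ in (0 : ℝ)..Real.pi, g (Real.cos θ) := by
  have hi : ∀ a b : ℝ, IntervalIntegrable (fun θ => g (Real.cos θ)) volume a b :=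
    fun a b => (by fun_prop : Continuous fun θ => g (Real.cos θ)).intervalIntegrable a b
  rw [← intervalIntegral.integral_add_adjacent_intervals (hi 0 Real.pi) (hi _ _),
    two_mul (∫ θ in (0 : ℝ)..Real.pi, g (Real.cos θ))]
  congr 1
  have := intervalIntegral.integral_comp_sub_left (a := 0) (b := Real.pi)
    (fun θ => g (Real.cos θ)) (2 * Real.pi)
  simp only [Real.cos_two_pi_sub, sub_zero] at this
  rw [this, show 2 * Real.pi - Real.pi = Real.pi by ring]

theorem integral_exp_re_uniformCircle (x : ℝ) :
    ∫ z, Complex.exp ((x * z.re : ℝ) * I) ∂uniformCircle = besselJZero x := by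
  rw [integral_uniformCircle (by fun_prop)]
  simp only [Complex.exp_ofReal_mul_I_re]
  rw [integral_comp_cos_two_pi (g := fun u => Complex.exp ((x * u : ℝ) * I)) (by fun_prop)]
  have h1 : ∀ θ : ℝ, Complex.exp ((x * Real.cos θ : ℝ) * I) =
      ((Real.cos (x * Real.cos θ) : ℝ) : ℂ) + ((Real.sin (x * Real.cos θ) : ℝ) : ℂ) * I := by
    intro θ
    rw [Complex.exp_mul_I, Complex.ofReal_cos, Complex.ofReal_sin]
  have h2 : ∫ θ in (0 : ℝ)..Real.pi, Real.sin (x * Real.cos θ) = 0 := by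
    have := intervalIntegral.integral_comp_sub_left (a := 0) (b := Real.pi)
      (fun θ => Real.sin (x * Real.cos θ)) Real.pi
    simp only [Real.cos_pi_sub, mul_neg, Real.sin_neg, sub_zero, sub_self,
      intervalIntegral.integral_neg] at this
    linarith
  simp_rw [h1]
  rw [intervalIntegral.integral_add, intervalIntegral.integral_mul_const,
    intervalIntegral.integral_ofReal, intervalIntegral.integral_ofReal, h2, besselJZero]
  · simp only [ofReal_zero, zero_mul, add_zero, real_smul]
    push_cast
    have : (Real.pi : ℂ) ≠ 0 := by exact_mod_cast Real.pi_ne_zero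
    field_simp
  · exact (by fun_prop : Continuous _).intervalIntegrable _ _
  · exact (by fun_prop : Continuous _).intervalIntegrable _ _

theorem abs_sin_div_le (x : ℝ) : |Real.sin x / x| ≤ 1 - min (x ^ 2) 1 / 10 := by
  rcases eq_or_ne x 0 with rfl | hx
  · simp
  rcases le_or_gt |x| 2 with h2 | h2
  · have hc : |Real.sin x / x| ≤ |Real.cos (x / 2)| := by
      have : Real.sin x = 2 * Real.sin (x / 2) * Real.cos (x / 2) := by
        rw [← Real.sin_two_mul]; congr 1; ring
      rw [this, abs_div, abs_mul, abs_mul, abs_two, div_le_iff₀ (abs_pos.2 hx)]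
      have h := Real.abs_sin_le_abs (x := x / 2)
      rw [abs_div, abs_two] at h
      nlinarith [abs_nonneg (Real.cos (x / 2))]
    have hx1 : |x / 2| ≤ 1 := by rw [abs_div, abs_two]; linarith
    have hb := Real.cos_bound hx1
    have hx2 : x ^ 2 ≤ 4 := by nlinarith [abs_nonneg x, sq_abs x]
    have hc0 : 0 ≤ Real.cos (x / 2) := by
      refine Real.cos_nonneg_of_mem_Icc ⟨?_, ?_⟩ <;>
        nlinarith [abs_le.1 hx1, Real.pi_gt_three]
    rw [abs_of_nonneg hc0] at hc
    have h4 : |x / 2| ^ 4 = x ^ 4 / 16 := by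
      rw [← abs_pow, abs_of_nonneg (by positivity)]; ring
    rw [h4] at hb
    have := (abs_le.1 hb).2
    have := min_le_left (x ^ 2) 1
    nlinarith [sq_nonneg x, mul_nonneg (sq_nonneg x) (sub_nonneg.2 hx2)]
  · have h1 : |Real.sin x / x| ≤ 1 / 2 := by
      rw [abs_div, div_le_div_iff₀ (abs_pos.2 hx) two_pos]
      linarith [Real.abs_sin_le_one x]
    linarith [min_le_right (x ^ 2) 1]

/-- `J₀` stays away from `±1` off the origin: the law of `cos θ` has density at least `1 / π` on
`[-1, 1]`, and the uniform law contributes `sin x / x`. -/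
theorem abs_besselJZero_le (x : ℝ) :
    |besselJZero x| ≤ Real.exp (-(min (x ^ 2) 1) / 16) := by
  have hp := Real.pi_pos
  have hm : 0 ≤ min (x ^ 2) 1 := le_min (sq_nonneg x) zero_le_one
  rcases eq_or_ne x 0 with rfl | hx
  · simp [besselJZero, hp.ne']
  have hi1 : IntervalIntegrable (fun θ => Real.cos (x * Real.cos θ) * (1 - Real.sin θ)) volume 0
      Real.pi := (by fun_prop : Continuous _).intervalIntegrable _ _
  have hi2 : IntervalIntegrable (fun θ => Real.cos (x * Real.cos θ) * Real.sin θ) volume 0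
      Real.pi := (by fun_prop : Continuous _).intervalIntegrable _ _
  have hsplit : ∫ θ in (0 : ℝ)..Real.pi, Real.cos (x * Real.cos θ) =
      (∫ θ in (0 : ℝ)..Real.pi, Real.cos (x * Real.cos θ) * (1 - Real.sin θ)) +
        ∫ θ in (0 : ℝ)..Real.pi, Real.cos (x * Real.cos θ) * Real.sin θ := by
    rw [← intervalIntegral.integral_add hi1 hi2]
    congr 1; ext θ; ring
  have hs : ∫ θ in (0 : ℝ)..Real.pi, Real.cos (x * Real.cos θ) * Real.sin θ =
      2 * (Real.sin x / x) := by
    have hd : ∀ θ ∈ Set.uIcc 0 Real.pi,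
        HasDerivAt (fun θ => -(Real.sin (x * Real.cos θ) / x))
          (Real.cos (x * Real.cos θ) * Real.sin θ) θ := by
      intro θ _
      have := ((Real.hasDerivAt_cos θ).const_mul x).sin.div_const x |>.neg
      convert! this using 1
      field_simp
    rw [intervalIntegral.integral_eq_sub_of_hasDerivAt hd hi2]
    simp
    ring
  have hb : |∫ θ in (0 : ℝ)..Real.pi, Real.cos (x * Real.cos θ) * (1 - Real.sin θ)| ≤
      Real.pi - 2 := by
    have h1 : ∫ θ in (0 : ℝ)..Real.pi, (1 - Real.sin θ) = Real.pi - 2 := by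
      rw [intervalIntegral.integral_sub (by simp) (by simp)]
      simp
      norm_num
    rw [← h1, ← Real.norm_eq_abs]
    refine intervalIntegral.norm_integral_le_of_norm_le hp.le (ae_of_all _ fun θ _ => ?_)
      ((by fun_prop : Continuous _).intervalIntegrable _ _)
    rw [norm_mul, Real.norm_eq_abs, Real.norm_eq_abs,
      abs_of_nonneg (sub_nonneg.2 (Real.sin_le_one θ))]
    nlinarith [Real.abs_cos_le_one (x * Real.cos θ), Real.sin_le_one θ]
  have hJ : |besselJZero x| ≤ Real.pi⁻¹ * (Real.pi - 2 + 2 * (1 - min (x ^ 2) 1 / 10)) := by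
    rw [besselJZero, hsplit, hs, abs_mul, abs_of_pos (inv_pos.2 hp)]
    refine mul_le_mul_of_nonneg_left ((abs_add_le _ _).trans (add_le_add hb ?_))
      (inv_pos.2 hp).le
    rw [abs_mul, abs_two]
    linarith [abs_sin_div_le x]
  refine hJ.trans (le_trans ?_ (Real.add_one_le_exp _))
  rw [inv_mul_le_iff₀ hp]
  nlinarith [Real.pi_lt_d2]

/-- Near the origin `J₀` agrees with a Gaussian up to a fourth order error; there is no third order
term by symmetry. -/
theorem abs_besselJZero_sub_exp_le {x : ℝ} (hx : |x| ≤ 1) :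
    |besselJZero x - Real.exp (-(x ^ 2) / 4)| ≤ x ^ 4 := by
  have hp := Real.pi_pos
  have h2 : ∫ θ in (0 : ℝ)..Real.pi, (1 - (x * Real.cos θ) ^ 2 / 2) =
      Real.pi * (1 - x ^ 2 / 4) := by
    have : ∀ θ : ℝ, 1 - (x * Real.cos θ) ^ 2 / 2 = 1 - x ^ 2 / 2 * Real.cos θ ^ 2 := fun θ => by
      ring
    simp_rw [this]
    rw [intervalIntegral.integral_sub (by simp)
      ((by fun_prop : Continuous _).intervalIntegrable _ _), intervalIntegral.integral_const_mul,
      integral_cos_sq]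
    simp
    ring
  have h1 : |besselJZero x - (1 - x ^ 2 / 4)| ≤ x ^ 4 * (5 / 96) := by
    have : besselJZero x - (1 - x ^ 2 / 4) = Real.pi⁻¹ *
        ∫ θ in (0 : ℝ)..Real.pi, (Real.cos (x * Real.cos θ) - (1 - (x * Real.cos θ) ^ 2 / 2)) := by
      rw [intervalIntegral.integral_sub ((by fun_prop : Continuous _).intervalIntegrable _ _)
        ((by fun_prop : Continuous _).intervalIntegrable _ _), h2, besselJZero]
      field_simp
    rw [this, abs_mul, abs_of_pos (inv_pos.2 hp), inv_mul_le_iff₀ hp]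
    have h := intervalIntegral.norm_integral_le_of_norm_le_const (a := 0) (b := Real.pi)
      (C := x ^ 4 * (5 / 96))
      (f := fun θ => Real.cos (x * Real.cos θ) - (1 - (x * Real.cos θ) ^ 2 / 2)) ?_
    · rw [sub_zero, abs_of_pos hp] at h
      rw [← Real.norm_eq_abs]
      linarith
    · intro θ _
      have hxc : |x * Real.cos θ| ≤ |x| := by
        rw [abs_mul]
        exact mul_le_of_le_one_right (abs_nonneg x) (Real.abs_cos_le_one θ)
      rw [Real.norm_eq_abs]
      refine (Real.cos_bound (hxc.trans hx)).trans ?_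
      have : |x * Real.cos θ| ^ 4 ≤ |x| ^ 4 := pow_le_pow_left₀ (abs_nonneg _) hxc 4
      have h4 : |x| ^ 4 = x ^ 4 := by rw [← abs_pow, abs_of_nonneg (by positivity)]
      rw [h4] at this
      linarith
  have h3 : |Real.exp (-(x ^ 2) / 4) - 1 - -(x ^ 2) / 4| ≤ (-(x ^ 2) / 4) ^ 2 := by
    refine Real.abs_exp_sub_one_sub_id_le ?_
    rw [neg_div, abs_neg, abs_of_nonneg (by positivity)]
    nlinarith [sq_abs x, abs_nonneg x]
  rw [abs_le] at *
  constructor <;> nlinarith [sq_nonneg (x ^ 2)]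

/-! ### Products of Bessel functions against a Gaussian -/

theorem abs_prod_sub_prod_le {ι : Type*} (s : Finset ι) {a b M : ι → ℝ}
    (hM : ∀ k ∈ s, 0 < M k) (ha : ∀ k ∈ s, |a k| ≤ M k) (hb : ∀ k ∈ s, |b k| ≤ M k) :
    |∏ k ∈ s, a k - ∏ k ∈ s, b k| ≤ (∑ k ∈ s, |a k - b k| / M k) * ∏ k ∈ s, M k := by
  classical
  induction s using Finset.induction_on with
  | empty => simp
  | insert k s hk ih =>
    simp only [Finset.mem_insert, forall_eq_or_imp] at hM ha hb
    have ih := ih hM.2 ha.2 hb.2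
    rw [Finset.prod_insert hk, Finset.prod_insert hk, Finset.prod_insert hk,
      Finset.sum_insert hk]
    have hP : |∏ k ∈ s, a k| ≤ ∏ k ∈ s, M k := by
      rw [Finset.abs_prod]
      exact Finset.prod_le_prod (fun _ _ => abs_nonneg _) ha.2
    have h1 : a k * ∏ k ∈ s, a k - b k * ∏ k ∈ s, b k =
        (a k - b k) * ∏ k ∈ s, a k + b k * (∏ k ∈ s, a k - ∏ k ∈ s, b k) := by ring
    rw [h1]
    refine (abs_add_le _ _).trans ?_
    rw [abs_mul, abs_mul]
    have hMk := hM.1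
    calc |a k - b k| * |∏ k ∈ s, a k| + |b k| * |∏ k ∈ s, a k - ∏ k ∈ s, b k|
        ≤ |a k - b k| * ∏ k ∈ s, M k +
          M k * ((∑ k ∈ s, |a k - b k| / M k) * ∏ k ∈ s, M k) := by
          gcongr
          exact hb.1
      _ = _ := by field_simp

theorem abs_prod_besselJZero_le {ι : Type*} (s : Finset ι) {l : ι → ℝ}
    (hl : ∀ k ∈ s, l k ^ 2 ≤ 256) (t : ℝ) :
    |∏ k ∈ s, besselJZero (t * l k)| ≤
      Real.exp (-((∑ k ∈ s, l k ^ 2 / 2) / 2048 * min (256 * t ^ 2) 1)) := by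
  rw [Finset.abs_prod, Finset.sum_div, Finset.sum_mul, ← Finset.sum_neg_distrib, Real.exp_sum]
  refine Finset.prod_le_prod (fun _ _ => abs_nonneg _) fun k hk => ?_
  refine (abs_besselJZero_le _).trans (Real.exp_le_exp.2 ?_)
  have hk := hl k hk
  have : l k ^ 2 / 256 * min (256 * t ^ 2) 1 ≤ min ((t * l k) ^ 2) 1 := by
    refine le_min ?_ ?_
    · calc l k ^ 2 / 256 * min (256 * t ^ 2) 1 ≤ l k ^ 2 / 256 * (256 * t ^ 2) := by
            gcongr; exact min_le_left _ _
        _ = _ := by ring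
    · calc l k ^ 2 / 256 * min (256 * t ^ 2) 1 ≤ l k ^ 2 / 256 * 1 := by
            gcongr; exact min_le_right _ _
        _ ≤ 1 := by linarith
  linarith

theorem abs_prod_besselJZero_sub_exp_le {ι : Type*} (s : Finset ι) {l : ι → ℝ}
    (hl : ∀ k ∈ s, l k ^ 2 ≤ 256) {t : ℝ} (ht : |t| ≤ 1 / 16) :
    |∏ k ∈ s, besselJZero (t * l k) - Real.exp (-((∑ k ∈ s, l k ^ 2 / 2) * t ^ 2 / 2))| ≤
      1024 * (∑ k ∈ s, l k ^ 2 / 2) * t ^ 4 * Real.exp (-((∑ k ∈ s, l k ^ 2 / 2) * t ^ 2 / 8)) := by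
  have ht2 : t ^ 2 ≤ 1 / 256 := by
    rw [← sq_abs]; nlinarith [abs_nonneg t]
  have htl : ∀ k ∈ s, (t * l k) ^ 2 ≤ 1 := fun k hk => by
    rw [mul_pow]; nlinarith [hl k hk, sq_nonneg t, sq_nonneg (l k)]
  have hprod : Real.exp (-((∑ k ∈ s, l k ^ 2 / 2) * t ^ 2 / 2)) =
      ∏ k ∈ s, Real.exp (-((t * l k) ^ 2) / 4) := by
    rw [← Real.exp_sum, Finset.sum_mul, Finset.sum_div, ← Finset.sum_neg_distrib]
    congr 1
    exact Finset.sum_congr rfl fun k _ => by ring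
  have hM : ∏ k ∈ s, Real.exp (-((t * l k) ^ 2) / 16) =
      Real.exp (-((∑ k ∈ s, l k ^ 2 / 2) * t ^ 2 / 8)) := by
    rw [← Real.exp_sum, Finset.sum_mul, Finset.sum_div, ← Finset.sum_neg_distrib]
    congr 1
    exact Finset.sum_congr rfl fun k _ => by ring
  rw [hprod]
  refine (abs_prod_sub_prod_le s (M := fun k => Real.exp (-((t * l k) ^ 2) / 16))
    (fun _ _ => Real.exp_pos _) (fun k hk => ?_) (fun k _ => ?_)).trans ?_
  · have := abs_besselJZero_le (t * l k)
    rwa [min_eq_left (htl k hk)] at this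
  · rw [Real.abs_exp]
    exact Real.exp_le_exp.2 (by nlinarith [sq_nonneg (t * l k)])
  · rw [hM]
    refine mul_le_mul_of_nonneg_right ?_ (Real.exp_pos _).le
    rw [Finset.mul_sum, Finset.sum_mul]
    refine Finset.sum_le_sum fun k hk => ?_
    rw [div_le_iff₀ (Real.exp_pos _)]
    have h1 : |t * l k| ≤ 1 := abs_le_one_iff_mul_self_le_one.2 (by
      have := htl k hk; nlinarith)
    refine (abs_besselJZero_sub_exp_le h1).trans ?_
    have h2 : (1 : ℝ) / 2 ≤ Real.exp (-((t * l k) ^ 2) / 16) := by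
      refine le_trans ?_ (Real.add_one_le_exp _)
      linarith [htl k hk]
    have h3 : 0 ≤ t ^ 4 * l k ^ 2 := by positivity
    have h4 : (t * l k) ^ 4 ≤ 256 * (t ^ 4 * l k ^ 2) := by
      have : (t * l k) ^ 4 = t ^ 4 * l k ^ 2 * l k ^ 2 := by ring
      rw [this]; nlinarith [hl k hk]
    nlinarith [mul_le_mul_of_nonneg_left h2 h3]

/-! ### Kolmogorov distance to a Gaussian from characteristic function bounds -/

theorem integral_charFun_gaussianReal_sub (μ : Measure ℝ) [IsProbabilityMeasure μ] (v : NNReal)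
    (x : ℝ) :
    ((∫ y, Real.exp (-(v * (x - y) ^ 2 / 2)) ∂μ : ℝ) : ℂ) =
      ∫ t, Complex.exp (-(t * x * I)) * charFun μ t ∂gaussianReal 0 v := by
  have h1 : ∀ y : ℝ, ((Real.exp (-(v * (x - y) ^ 2 / 2)) : ℝ) : ℂ) =
      ∫ t, Complex.exp ((t * (y - x) : ℝ) * I) ∂gaussianReal 0 v := by
    intro y
    have := charFun_gaussianReal (μ := 0) (v := v) (y - x)
    rw [charFun_apply_real] at this
    rw [show (∫ t, Complex.exp ((t * (y - x) : ℝ) * I) ∂gaussianReal 0 v) =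
      ∫ t : ℝ, Complex.exp (((y - x : ℝ) : ℂ) * t * I) ∂gaussianReal 0 v by
        congr 1; ext t; push_cast; ring_nf, this]
    push_cast
    congr 1
    ring
  rw [← integral_complex_ofReal]
  simp_rw [h1, charFun_apply_real]
  rw [integral_integral_swap]
  · congr 1; ext t
    rw [← integral_const_mul]
    congr 1; ext y
    rw [← Complex.exp_add]
    congr 1; push_cast; ring
  · refine Integrable.of_bound (C := 1) (by fun_prop) (ae_of_all _ fun p => ?_)
    simp only [Function.uncurry, Complex.norm_exp_ofReal_mul_I, le_refl]

theorem gaussianReal_Iic_dist_le {v : NNReal} (hv : v ≠ 0) (z : ℝ) :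
    |(Set.Ici (0 : ℝ)).indicator 1 z - (gaussianReal 0 v⁻¹).real (Set.Iic z)| ≤
      Real.exp (-(v * z ^ 2 / 2)) := by
  have hv0 : (0 : ℝ) < v := by positivity
  have key : ∀ t : ℝ, mgf id (gaussianReal 0 v⁻¹) t = Real.exp (t ^ 2 / (2 * v)) := fun t => by
    simp only [mgf_id_gaussianReal]
    congr 1
    push_cast
    field_simp
    ring
  rcases le_or_gt 0 z with h | h
  · have h1 : (gaussianReal 0 v⁻¹).real (Set.Iic z) =
        1 - (gaussianReal 0 v⁻¹).real (Set.Ioi z) := by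
      rw [← Set.compl_Iic, probReal_compl_eq_one_sub measurableSet_Iic, sub_sub_cancel]
    rw [Set.indicator_of_mem (by exact h), h1]
    simp only [Pi.one_apply, sub_sub_cancel, abs_of_nonneg measureReal_nonneg]
    have := measure_ge_le_exp_mul_mgf (μ := gaussianReal 0 v⁻¹) (X := id) (t := v * z) z
      (by positivity) (integrable_exp_mul_gaussianReal _)
    rw [key, ← Real.exp_add] at this
    refine (measureReal_mono (fun y hy => ?_)).trans (this.trans (Real.exp_le_exp.2 ?_))
    · exact (Set.mem_Ioi.1 hy).le
    · field_simp; nlinarith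
  · rw [Set.indicator_of_notMem (by exact not_le.2 h), zero_sub, abs_neg,
      abs_of_nonneg measureReal_nonneg]
    have := measure_le_le_exp_mul_mgf (μ := gaussianReal 0 v⁻¹) (X := id) (t := v * z) z
      (by nlinarith) (integrable_exp_mul_gaussianReal _)
    rw [key, ← Real.exp_add] at this
    refine (measureReal_mono (fun y hy => ?_)).trans (this.trans (Real.exp_le_exp.2 ?_))
    · exact hy
    · field_simp; nlinarith

theorem real_conv_apply (μ ν : Measure ℝ) [IsProbabilityMeasure μ] [IsProbabilityMeasure ν]
    {s : Set ℝ} (hs : MeasurableSet s) :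
    (μ ∗ ν).real s = ∫ y, ν.real ((fun z => y + z) ⁻¹' s) ∂μ := by
  have hm : Measurable fun y => ν ((fun z => y + z) ⁻¹' s) :=
    measurable_measure_prodMk_left (ν := ν)
      (s := (fun p : ℝ × ℝ => p.1 + p.2) ⁻¹' s) (measurable_add hs)
  rw [measureReal_def, Measure.conv, Measure.map_apply (by fun_prop) hs,
    Measure.prod_apply (measurable_add hs)]
  simp only [measureReal_def]
  rw [integral_toReal hm.aemeasurable (ae_of_all _ fun _ => measure_lt_top _ _)]
  rfl

/-- Smoothing a law by a Gaussian of variance `1 / v` moves its distribution function by at most an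
average of its characteristic function. -/
theorem abs_real_Iic_sub_conv_le (μ : Measure ℝ) [IsProbabilityMeasure μ] {v : NNReal}
    (hv : v ≠ 0) (x : ℝ) :
    |μ.real (Set.Iic x) - (μ ∗ gaussianReal 0 v⁻¹).real (Set.Iic x)| ≤
      ∫ t, ‖charFun μ t‖ ∂gaussianReal 0 v := by
  have hpre : ∀ y : ℝ, (fun z => y + z) ⁻¹' Set.Iic x = Set.Iic (x - y) := fun y => by
    ext z; simp [le_sub_iff_add_le']
  have hind : μ.real (Set.Iic x) = ∫ y, (Set.Ici (0 : ℝ)).indicator 1 (x - y) ∂μ := by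
    rw [← integral_indicator_one measurableSet_Iic]
    congr 1; ext y
    simp [Set.indicator_apply]
  rw [real_conv_apply _ _ measurableSet_Iic, hind]
  simp_rw [hpre]
  have hmono : Monotone fun z => (gaussianReal 0 v⁻¹).real (Set.Iic z) := fun a b hab =>
    measureReal_mono (Set.Iic_subset_Iic.2 hab)
  have hm1 : Measurable fun y : ℝ => (Set.Ici (0 : ℝ)).indicator (1 : ℝ → ℝ) (x - y) :=
    (measurable_one.indicator measurableSet_Ici).comp (by fun_prop)
  have hm2 : Measurable fun y : ℝ => (gaussianReal 0 v⁻¹).real (Set.Iic (x - y)) :=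
    hmono.measurable.comp (by fun_prop)
  rw [← integral_sub]
  · calc |∫ y, ((Set.Ici (0 : ℝ)).indicator 1 (x - y) -
            (gaussianReal 0 v⁻¹).real (Set.Iic (x - y))) ∂μ|
        ≤ ∫ y, Real.exp (-(v * (x - y) ^ 2 / 2)) ∂μ := by
          rw [← Real.norm_eq_abs]
          refine norm_integral_le_of_norm_le ?_ (ae_of_all _ fun y =>
            gaussianReal_Iic_dist_le hv (x - y))
          refine Integrable.of_bound (C := 1) (by fun_prop) (ae_of_all _ fun y => ?_)
          rw [Real.norm_eq_abs, Real.abs_exp, Real.exp_le_one_iff]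
          have := v.2
          nlinarith [mul_nonneg this (sq_nonneg (x - y))]
      _ ≤ |∫ y, Real.exp (-(v * (x - y) ^ 2 / 2)) ∂μ| := le_abs_self _
      _ = ‖∫ t, Complex.exp (-(t * x * I)) * charFun μ t ∂gaussianReal 0 v‖ := by
          rw [← integral_charFun_gaussianReal_sub, Complex.norm_real, Real.norm_eq_abs]
      _ ≤ ∫ t, ‖Complex.exp (-(t * x * I)) * charFun μ t‖ ∂gaussianReal 0 v :=
          norm_integral_le_integral_norm _
      _ = ∫ t, ‖charFun μ t‖ ∂gaussianReal 0 v := by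
          congr 1; ext t
          rw [norm_mul, show -((t : ℂ) * x * I) = ((-(t * x) : ℝ) : ℂ) * I by push_cast; ring,
            Complex.norm_exp_ofReal_mul_I, one_mul]
  · refine Integrable.of_bound (C := 1) hm1.aestronglyMeasurable (ae_of_all _ fun y => ?_)
    rw [Set.indicator_apply]
    split_ifs <;> simp
  · refine Integrable.of_bound (C := 1) hm2.aestronglyMeasurable (ae_of_all _ fun y => ?_)
    rw [Real.norm_eq_abs, abs_of_nonneg measureReal_nonneg]
    exact measureReal_le_one

theorem gaussianReal_real_Ioc {v : NNReal} (hv : v ≠ 0) {a x : ℝ} (y : ℝ) :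
    (gaussianReal 0 v⁻¹).real ((fun z => y + z) ⁻¹' Set.Ioc a x) =
      ∫ u in Set.Ioc a x, Real.sqrt v / Real.sqrt (2 * Real.pi) *
        Real.exp (-(v * (u - y) ^ 2 / 2)) := by
  have hv0 : (0 : ℝ) < v := by positivity
  have hmap : (gaussianReal 0 v⁻¹).map (fun z => y + z) = gaussianReal y v⁻¹ := by
    rw [gaussianReal_map_const_add, zero_add]
  rw [← map_measureReal_apply (by fun_prop) measurableSet_Ioc, hmap, measureReal_def,
    gaussianReal_apply_eq_integral _ (inv_ne_zero hv),
    ENNReal.toReal_ofReal (integral_nonneg fun _ => gaussianPDFReal_nonneg _ _ _)]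
  congr 1; ext u
  rw [gaussianPDFReal]
  congr 1
  · push_cast
    rw [← div_eq_mul_inv, Real.sqrt_div (by positivity), inv_div]
  · congr 1
    push_cast
    field_simp

theorem ofReal_conv_gaussianReal_real_Ioc (μ : Measure ℝ) [IsProbabilityMeasure μ] {v : NNReal}
    (hv : v ≠ 0) (a x : ℝ) :
    (((μ ∗ gaussianReal 0 v⁻¹).real (Set.Ioc a x) : ℝ) : ℂ) =
      ∫ u in Set.Ioc a x, ((Real.sqrt v / Real.sqrt (2 * Real.pi) : ℝ) : ℂ) *
        ∫ t, Complex.exp (-(t * u * I)) * charFun μ t ∂gaussianReal 0 v := by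
  rw [real_conv_apply _ _ measurableSet_Ioc]
  simp_rw [gaussianReal_real_Ioc hv, ← integral_charFun_gaussianReal_sub]
  rw [integral_integral_swap]
  · rw [← integral_complex_ofReal]
    congr 1; ext u
    rw [integral_const_mul, Complex.ofReal_mul]
  · refine Integrable.of_bound (C := Real.sqrt v / Real.sqrt (2 * Real.pi)) (by fun_prop)
      (ae_of_all _ fun p => ?_)
    simp only [Function.uncurry, norm_mul, Real.norm_eq_abs, Real.abs_exp]
    rw [abs_of_nonneg (by positivity)]
    refine mul_le_of_le_one_right (by positivity) (Real.exp_le_one_iff.2 ?_)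
    have := v.2
    nlinarith [mul_nonneg this (sq_nonneg (p.2 - p.1))]

theorem abs_mul_norm_integral_exp_le (a x t : ℝ) :
    |t| * ‖∫ u in a..x, Complex.exp (-(t * u * I))‖ ≤ 2 := by
  rcases eq_or_ne t 0 with rfl | ht
  · simp
  have hc : -((t : ℂ) * I) ≠ 0 := by simp [ht]
  have h : ∀ u : ℝ, Complex.exp (-(t * u * I)) = Complex.exp (-((t : ℂ) * I) * u) := fun u => by
    congr 1; ring
  have hn : ∀ u : ℝ, ‖Complex.exp (-((t : ℂ) * I) * u)‖ = 1 := fun u => by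
    rw [show -((t : ℂ) * I) * u = ((-(t * u) : ℝ) : ℂ) * I by push_cast; ring,
      Complex.norm_exp_ofReal_mul_I]
  simp_rw [h]
  rw [integral_exp_mul_complex hc, norm_div, norm_neg, norm_mul, Complex.norm_I, mul_one,
    Complex.norm_real, Real.norm_eq_abs, mul_div_cancel₀ _ (abs_pos.2 ht).ne']
  refine (norm_sub_le _ _).trans ?_
  rw [hn, hn]
  norm_num

/-- Esseen's smoothing inequality, with a Gaussian kernel: the smoothed distribution functions
differ by at most a weighted `L¹` distance of the characteristic functions. The weight `2 / |t|` is
hidden in the hypothesis on the majorant `B`. -/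
theorem abs_conv_real_Iic_sub_le (μ ν : Measure ℝ) [IsProbabilityMeasure μ]
    [IsProbabilityMeasure ν] {v : NNReal} (hv : v ≠ 0) {B : ℝ → ℝ}
    (hBi : Integrable B (gaussianReal 0 v))
    (hB : ∀ t w : ℝ, 0 ≤ w → |t| * w ≤ 2 → ‖charFun μ t - charFun ν t‖ * w ≤ B t) (x : ℝ) :
    |(μ ∗ gaussianReal 0 v⁻¹).real (Set.Iic x) - (ν ∗ gaussianReal 0 v⁻¹).real (Set.Iic x)| ≤
      Real.sqrt v / Real.sqrt (2 * Real.pi) * ∫ t, B t ∂gaussianReal 0 v := by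
  have hlim : ∀ ξ : Measure ℝ, IsProbabilityMeasure ξ →
      Tendsto (fun a => (ξ ∗ gaussianReal 0 v⁻¹).real (Set.Ioc a x)) atBot
        (𝓝 ((ξ ∗ gaussianReal 0 v⁻¹).real (Set.Iic x))) := fun ξ _ =>
    (ENNReal.tendsto_toReal (measure_ne_top _ _)).comp (tendsto_measure_Ioc_atBot _ _)
  refine le_of_tendsto ((hlim μ inferInstance).sub (hlim ν inferInstance)).abs ?_
  filter_upwards [eventually_le_atBot x] with a hax
  rw [← Real.norm_eq_abs, ← Complex.norm_real, Complex.ofReal_sub,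
    ofReal_conv_gaussianReal_real_Ioc μ hv, ofReal_conv_gaussianReal_real_Ioc ν hv,
    integral_const_mul, integral_const_mul, ← mul_sub, norm_mul, Complex.norm_real,
    Real.norm_eq_abs, abs_of_nonneg (by positivity)]
  refine mul_le_mul_of_nonneg_left ?_ (by positivity)
  have hint : ∀ ξ : Measure ℝ, IsProbabilityMeasure ξ →
      Integrable (Function.uncurry fun (u t : ℝ) => Complex.exp (-(t * u * I)) * charFun ξ t)
        ((volume.restrict (Set.Ioc a x)).prod (gaussianReal 0 v)) := by
    intro ξ _
    refine Integrable.of_bound (C := 1) ?_ (ae_of_all _ fun p => ?_)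
    · have : Measurable fun p : ℝ × ℝ => charFun ξ p.2 := measurable_charFun.comp measurable_snd
      exact (Measurable.mul (by fun_prop) this).aestronglyMeasurable
    · simp only [Function.uncurry, norm_mul]
      rw [show -((p.2 : ℂ) * p.1 * I) = ((-(p.2 * p.1) : ℝ) : ℂ) * I by push_cast; ring,
        Complex.norm_exp_ofReal_mul_I, one_mul]
      exact norm_charFun_le_one _
  have hswap : ∀ ξ : Measure ℝ, IsProbabilityMeasure ξ →
      (∫ u in Set.Ioc a x, ∫ t, Complex.exp (-(t * u * I)) * charFun ξ t ∂gaussianReal 0 v) =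
        ∫ t, (∫ u in a..x, Complex.exp (-(t * u * I))) * charFun ξ t ∂gaussianReal 0 v := by
    intro ξ _
    rw [integral_integral_swap (hint ξ inferInstance)]
    congr 1; ext t
    rw [integral_mul_const, intervalIntegral.integral_of_le hax]
  have hint' : ∀ ξ : Measure ℝ, IsProbabilityMeasure ξ →
      Integrable (fun t : ℝ => (∫ u in a..x, Complex.exp (-(t * u * I))) * charFun ξ t)
        (gaussianReal 0 v) := by
    intro ξ _
    refine (hint ξ inferInstance).integral_prod_right.congr (ae_of_all _ fun t => ?_)
    simp only [Function.uncurry]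
    rw [integral_mul_const, intervalIntegral.integral_of_le hax]
  rw [hswap μ inferInstance, hswap ν inferInstance,
    ← integral_sub (hint' μ inferInstance) (hint' ν inferInstance)]
  refine norm_integral_le_of_norm_le hBi (ae_of_all _ fun t => ?_)
  rw [← mul_sub, norm_mul, mul_comm]
  exact hB t _ (norm_nonneg _) (abs_mul_norm_integral_exp_le a x t)

theorem integral_exp_gaussianReal_le {v : NNReal} (hv : v ≠ 0) :
    ∫ t, Real.exp (-(v * t ^ 2 / 16)) ∂gaussianReal 0 v ≤ 3 / v := by
  have hv0 : (0 : ℝ) < v := by positivity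
  rw [integral_gaussianReal_eq_integral_smul hv]
  have hg : Integrable fun t : ℝ => Real.exp (-((v : ℝ) / 16) * t ^ 2) :=
    integrable_exp_neg_mul_sq (by positivity)
  have hpdf : ∀ t, gaussianPDFReal 0 v t ≤ (Real.sqrt (2 * Real.pi * v))⁻¹ := fun t => by
    rw [gaussianPDFReal]
    refine mul_le_of_le_one_right (by positivity) (Real.exp_le_one_iff.2 ?_)
    rw [neg_div]
    exact neg_nonpos.2 (by positivity)
  calc ∫ t, gaussianPDFReal 0 v t • Real.exp (-(v * t ^ 2 / 16))
      ≤ ∫ t, (Real.sqrt (2 * Real.pi * v))⁻¹ * Real.exp (-((v : ℝ) / 16) * t ^ 2) := by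
        refine integral_mono_of_nonneg (ae_of_all _ fun t => ?_) (hg.const_mul _)
          (ae_of_all _ fun t => ?_)
        · exact smul_nonneg (gaussianPDFReal_nonneg _ _ _) (Real.exp_pos _).le
        · simp only [smul_eq_mul]
          rw [show -((v : ℝ) * t ^ 2 / 16) = -((v : ℝ) / 16) * t ^ 2 by ring]
          gcongr
          exact hpdf t
    _ = (Real.sqrt (2 * Real.pi * v))⁻¹ * Real.sqrt (Real.pi / (v / 16)) := by
        rw [integral_const_mul, integral_gaussian]
    _ ≤ 3 / v := by
        rw [← Real.sqrt_inv, ← Real.sqrt_mul (by positivity), Real.sqrt_le_iff]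
        refine ⟨by positivity, ?_⟩
        have hp := Real.pi_pos
        rw [div_pow, show (2 * Real.pi * (v : ℝ))⁻¹ * (Real.pi / (v / 16)) = 8 / v ^ 2 by
          field_simp; norm_num]
        gcongr
        norm_num

/-- A law whose characteristic function is close to that of a centred Gaussian of variance `v`, with
no third order term near the origin and exponentially small beyond, has Kolmogorov distance `O(1/v)`
to it. The constant is not optimised. -/
theorem abs_real_Iic_sub_gaussianReal_le {μ : Measure ℝ} [IsProbabilityMeasure μ] {v : NNReal}
    (hv : 1 ≤ v)
    (h1 : ∀ t : ℝ, |t| ≤ 1 / 16 → ‖charFun μ t - Real.exp (-(v * t ^ 2 / 2))‖ ≤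
      1024 * v * t ^ 4 * Real.exp (-(v * t ^ 2 / 8)))
    (h2 : ∀ t : ℝ, ‖charFun μ t‖ ≤ Real.exp (-(v / 2048 * min (256 * t ^ 2) 1))) (x : ℝ) :
    |μ.real (Set.Iic x) - (gaussianReal 0 v).real (Set.Iic x)| ≤ 2 ^ 40 / v := by
  have hv' : v ≠ 0 := (zero_lt_one.trans_le hv).ne'
  have hv1 : (1 : ℝ) ≤ v := by exact_mod_cast hv
  have hv0 : (0 : ℝ) < v := by linarith
  have hgc : ∀ t : ℝ, charFun (gaussianReal 0 v) t =
      (Real.exp (-(v * t ^ 2 / 2)) : ℝ) := fun t => by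
    rw [charFun_gaussianReal]; push_cast; congr 1; ring
  have h2g : ∀ t : ℝ, ‖charFun (gaussianReal 0 v) t‖ ≤
      Real.exp (-(v / 2048 * min (256 * t ^ 2) 1)) := fun t => by
    rw [hgc, Complex.norm_real, Real.norm_eq_abs, Real.abs_exp]
    refine Real.exp_le_exp.2 (neg_le_neg ?_)
    have := min_le_left (256 * t ^ 2) 1
    have := mul_le_mul_of_nonneg_left this (by positivity : (0 : ℝ) ≤ v / 2048)
    nlinarith [mul_nonneg hv0.le (sq_nonneg t)]
  -- the two exponentials into which the bound `h2` is split
  set E : ℝ → ℝ := fun t => Real.exp (-(v * t ^ 2 / 16)) with hE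
  set e : ℝ := Real.exp (-(v / 2048)) with he
  have hEi : Integrable E (gaussianReal 0 v) := by
    refine Integrable.of_bound (C := 1) (by fun_prop) (ae_of_all _ fun t => ?_)
    rw [Real.norm_eq_abs, Real.abs_exp, Real.exp_le_one_iff]
    exact neg_nonpos.2 (by positivity)
  have hEle := integral_exp_gaussianReal_le hv'
  have hee : v ^ 2 * e ≤ 2 ^ 23 := by
    have h : (v / 2048 : ℝ) ^ 2 / 2 ≤ Real.exp (v / 2048) := by
      have := Real.quadratic_le_exp_of_nonneg (x := (v / 2048 : ℝ)) (by positivity)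
      have : (0 : ℝ) ≤ v / 2048 := by positivity
      linarith
    rw [he, Real.exp_neg, ← div_eq_mul_inv, div_le_iff₀ (Real.exp_pos _)]
    nlinarith
  have he0 : 0 < e := Real.exp_pos _
  have hev : e ≤ 2 ^ 23 / v := by
    rw [le_div_iff₀ hv0]
    nlinarith [mul_pos he0 hv0]
  have hsplit : ∀ t : ℝ, Real.exp (-(v / 2048 * min (256 * t ^ 2) 1)) ≤ E t + e := by
    intro t
    rcases min_choice (256 * t ^ 2) 1 with h | h
    · rw [h]
      have : Real.exp (-(v / 2048 * (256 * t ^ 2))) ≤ E t := by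
        refine Real.exp_le_exp.2 (neg_le_neg ?_)
        nlinarith [mul_nonneg hv0.le (sq_nonneg t)]
      linarith
    · rw [h, mul_one]
      have : 0 < E t := Real.exp_pos _
      linarith
  have hsmooth : ∀ ξ : Measure ℝ, IsProbabilityMeasure ξ →
      (∀ t : ℝ, ‖charFun ξ t‖ ≤ Real.exp (-(v / 2048 * min (256 * t ^ 2) 1))) →
      |ξ.real (Set.Iic x) - (ξ ∗ gaussianReal 0 v⁻¹).real (Set.Iic x)| ≤ 3 / v + e := by
    intro ξ _ hξ
    refine (abs_real_Iic_sub_conv_le ξ hv' x).trans ?_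
    calc ∫ t, ‖charFun ξ t‖ ∂gaussianReal 0 v ≤ ∫ t, (E t + e) ∂gaussianReal 0 v := by
          refine integral_mono_of_nonneg (ae_of_all _ fun t => norm_nonneg _)
            (hEi.add (integrable_const _)) (ae_of_all _ fun t => (hξ t).trans (hsplit t))
      _ ≤ 3 / v + e := by
          rw [integral_add hEi (integrable_const _)]
          simpa using hEle
  set s := Real.sqrt v with hs
  have hs1 : 1 ≤ s := Real.one_le_sqrt.2 hv1
  have hs0 : 0 < s := by linarith
  have hss : s ^ 2 = v := Real.sq_sqrt hv0.le
  have hmid := abs_conv_real_Iic_sub_le μ (gaussianReal 0 v) hv'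
    (B := fun t => 2048 * 513 / s * E t + 64 * e)
    ((hEi.const_mul _).add (integrable_const _)) (fun t w hw htw => ?_) x
  · have hB : ∫ t, (2048 * 513 / s * E t + 64 * e) ∂gaussianReal 0 v ≤
        2048 * 513 / s * (3 / v) + 64 * e := by
      rw [integral_add (hEi.const_mul _) (integrable_const _), integral_const_mul]
      simp only [integral_const, probReal_univ, one_smul]
      gcongr
    have hc : Real.sqrt v / Real.sqrt (2 * Real.pi) ≤ s := by
      refine div_le_self (by positivity) (Real.one_le_sqrt.2 ?_)
      linarith [Real.pi_gt_three]
    have hmid' : Real.sqrt v / Real.sqrt (2 * Real.pi) *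
        ∫ t, (2048 * 513 / s * E t + 64 * e) ∂gaussianReal 0 v ≤ 2 ^ 35 / v := by
      calc _ ≤ s * (2048 * 513 / s * (3 / v) + 64 * e) := by gcongr
        _ = 2048 * 513 * 3 / v + 64 * (s * e) := by field_simp
        _ ≤ 2048 * 513 * 3 / v + 64 * (2 ^ 23 / v) := by
            gcongr
            rw [le_div_iff₀ hv0]
            have : s ≤ v := by nlinarith
            nlinarith [mul_pos he0 hv0]
        _ ≤ 2 ^ 35 / v := by
            rw [← mul_div_assoc, ← add_div]
            gcongr
            norm_num
    have ha := hsmooth μ inferInstance h2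
    have hb := hsmooth (gaussianReal 0 v) inferInstance h2g
    have hfin : (3 / v + e) + 2 ^ 35 / v + (3 / v + e) ≤ 2 ^ 40 / (v : ℝ) := by
      calc (3 / v + e) + 2 ^ 35 / v + (3 / v + e)
          ≤ (3 / v + 2 ^ 23 / v) + 2 ^ 35 / v + (3 / v + 2 ^ 23 / (v : ℝ)) := by gcongr
        _ = (6 + 2 ^ 24 + 2 ^ 35) / (v : ℝ) := by ring
        _ ≤ _ := by gcongr; norm_num
    have := hmid.trans hmid'
    rw [abs_le] at *
    constructor <;> linarith
  · rcases le_or_gt |t| (1 / 16) with ht | ht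
    · have hd := h1 t ht
      rw [← hgc] at hd
      have hE0 : 0 < E t := Real.exp_pos _
      have hEE : Real.exp (-(v * t ^ 2 / 8)) = E t * E t := by
        rw [hE, ← Real.exp_add]; congr 1; ring
      -- with `y = √v |t|`, the factor `y³ e^{-y²/16}` is bounded
      have hy : (s * |t|) ^ 3 * E t ≤ 513 := by
        have h : ((v : ℝ) * t ^ 2 / 16) ^ 2 / 2 ≤ Real.exp (v * t ^ 2 / 16) := by
          have := Real.quadratic_le_exp_of_nonneg (x := (v * t ^ 2 / 16 : ℝ)) (by positivity)
          have : (0 : ℝ) ≤ v * t ^ 2 / 16 := by positivity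
          linarith
        have h1e : 1 ≤ Real.exp (v * t ^ 2 / 16) := Real.one_le_exp (by positivity)
        simp only [hE]
        rw [Real.exp_neg, ← div_eq_mul_inv, div_le_iff₀ (Real.exp_pos _)]
        have hy2 : (v : ℝ) * t ^ 2 = (s * |t|) ^ 2 := by rw [mul_pow, hss, sq_abs]
        rw [hy2] at h h1e ⊢
        have hy0 : 0 ≤ s * |t| := by positivity
        generalize s * |t| = y at *
        have h3 : y ^ 3 ≤ 1 + y ^ 4 := by
          nlinarith [sq_nonneg (y ^ 2 - y), sq_nonneg (y - 1), sq_nonneg (y ^ 2 - 1)]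
        nlinarith
      have ht4 : t ^ 4 = |t| ^ 3 * |t| := by
        have : |t| ^ 4 = t ^ 4 := by rw [← abs_pow, abs_of_nonneg (by positivity)]
        rw [← this]; ring
      calc ‖charFun μ t - charFun (gaussianReal 0 v) t‖ * w
          ≤ 1024 * v * t ^ 4 * Real.exp (-(v * t ^ 2 / 8)) * w := by gcongr
        _ = 1024 / s * ((s * |t|) ^ 3 * E t) * E t * (|t| * w) := by
            rw [ht4, hEE, ← hss]; field_simp
        _ ≤ 1024 / s * 513 * E t * 2 := by gcongr
        _ = 2048 * 513 / s * E t := by ring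
        _ ≤ _ := by linarith
    · have hmin : min (256 * t ^ 2) 1 = 1 := by
        refine min_eq_right ?_
        rw [← sq_abs]; nlinarith
      have ha := h2 t
      have hb := h2g t
      rw [hmin, mul_one] at ha hb
      have hw2 : w ≤ 32 := by nlinarith
      have hn : ‖charFun μ t - charFun (gaussianReal 0 v) t‖ ≤ 2 * e := by
        refine (norm_sub_le _ _).trans ?_
        linarith
      have hE0 : 0 < E t := Real.exp_pos _
      calc _ ≤ 2 * e * 32 := by gcongr
        _ = 64 * e := by ring
        _ ≤ _ := by
            have : 0 ≤ 2048 * 513 / s * E t := by positivity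
            linarith

/-! ### Replacing independent coordinates one at a time -/

theorem abs_prod_real_sub_le_of_section_left {α β : Type*} [MeasurableSpace α] [MeasurableSpace β]
    (μ ν : Measure α) [IsProbabilityMeasure μ] [IsProbabilityMeasure ν] (ρ : Measure β)
    [IsProbabilityMeasure ρ] {S : Set (α × β)} (hS : MeasurableSet S) {D : ℝ}
    (hD : ∀ b, |μ.real ((fun a => (a, b)) ⁻¹' S) - ν.real ((fun a => (a, b)) ⁻¹' S)| ≤ D) :
    |(μ.prod ρ).real S - (ν.prod ρ).real S| ≤ D := by
  have hm : ∀ ξ : Measure α, IsProbabilityMeasure ξ →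
      Measurable fun b => ξ ((fun a => (a, b)) ⁻¹' S) := fun ξ _ =>
    measurable_measure_prodMk_right hS
  have he : ∀ ξ : Measure α, IsProbabilityMeasure ξ →
      (ξ.prod ρ).real S = ∫ b, ξ.real ((fun a => (a, b)) ⁻¹' S) ∂ρ := fun ξ _ => by
    rw [measureReal_def, Measure.prod_apply_symm hS]
    simp only [measureReal_def]
    rw [integral_toReal (hm ξ inferInstance).aemeasurable
      (ae_of_all _ fun _ => measure_lt_top _ _)]
  have hi : ∀ ξ : Measure α, IsProbabilityMeasure ξ →
      Integrable (fun b => ξ.real ((fun a => (a, b)) ⁻¹' S)) ρ := fun ξ _ => by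
    refine Integrable.of_bound (C := 1) (hm ξ inferInstance).ennreal_toReal.aestronglyMeasurable
      (ae_of_all _ fun b => ?_)
    rw [Real.norm_eq_abs, abs_of_nonneg measureReal_nonneg]
    exact measureReal_le_one
  rw [he μ inferInstance, he ν inferInstance, ← integral_sub (hi μ inferInstance)
    (hi ν inferInstance), ← Real.norm_eq_abs]
  refine (norm_integral_le_of_norm_le_const (C := D) (ae_of_all _ hD)).trans ?_
  simp

theorem abs_prod_real_sub_le_of_section_right {α β : Type*} [MeasurableSpace α]
    [MeasurableSpace β] (ρ : Measure β) [IsProbabilityMeasure ρ] (μ ν : Measure α)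
    [IsProbabilityMeasure μ] [IsProbabilityMeasure ν] {S : Set (β × α)} (hS : MeasurableSet S)
    {D : ℝ} (hD : ∀ b, |μ.real (Prod.mk b ⁻¹' S) - ν.real (Prod.mk b ⁻¹' S)| ≤ D) :
    |(ρ.prod μ).real S - (ρ.prod ν).real S| ≤ D := by
  have he : ∀ ξ : Measure α, IsProbabilityMeasure ξ →
      (ρ.prod ξ).real S = (ξ.prod ρ).real (Prod.swap ⁻¹' S) := fun ξ _ => by
    rw [← Measure.prod_swap, map_measureReal_apply measurable_swap hS]
  rw [he μ inferInstance, he ν inferInstance]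
  exact abs_prod_real_sub_le_of_section_left μ ν ρ (measurable_swap hS) hD

theorem abs_real_Iio_sub_le {μ ν : Measure ℝ} [IsProbabilityMeasure μ] [IsProbabilityMeasure ν]
    {D : ℝ} (hD : ∀ x, |μ.real (Set.Iic x) - ν.real (Set.Iic x)| ≤ D) (x : ℝ) :
    |μ.real (Set.Iio x) - ν.real (Set.Iio x)| ≤ D := by
  obtain ⟨u, hu, hux, hlim⟩ := exists_seq_strictMono_tendsto x
  have hU : ⋃ n, Set.Iic (u n) = Set.Iio x := by
    ext y
    simp only [Set.mem_iUnion, Set.mem_Iic, Set.mem_Iio]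
    refine ⟨fun ⟨n, hn⟩ => hn.trans_lt (hux n), fun hy => ?_⟩
    obtain ⟨n, hn⟩ := (hlim.eventually_const_lt hy).exists
    exact ⟨n, hn.le⟩
  have ht : ∀ ξ : Measure ℝ, IsProbabilityMeasure ξ →
      Tendsto (fun n => ξ.real (Set.Iic (u n))) atTop (𝓝 (ξ.real (Set.Iio x))) := fun ξ _ => by
    rw [← hU]
    exact (ENNReal.tendsto_toReal (measure_ne_top _ _)).comp (tendsto_measure_iUnion_atTop
      fun m n h => Set.Iic_subset_Iic.2 (hu.monotone h))
  exact le_of_tendsto ((ht μ inferInstance).sub (ht ν inferInstance)).abs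
    (Eventually.of_forall fun n => hD _)

theorem abs_real_Ioo_sub_le {μ ν : Measure ℝ} [IsProbabilityMeasure μ] [IsProbabilityMeasure ν]
    {D : ℝ} (hD : ∀ x, |μ.real (Set.Iic x) - ν.real (Set.Iic x)| ≤ D) (z x : ℝ) :
    |μ.real (Set.Ioo z x) - ν.real (Set.Ioo z x)| ≤ 2 * D := by
  have h0 : 0 ≤ D := (abs_nonneg _).trans (hD 0)
  rcases le_or_gt x z with h | h
  · simp [Set.Ioo_eq_empty (not_lt.2 h), h0]
  have he : ∀ ξ : Measure ℝ, IsProbabilityMeasure ξ →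
      ξ.real (Set.Ioo z x) = ξ.real (Set.Iio x) - ξ.real (Set.Iic z) := fun ξ _ => by
    rw [← measureReal_sdiff (Set.Iic_subset_Iio.2 h) measurableSet_Iic]
    congr 1
    ext y; simp
  rw [he μ inferInstance, he ν inferInstance]
  have h1 := abs_real_Iio_sub_le hD x
  have h2 := hD z
  rw [abs_le] at *
  constructor <;> linarith

theorem abs_real_Ioi_sub_le {μ ν : Measure ℝ} [IsProbabilityMeasure μ] [IsProbabilityMeasure ν]
    {D : ℝ} (hD : ∀ x, |μ.real (Set.Iic x) - ν.real (Set.Iic x)| ≤ D) (x : ℝ) :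
    |μ.real (Set.Ioi x) - ν.real (Set.Ioi x)| ≤ D := by
  rw [← Set.compl_Iic, probReal_compl_eq_one_sub measurableSet_Iic,
    probReal_compl_eq_one_sub measurableSet_Iic, sub_sub_sub_cancel_left, abs_sub_comm]
  exact hD x

theorem measurableSet_ordered :
    MeasurableSet {p : ℝ × ℝ × ℝ | p.1 > p.2.1 ∧ p.2.1 > p.2.2} :=
  (measurableSet_lt (f := fun p : ℝ × ℝ × ℝ => p.2.1) (g := fun p => p.1) (by fun_prop)
    (by fun_prop)).inter (measurableSet_lt (f := fun p : ℝ × ℝ × ℝ => p.2.2)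
      (g := fun p => p.2.1) (by fun_prop) (by fun_prop))

/-- The middle law counts twice: once the other two coordinates are fixed, the middle one is
confined to an interval, while the outer ones are confined to half-lines. -/
theorem abs_prod_real_ordered_sub_le {μ₁ μ₂ μ₃ ν₁ ν₂ ν₃ : Measure ℝ} [IsProbabilityMeasure μ₁]
    [IsProbabilityMeasure μ₂] [IsProbabilityMeasure μ₃] [IsProbabilityMeasure ν₁]
    [IsProbabilityMeasure ν₂] [IsProbabilityMeasure ν₃] {D₁ D₂ D₃ : ℝ}
    (h₁ : ∀ x, |μ₁.real (Set.Iic x) - ν₁.real (Set.Iic x)| ≤ D₁)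
    (h₂ : ∀ x, |μ₂.real (Set.Iic x) - ν₂.real (Set.Iic x)| ≤ D₂)
    (h₃ : ∀ x, |μ₃.real (Set.Iic x) - ν₃.real (Set.Iic x)| ≤ D₃) :
    |(μ₁.prod (μ₂.prod μ₃)).real {p | p.1 > p.2.1 ∧ p.2.1 > p.2.2} -
      (ν₁.prod (ν₂.prod ν₃)).real {p | p.1 > p.2.1 ∧ p.2.1 > p.2.2}| ≤ D₁ + 2 * D₂ + D₃ := by
  set S : Set (ℝ × ℝ × ℝ) := {p | p.1 > p.2.1 ∧ p.2.1 > p.2.2} with hSdef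
  have hS : MeasurableSet S := measurableSet_ordered
  have hD3 : 0 ≤ D₃ := (abs_nonneg _).trans (h₃ 0)
  have hD1 : 0 ≤ D₁ := (abs_nonneg _).trans (h₁ 0)
  have s1 : |(μ₁.prod (μ₂.prod μ₃)).real S - (ν₁.prod (μ₂.prod μ₃)).real S| ≤ D₁ := by
    refine abs_prod_real_sub_le_of_section_left _ _ _ hS fun b => ?_
    by_cases hb : b.1 > b.2
    · have : (fun a => (a, b)) ⁻¹' S = Set.Ioi b.1 := by ext a; simp [hSdef, hb]
      rw [this]
      exact abs_real_Ioi_sub_le h₁ _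
    · have : (fun a => (a, b)) ⁻¹' S = ∅ := by ext a; simp [hSdef, not_lt.1 hb]
      simpa [this] using hD1
  have s2 : |(ν₁.prod (μ₂.prod μ₃)).real S - (ν₁.prod (ν₂.prod μ₃)).real S| ≤ 2 * D₂ := by
    refine abs_prod_real_sub_le_of_section_right _ _ _ hS fun x => ?_
    refine abs_prod_real_sub_le_of_section_left _ _ _ (measurable_prodMk_left hS) fun z => ?_
    have : (fun a => (a, z)) ⁻¹' (Prod.mk x ⁻¹' S) = Set.Ioo z x := by
      ext a; simp [hSdef, and_comm]
    rw [this]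
    exact abs_real_Ioo_sub_le h₂ _ _
  have s3 : |(ν₁.prod (ν₂.prod μ₃)).real S - (ν₁.prod (ν₂.prod ν₃)).real S| ≤ D₃ := by
    refine abs_prod_real_sub_le_of_section_right _ _ _ hS fun x => ?_
    refine abs_prod_real_sub_le_of_section_right _ _ _ (measurable_prodMk_left hS) fun y => ?_
    by_cases hb : x > y
    · have : Prod.mk y ⁻¹' (Prod.mk x ⁻¹' S) = Set.Iio y := by ext a; simp [hSdef, hb]
      rw [this]
      exact abs_real_Iio_sub_le h₃ _
    · have : Prod.mk y ⁻¹' (Prod.mk x ⁻¹' S) = ∅ := by ext a; simp [hSdef, not_lt.1 hb]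
      simpa [this] using hD3
  rw [abs_le] at *
  constructor <;> linarith

theorem measureReal_ordered_eq_prod {Ω : Type*} [MeasurableSpace Ω] {P : Measure Ω}
    [IsProbabilityMeasure P] {Y : Fin 3 → Ω → ℝ} (hY : ∀ i, AEMeasurable (Y i) P)
    (hind : iIndepFun Y P) {i j k : Fin 3} (hij : i ≠ j) (hjk : j ≠ k) (hik : i ≠ k) :
    P.real {ω | Y i ω > Y j ω ∧ Y j ω > Y k ω} =
      ((P.map (Y i)).prod ((P.map (Y j)).prod (P.map (Y k)))).real
        {p | p.1 > p.2.1 ∧ p.2.1 > p.2.2} := by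
  have h1 : IndepFun (fun ω => (Y j ω, Y k ω)) (Y i) P :=
    hind.indepFun_prodMk₀ hY j k i hij.symm hik.symm
  rw [← (indepFun_iff_map_prod_eq_prod_map_map (hY j) (hY k)).1 (hind.indepFun hjk),
    ← (indepFun_iff_map_prod_eq_prod_map_map (hY i) ((hY j).prodMk (hY k))).1 h1.symm,
    map_measureReal_apply_of_aemeasurable ((hY i).prodMk ((hY j).prodMk (hY k)))
      measurableSet_ordered]
  rfl

/-! ### Almost sure convergence of random series -/

/-- The partial sums form a martingale bounded in `L²`. -/
theorem ae_tendsto_sum_of_iIndepFun_of_stronglyMeasurable {Ω : Type*} [MeasurableSpace Ω]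
    {P : Measure Ω} [IsProbabilityMeasure P] {ξ : ℕ → Ω → ℝ} (hm : ∀ n, StronglyMeasurable (ξ n))
    (hind : iIndepFun ξ P) {c : ℕ → ℝ} (hc : ∀ n, ∀ᵐ ω ∂P, |ξ n ω| ≤ c n)
    (h0 : ∀ n, ∫ ω, ξ n ω ∂P = 0) (hsum : Summable fun n => c n ^ 2) :
    ∀ᵐ ω ∂P, ∃ L, Tendsto (fun n => ∑ m ∈ Finset.range n, ξ m ω) atTop (𝓝 L) := by
  set M : ℕ → Ω → ℝ := fun n => ∑ m ∈ Finset.range (n + 1), ξ m with hM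
  have hLp : ∀ n, MemLp (ξ n) 2 P := fun n =>
    MemLp.of_bound (hm n).aestronglyMeasurable (c n) (hc n)
  have hMLp : ∀ n, MemLp (M n) 2 P := fun n => memLp_finsetSum' _ fun m _ => hLp m
  have hMint : ∀ n, Integrable (M n) P := fun n => (hMLp n).integrable (by norm_num)
  have hM0 : ∀ n, ∫ ω, M n ω ∂P = 0 := fun n => by
    simp only [hM, Finset.sum_apply]
    rw [integral_finsetSum _ fun m _ => (hLp m).integrable (by norm_num)]
    simp [h0]
  have hmart : Martingale M (Filtration.natural ξ hm) P := by
    refine martingale_of_condExp_sub_eq_zero_nat (fun n => ?_) hMint fun n => ?_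
    · refine Finset.stronglyMeasurable_sum _ fun m hm' => ?_
      exact (Filtration.stronglyAdapted_natural hm m).mono
        ((Filtration.natural ξ hm).mono (Nat.lt_succ_iff.1 (Finset.mem_range.1 hm')))
    · have : M (n + 1) - M n = ξ (n + 1) := by
        simp [hM, Finset.sum_range_succ]
      rw [this]
      refine (hind.condExp_natural_ae_eq_of_lt hm n.lt_succ_self).trans ?_
      simp [h0, Pi.zero_def]
  have hvar : ∀ n, ∫ ω, M n ω ^ 2 ∂P ≤ ∑' n, c n ^ 2 := by
    intro n
    have h1 : ∫ ω, M n ω ^ 2 ∂P = variance (M n) P := by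
      rw [variance_of_integral_eq_zero (hMLp n).aemeasurable (hM0 n)]
    rw [h1, IndepFun.variance_sum (fun m _ => hLp m)
      (fun i _ j _ hij => hind.indepFun hij)]
    refine (Finset.sum_le_sum fun m _ => ?_).trans (hsum.sum_le_tsum _ fun _ _ => sq_nonneg _)
    rw [variance_of_integral_eq_zero (hLp m).aemeasurable (h0 m)]
    calc ∫ ω, ξ m ω ^ 2 ∂P ≤ ∫ _, c m ^ 2 ∂P := by
          refine integral_mono_ae (hLp m).integrable_sq (integrable_const _) ?_
          filter_upwards [hc m] with ω hω
          exact sq_le_sq' (abs_le.1 hω).1 (abs_le.1 hω).2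
      _ = c m ^ 2 := by simp
  have hbdd : ∀ n, eLpNorm (M n) 1 P ≤ ((1 + ∑' n, c n ^ 2).toNNReal : NNReal) := by
    intro n
    rw [eLpNorm_one_eq_lintegral_enorm, ← ofReal_integral_norm_eq_lintegral_enorm (hMint n)]
    refine ENNReal.ofReal_le_ofReal ?_
    calc ∫ ω, ‖M n ω‖ ∂P ≤ ∫ ω, (1 + M n ω ^ 2) ∂P := by
          refine integral_mono (hMint n).norm ((integrable_const _).add (hMLp n).integrable_sq) ?_
          intro ω
          simp only [Real.norm_eq_abs]
          nlinarith [sq_nonneg (|M n ω| - 1), sq_abs (M n ω)]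
      _ ≤ 1 + ∑' n, c n ^ 2 := by
          rw [integral_add (integrable_const _) (hMLp n).integrable_sq]
          simpa using hvar n
  filter_upwards [hmart.submartingale.exists_ae_tendsto_of_bdd hbdd] with ω hω
  obtain ⟨L, hL⟩ := hω
  refine ⟨L, (tendsto_add_atTop_iff_nat 1).1 ?_⟩
  simpa [hM] using hL

theorem ae_tendsto_sum_of_iIndepFun {Ω : Type*} [MeasurableSpace Ω]
    {P : Measure Ω} [IsProbabilityMeasure P] {ξ : ℕ → Ω → ℝ} (hm : ∀ n, AEMeasurable (ξ n) P)
    (hind : iIndepFun ξ P) {c : ℕ → ℝ} (hc : ∀ n, ∀ᵐ ω ∂P, |ξ n ω| ≤ c n)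
    (h0 : ∀ n, ∫ ω, ξ n ω ∂P = 0) (hsum : Summable fun n => c n ^ 2) :
    ∀ᵐ ω ∂P, ∃ L, Tendsto (fun n => ∑ m ∈ Finset.range n, ξ m ω) atTop (𝓝 L) := by
  have hall : ∀ᵐ ω ∂P, ∀ n, ξ n ω = (hm n).mk (ξ n) ω := ae_all_iff.2 fun n => (hm n).ae_eq_mk
  have := ae_tendsto_sum_of_iIndepFun_of_stronglyMeasurable
    (fun n => (hm n).measurable_mk.stronglyMeasurable) (hind.congr fun n => (hm n).ae_eq_mk)
    (c := c) (fun n => by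
      filter_upwards [hc n, (hm n).ae_eq_mk] with ω h1 h2
      rwa [← h2])
    (fun n => by rw [← h0 n]; exact integral_congr_ae (hm n).ae_eq_mk.symm) hsum
  filter_upwards [this, hall] with ω h1 h2
  simpa only [h2] using h1

/-- A set whose points carry real ordinates, finitely many below each height, can be enumerated in
nondecreasing order of the ordinates. -/
theorem exists_equiv_nat_of_finite_lt {ι : Type*} [Infinite ι] {ord : ι → ℝ}
    (hfin : ∀ T, {z | ord z < T}.Finite) :
    ∃ (h : ℕ ≃ ι) (N : ℝ → ℕ), Tendsto N atTop atTop ∧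
      ∀ T, {z | ord z < T} = h '' Set.Iio (N T) := by
  classical
  have hcount : Countable ι := by
    have : (⋃ n : ℕ, {z : ι | ord z < n}) = Set.univ := by
      ext z
      obtain ⟨n, hn⟩ := exists_nat_gt (ord z)
      simpa using ⟨n, hn⟩
    rw [← Set.countable_univ_iff, ← this]
    exact Set.countable_iUnion fun n => (hfin n).countable
  obtain ⟨e, he⟩ := exists_injective_nat ι
  -- ties between equal ordinates are broken by `e`
  let κ : ι → ℝ ×ₗ ℕ := fun z => toLex (ord z, e z)
  have hκ : Function.Injective κ := fun z w hzw => he (congrArg (fun p => (ofLex p).2) hzw)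
  have hlt : ∀ z w, κ z < κ w → ord z ≤ ord w := fun z w h => by
    rcases Prod.Lex.toLex_lt_toLex.1 h with h | h
    · exact h.le
    · exact h.1.le
  have hlt' : ∀ z w, ord z < ord w → κ z < κ w := fun z w h =>
    Prod.Lex.toLex_lt_toLex.2 (Or.inl h)
  have hfκ : ∀ z, {w | κ w < κ z}.Finite := fun z =>
    (hfin (ord z + 1)).subset fun w hw => (hlt w z hw).trans_lt (lt_add_one _)
  let r : ι → ℕ := fun z => {w | κ w < κ z}.ncard
  have hr : ∀ z w, κ z < κ w → r z < r w := fun z w h =>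
    Set.ncard_lt_ncard ⟨fun u hu => lt_trans hu h,
      fun hs => lt_irrefl (κ z) (show κ z < κ z from hs h)⟩ (hfκ w)
  have hrinj : Function.Injective r := fun z w hzw => by
    rcases lt_trichotomy (κ z) (κ w) with h | h | h
    · exact absurd hzw (hr z w h).ne
    · exact hκ h
    · exact absurd hzw (hr w z h).ne'
  let N : ℝ → ℕ := fun T => {z | ord z < T}.ncard
  have hN : ∀ T z, ord z < T ↔ r z < N T := fun T z => by
    constructor
    · intro hz
      refine Set.ncard_lt_ncard ⟨fun w hw => (hlt w z hw).trans_lt hz, fun hs => ?_⟩ (hfin T)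
      exact lt_irrefl (κ z) (show κ z < κ z from hs hz)
    · intro hz
      by_contra hT
      exact hz.not_ge (Set.ncard_le_ncard (fun w hw => hlt' w z (lt_of_lt_of_le hw (not_lt.1 hT)))
        (hfκ z))
  have himg : ∀ T, r '' {z | ord z < T} = Set.Iio (N T) := fun T => by
    refine Set.eq_of_subset_of_ncard_le ?_ ?_ (Set.finite_Iio _)
    · rintro _ ⟨z, hz, rfl⟩
      exact (hN T z).1 hz
    · rw [Set.ncard_image_of_injective _ hrinj]
      simp [N]
  have hNtop : Tendsto N atTop atTop := by
    refine tendsto_atTop_atTop_of_monotone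
      (fun S T hST => Set.ncard_le_ncard (fun z hz => lt_of_lt_of_le hz hST) (hfin T)) fun n => ?_
    obtain ⟨s, hs⟩ := Infinite.exists_subset_card_eq ι n
    obtain ⟨T, hT⟩ : ∃ T, ∀ z ∈ s, ord z < T := by
      obtain ⟨B, hB⟩ := (s.finite_toSet.image ord).bddAbove
      exact ⟨B + 1, fun z hz => (hB ⟨z, hz, rfl⟩).trans_lt (lt_add_one _)⟩
    refine ⟨T, ?_⟩
    rw [← hs, ← Set.ncard_coe_finset]
    exact Set.ncard_le_ncard hT (hfin T)
  have hsurj : Function.Surjective r := fun n => by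
    obtain ⟨T, hT⟩ := (hNtop.eventually_gt_atTop n).exists
    have : n ∈ r '' {z | ord z < T} := by rw [himg]; exact hT
    exact ⟨_, this.choose_spec.2⟩
  refine ⟨(Equiv.ofBijective r ⟨hrinj, hsurj⟩).symm, N, hNtop, fun T => ?_⟩
  rw [← himg, ← Set.image_comp]
  have hs : ∀ z, (Equiv.ofBijective r ⟨hrinj, hsurj⟩).symm (r z) = z :=
    Equiv.ofBijective_symm_apply_apply r _
  ext z
  simp [hs]

theorem ae_tendsto_sum_re_im_of_iIndepFun {Ω : Type*} [MeasurableSpace Ω] {P : Measure Ω}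
    [IsProbabilityMeasure P] {Z : ℕ → Ω → ℂ} (hZ : ∀ n, HasLaw (Z n) uniformCircle P)
    (hind : iIndepFun Z P) {d : ℕ → ℝ} (hsum : Summable fun n => d n ^ 2) :
    ∀ᵐ ω ∂P, ∃ L, Tendsto (fun n => ∑ m ∈ Finset.range n, (d m : ℂ) * Z m ω) atTop (𝓝 L) := by
  have hnorm : ∀ n, ∀ᵐ ω ∂P, ‖Z n ω‖ = 1 := fun n =>
    ((hZ n).ae_iff (p := fun z => ‖z‖ = 1) (by fun_prop)).2 ae_norm_eq_one_uniformCircle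
  have h0 : ∀ n, ∫ ω, Z n ω ∂P = 0 := fun n => by
    rw [(hZ n).integral_eq, integral_id_uniformCircle]
  have hint : ∀ n, Integrable (Z n) P := fun n =>
    Integrable.of_bound (hZ n).aemeasurable.aestronglyMeasurable 1
      ((hnorm n).mono fun ω h => h.le)
  have key : ∀ g : ℂ →L[ℝ] ℝ, (∀ z, |g z| ≤ ‖z‖) → ∀ᵐ ω ∂P, ∃ L,
      Tendsto (fun n => ∑ m ∈ Finset.range n, d m * g (Z m ω)) atTop (𝓝 L) := by
    intro g hg
    refine ae_tendsto_sum_of_iIndepFun (ξ := fun n ω => d n * g (Z n ω)) (c := fun n => |d n|)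
      (fun n => ?_) ?_ (fun n => ?_) (fun n => ?_) ?_
    · exact ((g.continuous.measurable.comp_aemeasurable (hZ n).aemeasurable).const_mul _)
    · exact hind.comp (fun n z => d n * g z) fun n => (g.continuous.measurable.const_mul _)
    · filter_upwards [hnorm n] with ω hω
      rw [abs_mul]
      exact mul_le_of_le_one_right (abs_nonneg _) (hω ▸ hg _)
    · rw [integral_const_mul, g.integral_comp_comm (hint n), h0, map_zero, mul_zero]
    · simpa only [sq_abs] using hsum
  filter_upwards [key Complex.reCLM Complex.abs_re_le_norm,
    key Complex.imCLM Complex.abs_im_le_norm] with ω h1 h2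
  obtain ⟨a, ha⟩ := h1
  obtain ⟨b, hb⟩ := h2
  refine ⟨a + b * I, ?_⟩
  have hab := ((Complex.continuous_ofReal.tendsto a).comp ha).add
    (((Complex.continuous_ofReal.tendsto b).comp hb).mul_const I)
  refine hab.congr fun n => ?_
  simp only [Function.comp_apply, Complex.ofReal_sum, Finset.sum_mul, ← Finset.sum_add_distrib]
  refine Finset.sum_congr rfl fun m _ => ?_
  simp only [Complex.reCLM_apply, Complex.imCLM_apply]
  push_cast
  rw [mul_assoc, ← mul_add, Complex.re_add_im]

theorem ae_tendsto_charPartialSum {q : ℕ} [NeZero q] {χ : DirichletCharacter ℂ q} {Ω : Type*}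
    [MeasurableSpace Ω] {P : Measure Ω} [IsProbabilityMeasure P] {Z : UpperZero χ → Ω → ℂ}
    (hZ : ∀ z, HasLaw (Z z) uniformCircle P) (hind : iIndepFun Z P)
    (hsum : Summable fun z : UpperZero χ => 1 / (1 / 4 + z.ordinate ^ 2)) :
    ∀ᵐ ω ∂P, Tendsto (fun T : ℝ => charPartialSum Z T ω) atTop (𝓝 (charSum Z ω)) := by
  suffices h : ∀ᵐ ω ∂P, ∃ L, Tendsto (fun T : ℝ => charPartialSum Z T ω) atTop (𝓝 L) by
    filter_upwards [h] with ω hω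
    exact tendsto_nhds_limUnder hω
  have hterm : ∀ (z : UpperZero χ) (ω : Ω), Z z ω / (Real.sqrt (1 / 4 + z.ordinate ^ 2) : ℂ) =
      (((Real.sqrt (1 / 4 + z.ordinate ^ 2))⁻¹ : ℝ) : ℂ) * Z z ω := fun z ω => by
    push_cast; rw [div_eq_inv_mul]
  rcases finite_or_infinite (UpperZero χ) with hf | hf
  · have : Fintype (UpperZero χ) := Fintype.ofFinite _
    obtain ⟨B, hB⟩ := (Set.finite_range (UpperZero.ordinate (χ := χ))).bddAbove
    refine ae_of_all _ fun ω => ⟨∑ z, Z z ω / (Real.sqrt (1 / 4 + z.ordinate ^ 2) : ℂ), ?_⟩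
    refine tendsto_const_nhds.congr' ?_
    filter_upwards [eventually_gt_atTop B] with T hT
    rw [charPartialSum]
    congr 1
    ext z
    simpa using (hB ⟨z, rfl⟩).trans_lt hT
  · obtain ⟨h, N, hN, hT⟩ := exists_equiv_nat_of_finite_lt (UpperZero.finite_ordinate_lt χ)
    have := ae_tendsto_sum_re_im_of_iIndepFun (Z := fun n => Z (h n)) (fun n => hZ _)
      (hind.precomp h.injective)
      (d := fun n => (Real.sqrt (1 / 4 + (h n).ordinate ^ 2))⁻¹) (by
        refine (h.summable_iff.2 hsum).congr fun n => ?_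
        simp only [Function.comp_apply, one_div]
        rw [inv_pow, Real.sq_sqrt (by positivity)])
    filter_upwards [this] with ω hω
    obtain ⟨L, hL⟩ := hω
    refine ⟨L, (hL.comp hN).congr fun T => ?_⟩
    simp only [Function.comp_apply, charPartialSum, hterm]
    have : (UpperZero.finite_ordinate_lt χ T).toFinset =
        (Finset.range (N T)).map h.toEmbedding := by
      ext z
      rw [Set.Finite.mem_toFinset, hT T]
      simp
    rw [this, Finset.sum_map]
    rfl

/-! ### Laws of infinite sums of independent circle variables -/

section CircleSums

variable {Ω : Type*} [MeasurableSpace Ω] {P : Measure Ω} {ι : Type*} {ζ : ι → Ω → ℂ}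

theorem integral_exp_sum_re (hζ : ∀ p, HasLaw (ζ p) uniformCircle P) (hind : iIndepFun ζ P)
    (w : ι → ℝ) (s : Finset ι) :
    ∫ ω, Complex.exp ((∑ p ∈ s, w p * (ζ p ω).re : ℝ) * I) ∂P =
      ((∏ p ∈ s, besselJZero (w p) : ℝ) : ℂ) := by
  have hm : ∀ p, AEMeasurable (fun ω => w p * (ζ p ω).re) P := fun p =>
    (Complex.measurable_re.comp_aemeasurable (hζ p).aemeasurable).const_mul _
  have hi : iIndepFun (fun p ω => w p * (ζ p ω).re) P :=
    hind.comp (fun p z => w p * z.re) fun p => by fun_prop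
  have h := congrFun (iIndepFun.charFun_map_fun_finsetSum_eq_prod (s := s) (fun p _ => hm p)
    (hi.restrict s)) 1
  rw [charFun_apply_real, integral_map (Finset.aemeasurable_fun_sum s fun p _ => hm p)
    (by fun_prop), Finset.prod_apply] at h
  simp only [Complex.ofReal_one, one_mul] at h
  rw [h, Complex.ofReal_prod]
  refine Finset.prod_congr rfl fun p _ => ?_
  rw [charFun_apply_real, integral_map (hm p) (by fun_prop), ← integral_exp_re_uniformCircle,
    ← (hζ p).integral_comp (f := fun z => Complex.exp ((w p * z.re : ℝ) * I)) (by fun_prop)]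
  simp

theorem tendsto_prod_besselJZero [IsProbabilityMeasure P]
    (hζ : ∀ p, HasLaw (ζ p) uniformCircle P) (hind : iIndepFun ζ P)
    {w : ι → ℝ} {G : ℕ → Finset ι} {U : Ω → ℝ}
    (hU : ∀ᵐ ω ∂P, Tendsto (fun n => ∑ p ∈ G n, w p * (ζ p ω).re) atTop (𝓝 (U ω))) :
    Tendsto (fun n => ((∏ p ∈ G n, besselJZero (w p) : ℝ) : ℂ)) atTop
      (𝓝 (∫ ω, Complex.exp ((U ω : ℝ) * I) ∂P)) := by
  simp_rw [← integral_exp_sum_re hζ hind]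
  have hm : ∀ n, AEMeasurable (fun ω => ∑ p ∈ G n, w p * (ζ p ω).re) P := fun n =>
    Finset.aemeasurable_fun_sum _ fun p _ =>
      (Complex.measurable_re.comp_aemeasurable (hζ p).aemeasurable).const_mul _
  refine tendsto_integral_of_dominated_convergence (fun _ => (1 : ℝ)) (fun n => ?_)
    (integrable_const _) (fun n => ae_of_all _ fun ω => ?_) ?_
  · exact ((by fun_prop : Measurable fun x : ℝ => Complex.exp (x * I)).comp_aemeasurable
      (hm n)).aestronglyMeasurable
  · rw [Complex.norm_exp_ofReal_mul_I]
  · filter_upwards [hU] with ω hω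
    exact ((by fun_prop : Continuous fun x : ℝ => Complex.exp (x * I)).tendsto _).comp hω

theorem aemeasurable_of_tendsto_sum_re (hζ : ∀ p, HasLaw (ζ p) uniformCircle P) {w : ι → ℝ}
    {G : ℕ → Finset ι} {U : Ω → ℝ}
    (hU : ∀ᵐ ω ∂P, Tendsto (fun n => ∑ p ∈ G n, w p * (ζ p ω).re) atTop (𝓝 (U ω))) :
    AEMeasurable U P :=
  aemeasurable_of_tendsto_metrizable_ae atTop (fun _ => Finset.aemeasurable_fun_sum _ fun p _ =>
    (Complex.measurable_re.comp_aemeasurable (hζ p).aemeasurable).const_mul _) hU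

theorem tendsto_charFun_map [IsProbabilityMeasure P]
    (hζ : ∀ p, HasLaw (ζ p) uniformCircle P) (hind : iIndepFun ζ P)
    {w : ι → ℝ} {G : ℕ → Finset ι} {U : Ω → ℝ}
    (hU : ∀ᵐ ω ∂P, Tendsto (fun n => ∑ p ∈ G n, w p * (ζ p ω).re) atTop (𝓝 (U ω))) (t : ℝ) :
    Tendsto (fun n => ((∏ p ∈ G n, besselJZero (t * w p) : ℝ) : ℂ)) atTop
      (𝓝 (charFun (P.map U) t)) := by
  rw [charFun_apply_real, integral_map (aemeasurable_of_tendsto_sum_re hζ hU) (by fun_prop)]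
  have := tendsto_prod_besselJZero (w := fun p => t * w p) (U := fun ω => t * U ω) hζ hind
    (G := G) (by
      filter_upwards [hU] with ω hω
      simpa only [Finset.mul_sum, mul_assoc] using hω.const_mul t)
  simpa only [Complex.ofReal_mul] using this

/-- Families of weights with disjoint supports give independent sums. The joint characteristic
function of the partial sums is a product over the indices `p`, and at each `p` only one family
contributes. -/
theorem iIndepFun_of_tendsto_sum_re [IsProbabilityMeasure P]
    (hζ : ∀ p, HasLaw (ζ p) uniformCircle P)
    (hind : iIndepFun ζ P) {J : Type*} [Fintype J] {l : J → ι → ℝ}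
    (hdisj : ∀ p i j, i ≠ j → l i p = 0 ∨ l j p = 0) {G : ℕ → Finset ι} {X : J → Ω → ℝ}
    (hX : ∀ i, ∀ᵐ ω ∂P, Tendsto (fun n => ∑ p ∈ G n, l i p * (ζ p ω).re) atTop (𝓝 (X i ω))) :
    iIndepFun X P := by
  have hm : ∀ i, AEMeasurable (X i) P := fun i => aemeasurable_of_tendsto_sum_re hζ (hX i)
  rw [iIndepFun_iff_charFun_pi hm]
  intro t
  have hprod := tendsto_finsetProd (Finset.univ : Finset J) fun i _ =>
    tendsto_charFun_map hζ hind (hX i) (t i)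
  have hjoint := tendsto_prod_besselJZero (w := fun p => ∑ i, t i * l i p)
    (U := fun ω => ∑ i, t i * X i ω) hζ hind (G := G) (by
      filter_upwards [ae_all_iff.2 hX] with ω hω
      refine (tendsto_finsetSum Finset.univ fun i _ => (hω i).const_mul (t i)).congr fun n => ?_
      simp_rw [Finset.mul_sum, Finset.sum_mul, ← mul_assoc]
      exact Finset.sum_comm)
  have hchar : charFun (P.map fun ω => WithLp.toLp 2 (X · ω)) t =
      ∫ ω, Complex.exp ((∑ i, t i * X i ω : ℝ) * I) ∂P := by
    rw [charFun_apply, integral_map (by fun_prop) (by fun_prop)]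
    congr 1
  rw [hchar]
  refine tendsto_nhds_unique hjoint (hprod.congr fun n => ?_)
  rw [← Complex.ofReal_prod, Finset.prod_comm]
  congr 1
  refine Finset.prod_congr rfl fun p _ => ?_
  -- at most one of the weights at `p` is nonzero, and `J₀ 0 = 1`
  have hJ0 : besselJZero 0 = 1 := by simp [besselJZero, Real.pi_ne_zero]
  by_cases hp : ∀ i, l i p = 0
  · simp [hp, hJ0]
  · push Not at hp
    obtain ⟨i, hi⟩ := hp
    have hz : ∀ j, j ≠ i → l j p = 0 := fun j hj => (hdisj p j i hj).resolve_right hi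
    rw [Finset.prod_eq_single i (fun j _ hj => by rw [hz j hj, mul_zero, hJ0]) (by simp),
      Finset.sum_eq_single i (fun j _ hj => by rw [hz j hj, mul_zero]) (by simp)]

theorem abs_map_real_Iic_sub_gaussianReal_le [IsProbabilityMeasure P]
    (hζ : ∀ p, HasLaw (ζ p) uniformCircle P)
    (hind : iIndepFun ζ P) {w : ι → ℝ} (hw : ∀ p, w p ^ 2 ≤ 256) {G : ℕ → Finset ι} {U : Ω → ℝ}
    (hU : ∀ᵐ ω ∂P, Tendsto (fun n => ∑ p ∈ G n, w p * (ζ p ω).re) atTop (𝓝 (U ω))) {V : ℝ}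
    (hV : Tendsto (fun n => ∑ p ∈ G n, w p ^ 2 / 2) atTop (𝓝 V)) (hV1 : 1 ≤ V) (x : ℝ) :
    |(P.map U).real (Set.Iic x) - (gaussianReal 0 V.toNNReal).real (Set.Iic x)| ≤ 2 ^ 40 / V := by
  have hm := aemeasurable_of_tendsto_sum_re hζ hU
  have : IsProbabilityMeasure (P.map U) := Measure.isProbabilityMeasure_map hm
  have hcoe : ((V.toNNReal : NNReal) : ℝ) = V := Real.coe_toNNReal V (by linarith)
  have key := abs_real_Iic_sub_gaussianReal_le (μ := P.map U) (v := V.toNNReal)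
    (by simpa using hV1) ?_ ?_ x
  · rwa [hcoe] at key
  · intro t ht
    rw [hcoe]
    have hE : ∀ c : ℝ, Tendsto (fun n => Real.exp (-((∑ p ∈ G n, w p ^ 2 / 2) * t ^ 2 / c))) atTop
        (𝓝 (Real.exp (-(V * t ^ 2 / c)))) := fun c =>
      (Real.continuous_exp.tendsto _).comp ((hV.mul_const _).div_const _).neg
    refine le_of_tendsto_of_tendsto' ((tendsto_charFun_map hζ hind hU t).sub
      ((Complex.continuous_ofReal.tendsto _).comp (hE 2))).norm
      (((hV.const_mul 1024).mul_const (t ^ 4)).mul (hE 8)) fun n => ?_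
    rw [Function.comp_apply, ← Complex.ofReal_sub, Complex.norm_real, Real.norm_eq_abs]
    exact abs_prod_besselJZero_sub_exp_le _ (fun p _ => hw p) ht
  · intro t
    rw [hcoe]
    refine le_of_tendsto_of_tendsto' (tendsto_charFun_map hζ hind hU t).norm
      ((Real.continuous_exp.tendsto _).comp ((hV.div_const 2048).mul_const _).neg) fun n => ?_
    rw [Complex.norm_real, Real.norm_eq_abs]
    exact abs_prod_besselJZero_le _ (fun p _ => hw p) t

end CircleSums

/-! ### The race variables -/

section Race

variable {q : ℕ} [NeZero q] {a : Fin 3 → (ZMod q)ˣ}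

theorem mem_oddOneOut {i : Fin 3} {χ : DirichletCharacter ℂ q} :
    χ ∈ oddOneOut a i ↔ ∀ j, j ≠ i → χ (a j : ZMod q) = -χ (a i : ZMod q) := by
  simp [oddOneOut]

theorem notMem_oddOneOut_of_mem {i j : Fin 3} (hij : i ≠ j) {χ : DirichletCharacter ℂ q}
    (hi : χ ∈ oddOneOut a i) : χ ∉ oddOneOut a j := by
  rw [mem_oddOneOut] at *
  intro hj
  obtain ⟨k, hki, hkj⟩ : ∃ k : Fin 3, k ≠ i ∧ k ≠ j := by
    clear hi hj hij
    revert i j; decide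
  have h1 := hi k hki
  have h2 := hj k hkj
  have h3 := hi j hij.symm
  have h4 : χ (a j : ZMod q) ≠ 0 := ((a j).isUnit.map χ).ne_zero
  apply h4
  have : χ (a j : ZMod q) = -χ (a j : ZMod q) := by rw [← h2, h1, ← h3]
  exact self_eq_neg.1 this

theorem UpperZero.tendsto_toFinset_atTop (χ : DirichletCharacter ℂ q) :
    Tendsto (fun n : ℕ => (UpperZero.finite_ordinate_lt χ n).toFinset) atTop atTop := by
  refine tendsto_atTop_finset_of_monotone (fun m n hmn => ?_) fun z => ?_
  · refine Set.Finite.toFinset_subset_toFinset.2 fun z hz => ?_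
    exact lt_of_lt_of_le (show z.ordinate < m from hz) (by exact_mod_cast hmn)
  · obtain ⟨n, hn⟩ := exists_nat_gt z.ordinate
    exact ⟨n, by simpa using hn⟩

open scoped Classical in
/-- The coefficient of `Re Z_{χ,γ}` in the race variable `X_i`. -/
noncomputable def raceWeight (a : Fin 3 → (ZMod q)ˣ) (i : Fin 3)
    (p : Σ χ : DirichletCharacter ℂ q, UpperZero χ) : ℝ :=
  if p.1 ∈ oddOneOut a i then 8 * (Real.sqrt (1 / 4 + p.2.ordinate ^ 2))⁻¹ else 0

/-- All zeros of ordinate below `n` of all characters modulo `q`. -/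
noncomputable def zerosBelow (q : ℕ) [NeZero q] (n : ℕ) :
    Finset (Σ χ : DirichletCharacter ℂ q, UpperZero χ) :=
  Finset.univ.sigma fun χ => (UpperZero.finite_ordinate_lt χ n).toFinset

theorem raceWeight_sq_le (i : Fin 3) (p : Σ χ : DirichletCharacter ℂ q, UpperZero χ) :
    raceWeight a i p ^ 2 ≤ 256 := by
  rw [raceWeight]
  split_ifs
  · rw [mul_pow, inv_pow, Real.sq_sqrt (by positivity)]
    have : (1 / 4 + p.2.ordinate ^ 2)⁻¹ ≤ 4 := by
      rw [inv_le_comm₀ (by positivity) (by norm_num)]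
      nlinarith [sq_nonneg p.2.ordinate]
    linarith
  · norm_num

theorem tendsto_sum_raceWeight {Ω : Type*} [MeasurableSpace Ω] {P : Measure Ω}
    {Z : (χ : DirichletCharacter ℂ q) → UpperZero χ → Ω → ℂ} {i : Fin 3}
    (hconv : ∀ χ ∈ oddOneOut a i, ∀ᵐ ω ∂P,
      Tendsto (fun T : ℝ => charPartialSum (Z χ) T ω) atTop (𝓝 (charSum (Z χ) ω))) :
    ∀ᵐ ω ∂P, Tendsto (fun n => ∑ p ∈ zerosBelow q n, raceWeight a i p * (Z p.1 p.2 ω).re) atTop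
      (𝓝 (raceVariable a Z i ω)) := by
  classical
  have := (ae_ball_iff (oddOneOut a i).countable_toSet (p := fun ω χ _ =>
    Tendsto (fun T : ℝ => charPartialSum (Z χ) T ω) atTop (𝓝 (charSum (Z χ) ω)))).2 hconv
  filter_upwards [this] with ω hω
  have h1 : Tendsto (fun n : ℕ => 8 * ∑ χ ∈ oddOneOut a i, (charPartialSum (Z χ) n ω).re) atTop
      (𝓝 (raceVariable a Z i ω)) := by
    refine (tendsto_finsetSum _ fun χ hχ => ?_).const_mul 8
    exact ((Complex.continuous_re.tendsto _).comp (hω χ hχ)).comp tendsto_natCast_atTop_atTop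
  refine h1.congr fun n => ?_
  rw [zerosBelow, Finset.sum_sigma, ← Finset.sum_filter_add_sum_filter_not Finset.univ
    (fun χ => χ ∈ oddOneOut a i), Finset.filter_mem_eq_inter, Finset.univ_inter, Finset.mul_sum]
  rw [Finset.sum_eq_zero (s := Finset.univ.filter fun χ => χ ∉ oddOneOut a i), add_zero]
  · refine Finset.sum_congr rfl fun χ hχ => ?_
    rw [charPartialSum, Complex.re_sum, Finset.mul_sum]
    refine Finset.sum_congr rfl fun z _ => ?_
    rw [raceWeight, if_pos hχ, Complex.div_ofReal_re]
    simp only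
    ring
  · intro χ hχ
    refine Finset.sum_eq_zero fun z _ => ?_
    rw [raceWeight, if_neg (Finset.mem_filter.1 hχ).2, zero_mul]

theorem tendsto_sum_raceWeight_sq {i : Fin 3} (hsum : ∀ χ ∈ oddOneOut a i,
      Summable fun z : UpperZero χ => 1 / (1 / 4 + z.ordinate ^ 2)) :
    Tendsto (fun n => ∑ p ∈ zerosBelow q n, raceWeight a i p ^ 2 / 2) atTop
      (𝓝 (raceVariance a i)) := by
  classical
  have h1 : Tendsto (fun n : ℕ => 32 * ∑ χ ∈ oddOneOut a i,
      ∑ z ∈ (UpperZero.finite_ordinate_lt χ n).toFinset, 1 / (1 / 4 + z.ordinate ^ 2)) atTop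
      (𝓝 (raceVariance a i)) :=
    (tendsto_finsetSum _ fun χ hχ =>
      (hsum χ hχ).hasSum.comp (UpperZero.tendsto_toFinset_atTop χ)).const_mul 32
  refine h1.congr fun n => ?_
  rw [zerosBelow, Finset.sum_sigma, ← Finset.sum_filter_add_sum_filter_not Finset.univ
    (fun χ => χ ∈ oddOneOut a i), Finset.filter_mem_eq_inter, Finset.univ_inter, Finset.mul_sum]
  rw [Finset.sum_eq_zero (s := Finset.univ.filter fun χ => χ ∉ oddOneOut a i), add_zero]
  · refine Finset.sum_congr rfl fun χ hχ => ?_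
    rw [Finset.mul_sum]
    refine Finset.sum_congr rfl fun z _ => ?_
    rw [raceWeight, if_pos hχ, mul_pow, inv_pow, Real.sq_sqrt (by positivity)]
    simp only [one_div]
    ring
  · intro χ hχ
    refine Finset.sum_eq_zero fun z _ => ?_
    rw [raceWeight, if_neg (Finset.mem_filter.1 hχ).2]
    norm_num

/-- The comparison of the two ordering probabilities in terms of the three variances. -/
theorem abs_measureReal_ordered_sub_le
    (hsum : ∀ i, ∀ χ ∈ oddOneOut a i,
      Summable fun z : UpperZero χ => 1 / (1 / 4 + z.ordinate ^ 2))
    {V : ℝ} (hV1 : 1 ≤ V) (hV : ∀ i, V ≤ raceVariance a i)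
    {Ω : Type*} [MeasurableSpace Ω] {P : Measure Ω} [IsProbabilityMeasure P]
    {Z : (χ : DirichletCharacter ℂ q) → UpperZero χ → Ω → ℂ}
    (hZ : ∀ χ z, HasLaw (Z χ z) uniformCircle P)
    (hind : iIndepFun (fun p : (Σ χ : DirichletCharacter ℂ q, UpperZero χ) => Z p.1 p.2) P)
    (hconv : ∀ i, ∀ χ ∈ oddOneOut a i, ∀ᵐ ω ∂P,
      Tendsto (fun T : ℝ => charPartialSum (Z χ) T ω) atTop (𝓝 (charSum (Z χ) ω)))
    {Ω' : Type*} [MeasurableSpace Ω'] {P' : Measure Ω'} [IsProbabilityMeasure P']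
    {Y : Fin 3 → Ω' → ℝ}
    (hY : ∀ i, HasLaw (Y i) (gaussianReal 0 (raceVariance a i).toNNReal) P')
    (hYind : iIndepFun Y P') {i j k : Fin 3} (hij : i ≠ j) (hjk : j ≠ k) (hik : i ≠ k) :
    |P.real {ω | raceVariable a Z i ω > raceVariable a Z j ω ∧
        raceVariable a Z j ω > raceVariable a Z k ω} -
      P'.real {ω | Y i ω > Y j ω ∧ Y j ω > Y k ω}| ≤ 2 ^ 42 / V := by
  have hζ : ∀ p : (Σ χ : DirichletCharacter ℂ q, UpperZero χ),
      HasLaw (Z p.1 p.2) uniformCircle P := fun p => hZ p.1 p.2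
  have hlim := fun i => tendsto_sum_raceWeight (hconv i)
  have hm : ∀ i, AEMeasurable (raceVariable a Z i) P := fun i =>
    aemeasurable_of_tendsto_sum_re hζ (hlim i)
  have hXind : iIndepFun (raceVariable a Z) P := by
    refine iIndepFun_of_tendsto_sum_re hζ hind (l := raceWeight a) (fun p i j hij => ?_) hlim
    by_cases hi : p.1 ∈ oddOneOut a i
    · right
      rw [raceWeight, if_neg (notMem_oddOneOut_of_mem hij hi)]
    · left
      rw [raceWeight, if_neg hi]
  have hdist : ∀ i x, |(P.map (raceVariable a Z i)).real (Set.Iic x) -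
      (P'.map (Y i)).real (Set.Iic x)| ≤ 2 ^ 40 / V := fun i x => by
    rw [(hY i).map_eq]
    refine (abs_map_real_Iic_sub_gaussianReal_le hζ hind (raceWeight_sq_le i) (hlim i)
      (tendsto_sum_raceWeight_sq (hsum i)) (hV1.trans (hV i)) x).trans ?_
    gcongr
    exact hV i
  have hYm : ∀ i, AEMeasurable (Y i) P' := fun i => (hY i).aemeasurable
  rw [measureReal_ordered_eq_prod hm hXind hij hjk hik,
    measureReal_ordered_eq_prod hYm hYind hij hjk hik]
  have h1 : ∀ i, IsProbabilityMeasure (P.map (raceVariable a Z i)) := fun i =>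
    Measure.isProbabilityMeasure_map (hm i)
  have h2 : ∀ i, IsProbabilityMeasure (P'.map (Y i)) := fun i =>
    Measure.isProbabilityMeasure_map (hYm i)
  refine (abs_prod_real_ordered_sub_le (hdist i) (hdist j) (hdist k)).trans (le_of_eq ?_)
  ring

end Race

/-! ### Bounds for Dirichlet `L`-functions -/

theorem ZMod.sum_range_natCast {q : ℕ} [NeZero q] {E : Type*} [AddCommMonoid E] (g : ZMod q → E) :
    ∑ x ∈ Finset.range q, g (x : ZMod q) = ∑ y, g y := by
  refine Finset.sum_nbij' (fun x => (x : ZMod q)) (fun y => y.val) (by simp) ?_ ?_ ?_ ?_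
  · intro y _
    simpa using ZMod.val_lt y
  · intro x hx
    exact ZMod.val_cast_of_lt (Finset.mem_range.1 hx)
  · intro y _
    exact ZMod.natCast_zmod_val y
  · intro x _
    rfl

section LBounds

variable {q : ℕ} [NeZero q] {χ : DirichletCharacter ℂ q}

theorem norm_sum_range_dirichletCharacter_le (hχ : χ ≠ 1) (n : ℕ) :
    ‖∑ m ∈ Finset.range n, χ ((m + 1 : ℕ) : ZMod q)‖ ≤ q := by
  induction n using Nat.strong_induction_on with
  | _ n ih =>
    rcases lt_or_ge n q with h | h
    · refine (norm_sum_le _ _).trans ?_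
      calc ∑ m ∈ Finset.range n, ‖χ ((m + 1 : ℕ) : ZMod q)‖ ≤ ∑ m ∈ Finset.range n, (1 : ℝ) :=
            Finset.sum_le_sum fun m _ => χ.norm_le_one _
        _ ≤ q := by simpa using by exact_mod_cast h.le
    · obtain ⟨k, rfl⟩ := Nat.exists_eq_add_of_le h
      rw [add_comm, Finset.sum_range_add]
      have h0 : ∑ x ∈ Finset.range q, χ ((k + x + 1 : ℕ) : ZMod q) = 0 := by
        rw [← MulChar.sum_eq_zero_of_ne_one hχ,
          ← Equiv.sum_comp (Equiv.addLeft ((k + 1 : ℕ) : ZMod q)),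
          ← ZMod.sum_range_natCast fun y => χ (Equiv.addLeft ((k + 1 : ℕ) : ZMod q) y)]
        refine Finset.sum_congr rfl fun x _ => ?_
        congr 1
        simp only [Equiv.coe_addLeft]
        push_cast
        ring
      rw [h0, add_zero]
      exact ih k (by have := NeZero.pos q; omega)

theorem sum_range_mul_eq_summation_by_parts (f g : ℕ → ℂ) (N : ℕ) :
    ∑ n ∈ Finset.range N, f n * g n = (∑ m ∈ Finset.range N, f m) * g N +
      ∑ n ∈ Finset.range N, (∑ m ∈ Finset.range (n + 1), f m) * (g n - g (n + 1)) := by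
  induction N with
  | zero => simp
  | succ N ih =>
    rw [Finset.sum_range_succ, ih, Finset.sum_range_succ (fun n => (∑ m ∈ Finset.range (n + 1),
      f m) * (g n - g (n + 1))), Finset.sum_range_succ f N]
    ring

theorem norm_cpow_neg_sub_le {s : ℂ} (hs : 0 ≤ s.re) (n : ℕ) :
    ‖((n + 1 : ℕ) : ℂ) ^ (-s) - ((n + 2 : ℕ) : ℂ) ^ (-s)‖ ≤ ‖s‖ * (n + 1 : ℝ) ^ (-s.re - 1) := by
  have hd : ∀ x ∈ Set.Icc (n + 1 : ℝ) (n + 2), HasDerivWithinAt (fun x : ℝ => (x : ℂ) ^ (-s))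
      (-s * (x : ℂ) ^ (-s - 1)) (Set.Icc (n + 1 : ℝ) (n + 2)) x := by
    intro x hx
    have hx0 : (0 : ℝ) < x := by linarith [hx.1, n.cast_nonneg (α := ℝ)]
    by_cases hs0 : s = 0
    · simp only [hs0, neg_zero, Complex.cpow_zero, zero_mul]
      exact hasDerivWithinAt_const _ _ _
    · exact (hasDerivAt_ofReal_cpow_const hx0.ne' (neg_ne_zero.2 hs0)).hasDerivWithinAt
  have hb : ∀ x ∈ Set.Icc (n + 1 : ℝ) (n + 2),
      ‖-s * (x : ℂ) ^ (-s - 1)‖ ≤ ‖s‖ * (n + 1 : ℝ) ^ (-s.re - 1) := by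
    intro x hx
    have hx0 : (0 : ℝ) < x := by linarith [hx.1, n.cast_nonneg (α := ℝ)]
    rw [norm_mul, norm_neg, Complex.norm_cpow_eq_rpow_re_of_pos hx0]
    simp only [Complex.sub_re, Complex.neg_re, Complex.one_re]
    gcongr ?_ * ?_
    exact Real.rpow_le_rpow_of_nonpos (by positivity) hx.1 (by linarith)
  have := Convex.norm_image_sub_le_of_norm_hasDerivWithin_le hd hb (convex_Icc _ _)
    (Set.right_mem_Icc.2 (by linarith)) (Set.left_mem_Icc.2 (by linarith))
  refine le_trans (le_of_eq ?_) (this.trans (le_of_eq ?_))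
  · push_cast; rfl
  · norm_num

/-- The summand of the series for `L(s, χ)` obtained by summation by parts. -/
noncomputable def abelTerm (χ : DirichletCharacter ℂ q) (n : ℕ) (s : ℂ) : ℂ :=
  (∑ m ∈ Finset.range (n + 1), χ ((m + 1 : ℕ) : ZMod q)) *
    (((n + 1 : ℕ) : ℂ) ^ (-s) - ((n + 2 : ℕ) : ℂ) ^ (-s))

theorem norm_abelTerm_le (hχ : χ ≠ 1) {δ : ℝ} (hδ : 0 ≤ δ) {s : ℂ} (hs : δ ≤ s.re) (n : ℕ) :
    ‖abelTerm χ n s‖ ≤ q * ‖s‖ * (n + 1 : ℝ) ^ (-δ - 1) := by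
  rw [abelTerm, norm_mul, mul_assoc]
  refine mul_le_mul (norm_sum_range_dirichletCharacter_le hχ _) ?_ (norm_nonneg _)
    (Nat.cast_nonneg _)
  refine (norm_cpow_neg_sub_le (hδ.trans hs) n).trans ?_
  gcongr
  · linarith [n.cast_nonneg (α := ℝ)]

theorem summable_nat_add_one_rpow {δ : ℝ} (hδ : 0 < δ) :
    Summable fun n : ℕ => (n + 1 : ℝ) ^ (-δ - 1) := by
  have := (summable_nat_add_iff 1).2 (Real.summable_nat_rpow.2 (by linarith : -δ - 1 < -1))
  simpa using this

theorem differentiableOn_tsum_abelTerm (hχ : χ ≠ 1) :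
    DifferentiableOn ℂ (fun s => ∑' n, abelTerm χ n s) {s | (1 / 8 : ℝ) < s.re} := by
  intro s hs
  have hU : IsOpen ({s : ℂ | (1 / 8 : ℝ) < s.re} ∩ Metric.ball 0 (‖s‖ + 1)) :=
    (isOpen_lt continuous_const Complex.continuous_re).inter Metric.isOpen_ball
  have hd := differentiableOn_tsum_of_summable_norm (F := fun n s => abelTerm χ n s)
    (u := fun n : ℕ => q * (‖s‖ + 1) * (n + 1 : ℝ) ^ (-(1 / 8 : ℝ) - 1))
    ((summable_nat_add_one_rpow (by norm_num)).mul_left _) (fun n => ?_) hU (fun n w hw => ?_)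
  · exact ((hd s ⟨hs, by simp⟩).differentiableAt (hU.mem_nhds ⟨hs, by simp⟩)).differentiableWithinAt
  · unfold abelTerm
    refine Differentiable.differentiableOn ?_
    have : ∀ k : ℕ, k ≠ 0 → Differentiable ℂ fun s : ℂ => (k : ℂ) ^ (-s) := fun k hk =>
      differentiable_neg.const_cpow (Or.inl (by exact_mod_cast hk))
    exact ((this _ (by omega)).sub (this _ (by omega))).const_mul _
  · refine (norm_abelTerm_le hχ (by norm_num : (0 : ℝ) ≤ 1 / 8) (le_of_lt hw.1) n).trans ?_
    have : ‖w‖ < ‖s‖ + 1 := by simpa using hw.2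
    gcongr

theorem LFunction_eq_tsum_abelTerm_of_one_lt_re (hχ : χ ≠ 1) {s : ℂ} (hs : 1 < s.re) :
    DirichletCharacter.LFunction χ s = ∑' n, abelTerm χ n s := by
  have h1 : HasSum (fun n : ℕ => χ ((n + 1 : ℕ) : ZMod q) * ((n + 1 : ℕ) : ℂ) ^ (-s))
      (DirichletCharacter.LFunction χ s) := by
    rw [DirichletCharacter.LFunction_eq_LSeries χ hs]
    have h := ((DirichletCharacter.LSeriesSummable_of_one_lt_re χ hs).LSeriesHasSum)
    rw [LSeriesHasSum, ← hasSum_nat_add_iff' 1] at h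
    simp only [Finset.sum_range_one, LSeries.term_zero, sub_zero] at h
    convert! h using 2 with n
    rw [LSeries.term_of_ne_zero (by omega), div_eq_mul_inv, Complex.cpow_neg]
  have hsum : Summable fun n => abelTerm χ n s :=
    Summable.of_norm_bounded (((summable_nat_add_one_rpow (by norm_num : (0 : ℝ) < 1)).mul_left _))
      (norm_abelTerm_le hχ (by norm_num) hs.le)
  have hz : Tendsto (fun N : ℕ => (∑ m ∈ Finset.range N, χ ((m + 1 : ℕ) : ZMod q)) *
      ((N + 1 : ℕ) : ℂ) ^ (-s)) atTop (𝓝 0) := by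
    have hb : Tendsto (fun N : ℕ => (q : ℝ) * (N + 1 : ℝ) ^ (-s.re)) atTop (𝓝 0) := by
      rw [← mul_zero (q : ℝ)]
      refine Tendsto.const_mul _ ?_
      exact (tendsto_rpow_neg_atTop (by linarith : 0 < s.re)).comp
        (tendsto_atTop_add_const_right _ _ tendsto_natCast_atTop_atTop)
    refine squeeze_zero_norm (fun N => ?_) hb
    rw [norm_mul]
    refine mul_le_mul (norm_sum_range_dirichletCharacter_le hχ N) (le_of_eq ?_) (norm_nonneg _)
      (Nat.cast_nonneg _)
    rw [Complex.norm_natCast_cpow_of_pos (by omega)]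
    push_cast; rfl
  refine tendsto_nhds_unique h1.tendsto_sum_nat ?_
  have := hz.add hsum.hasSum.tendsto_sum_nat
  rw [zero_add] at this
  refine this.congr fun N => ?_
  rw [sum_range_mul_eq_summation_by_parts (fun n => χ ((n + 1 : ℕ) : ZMod q))
    (fun n => ((n + 1 : ℕ) : ℂ) ^ (-s)) N]
  rfl

/-- Summation by parts continues the Dirichlet series to the left of `Re s = 1`; both sides are
analytic and they agree for `Re s > 1`. -/
theorem LFunction_eq_tsum_abelTerm (hχ : χ ≠ 1) {s : ℂ} (hs : (1 / 8 : ℝ) < s.re) :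
    DirichletCharacter.LFunction χ s = ∑' n, abelTerm χ n s := by
  have hopen : IsOpen {s : ℂ | (1 / 8 : ℝ) < s.re} := isOpen_lt continuous_const continuous_re
  have hL : AnalyticOnNhd ℂ (DirichletCharacter.LFunction χ) {s : ℂ | (1 / 8 : ℝ) < s.re} :=
    (DirichletCharacter.differentiable_LFunction hχ).differentiableOn.analyticOnNhd hopen
  have hF := (differentiableOn_tsum_abelTerm hχ).analyticOnNhd hopen
  have hconv : IsPreconnected {s : ℂ | (1 / 8 : ℝ) < s.re} :=
    (convex_halfSpace_re_gt _).isPreconnected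
  refine hL.eqOn_of_preconnected_of_eventuallyEq hF hconv (z₀ := 2) (by norm_num) ?_ hs
  have : {s : ℂ | 1 < s.re} ∈ 𝓝 (2 : ℂ) :=
    (isOpen_lt continuous_const continuous_re).mem_nhds (by norm_num)
  filter_upwards [this] with w hw
  exact LFunction_eq_tsum_abelTerm_of_one_lt_re hχ hw

/-- The absolute constant in the bound `‖L(s, χ)‖ ≤ C q ‖s‖` for `Re s ≥ 1/4`. -/
noncomputable def lBoundConst : ℝ := ∑' n : ℕ, (n + 1 : ℝ) ^ (-(1 / 4 : ℝ) - 1)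

theorem one_le_lBoundConst : 1 ≤ lBoundConst := by
  have := (summable_nat_add_one_rpow (by norm_num : (0 : ℝ) < 1 / 4)).le_tsum 0
    fun n _ => by positivity
  simpa [lBoundConst] using this

theorem norm_LFunction_le (hχ : χ ≠ 1) {s : ℂ} (hs : 1 / 4 ≤ s.re) :
    ‖DirichletCharacter.LFunction χ s‖ ≤ lBoundConst * q * ‖s‖ := by
  rw [LFunction_eq_tsum_abelTerm hχ (by linarith)]
  have hsum := (summable_nat_add_one_rpow (by norm_num : (0 : ℝ) < 1 / 4)).mul_left (q * ‖s‖)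
  refine (tsum_of_norm_bounded hsum.hasSum
    (norm_abelTerm_le hχ (by norm_num) hs)).trans (le_of_eq ?_)
  rw [tsum_mul_left, lBoundConst]
  ring

/-- The terms of the Dirichlet series with `n ≥ 2` sum to at most `ζ(2) - 1 < 2/3`. -/
theorem one_third_le_norm_LFunction {s : ℂ} (hs : 2 ≤ s.re) :
    1 / 3 ≤ ‖DirichletCharacter.LFunction χ s‖ := by
  have hs1 : 1 < s.re := by linarith
  rw [DirichletCharacter.LFunction_eq_LSeries χ hs1]
  have h := (DirichletCharacter.LSeriesSummable_of_one_lt_re χ hs1).LSeriesHasSum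
  rw [LSeriesHasSum, ← hasSum_nat_add_iff' 2] at h
  have hz := (hasSum_nat_add_iff' 2).2 hasSum_zeta_two
  have hb : ∀ n : ℕ, ‖LSeries.term (fun n => χ (n : ZMod q)) s (n + 2)‖ ≤
      1 / ((n + 2 : ℕ) : ℝ) ^ 2 := by
    intro n
    rw [LSeries.term_of_ne_zero (by omega), norm_div,
      Complex.norm_natCast_cpow_of_pos (by omega)]
    have h1 : (1 : ℝ) ≤ ((n + 2 : ℕ) : ℝ) := by norm_cast; omega
    have h2 : ((n + 2 : ℕ) : ℝ) ^ 2 ≤ ((n + 2 : ℕ) : ℝ) ^ s.re := by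
      rw [← Real.rpow_natCast]
      exact Real.rpow_le_rpow_of_exponent_le h1 (by exact_mod_cast hs)
    exact div_le_div₀ zero_le_one (χ.norm_le_one _) (by positivity) h2
  have hn := tsum_of_norm_bounded hz hb
  rw [h.tsum_eq] at hn
  simp only [Finset.sum_range_succ, Finset.sum_range_zero, LSeries.term_zero, zero_add] at hn
  rw [LSeries.term_of_ne_zero one_ne_zero] at hn
  simp only [Nat.cast_one, map_one, Complex.one_cpow, div_one] at hn
  have hp : Real.pi ^ 2 / 6 - 1 ≤ 2 / 3 := by
    have := Real.pi_lt_d2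
    have := Real.pi_pos
    nlinarith
  have h3 := norm_sub_norm_le (1 : ℂ) (1 - LSeries (fun n => χ (n : ZMod q)) s)
  rw [sub_sub_cancel, norm_one, norm_sub_rev] at h3
  norm_num at hn
  linarith

end LBounds

/-! ### Counting zeros by Jensen's formula -/

theorem divisor_eq_analyticOrderNatAt {f : ℂ → ℂ} {U : Set ℂ} (hf : AnalyticOnNhd ℂ f U) {z : ℂ}
    (hz : z ∈ U) : MeromorphicOn.divisor f U z = (analyticOrderNatAt f z : ℤ) := by
  rw [MeromorphicOn.AnalyticOnNhd.divisor_apply hf hz, analyticOrderNatAt]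
  cases analyticOrderAt f z <;> simp

/-- Jensen's bound for the number of zeros in a disc, with multiplicity, in terms of a finite set of
zeros. -/
theorem sum_analyticOrderNatAt_le {f : ℂ → ℂ} (hf : Differentiable ℂ f) {c : ℂ} (hc : f c ≠ 0)
    {r R M : ℝ} (hr : 0 < r) (hrR : r < R) (hM : 1 ≤ M)
    (hb : ∀ z ∈ Metric.sphere c R, ‖f z‖ ≤ M) (F : Finset ℂ) (hF : ∀ u ∈ F, ‖u - c‖ ≤ r) :
    ∑ u ∈ F, (analyticOrderNatAt f u : ℝ) ≤ Real.log (M / ‖f c‖) / Real.log (R / r) := by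
  have hR : 0 < R := hr.trans hrR
  have han : ∀ U, AnalyticOnNhd ℂ f U := fun U =>
    (hf.differentiableOn.analyticOnNhd isOpen_univ).mono (Set.subset_univ U)
  have key := (han (Metric.closedBall c |R|)).sum_divisor_le (r := r) (M := M)
    (by rwa [abs_of_pos hr]) (by rwa [abs_of_pos hr, abs_of_pos hR]) hM hc
    (by rwa [abs_of_pos hR])
  refine le_trans ?_ key
  rw [abs_of_pos hr]
  set D := MeromorphicOn.divisor f (Metric.closedBall c r) with hD
  have hfin : (Function.support D).Finite := D.finiteSupport (isCompact_closedBall c r)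
  have h1 : ∑ u ∈ F, (analyticOrderNatAt f u : ℤ) ≤ ∑ᶠ u, D u := by
    rw [finsum_eq_sum_of_support_subset (s := hfin.toFinset ∪ F) _ (by
      intro u hu; simp only [Finset.coe_union, Set.Finite.coe_toFinset]; exact Or.inl hu)]
    calc ∑ u ∈ F, (analyticOrderNatAt f u : ℤ) = ∑ u ∈ F, D u := by
          refine Finset.sum_congr rfl fun u hu => ?_
          rw [hD, divisor_eq_analyticOrderNatAt (han _) (by
            rw [Metric.mem_closedBall, dist_eq_norm]; exact hF u hu)]
      _ ≤ _ := Finset.sum_le_sum_of_subset_of_nonneg Finset.subset_union_right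
          fun u _ _ => MeromorphicOn.AnalyticOnNhd.divisor_nonneg (han _) u
  exact_mod_cast h1

section ZeroCount

variable {q : ℕ} [NeZero q] {χ : DirichletCharacter ℂ q}

/-- A unit interval of the critical line contains `O(log (q (|T| + 4)))` zeros: it lies in the disc
of radius `8/5` about `2 + iT`, and the disc of radius `7/4` stays in `Re s ≥ 1/4`. -/
theorem sum_zeroMultiplicity_le (hχ : χ ≠ 1) (T : ℝ) (F : Finset ℝ)
    (hF : ∀ t ∈ F, |t - T| ≤ 1 / 2) :
    ∑ t ∈ F, (zeroMultiplicity χ t : ℝ) ≤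
      12 * Real.log (3 * lBoundConst * q * (|T| + 4)) := by
  classical
  have hq : (1 : ℝ) ≤ q := by exact_mod_cast NeZero.one_le
  have hC := one_le_lBoundConst
  set f := DirichletCharacter.LFunction χ with hf
  set c : ℂ := 2 + T * I with hc
  set M : ℝ := lBoundConst * q * (|T| + 4) with hMdef
  have hM : 1 ≤ M := by
    have := abs_nonneg T
    have h1 : 1 ≤ lBoundConst * q := one_le_mul_of_one_le_of_one_le hC hq
    exact one_le_mul_of_one_le_of_one_le h1 (by linarith)
  have hre : c.re = 2 := by simp [hc]
  have hfc : 1 / 3 ≤ ‖f c‖ := one_third_le_norm_LFunction hre.ge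
  have hinj : Function.Injective fun t : ℝ => (1 / 2 + t * I : ℂ) := fun s t h => by
    simpa using h
  have hnorm : ‖c‖ ≤ 2 + |T| := by
    refine (norm_add_le _ _).trans ?_
    simp
  have key := sum_analyticOrderNatAt_le (DirichletCharacter.differentiable_LFunction hχ) (c := c)
    (fun h => by rw [← hf] at h; rw [h, norm_zero] at hfc; norm_num at hfc)
    (r := 8 / 5) (R := 7 / 4) (by norm_num) (by norm_num) hM (fun z hz => ?_)
    (F.map ⟨_, hinj⟩) (fun u hu => ?_)
  · rw [Finset.sum_map] at key
    refine key.trans ?_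
    rw [← hf]
    have h3M : Real.log (M / ‖f c‖) ≤ Real.log (3 * lBoundConst * q * (|T| + 4)) := by
      refine Real.log_le_log (by positivity) ?_
      rw [div_le_iff₀ (by linarith)]
      have : 3 * lBoundConst * q * (|T| + 4) = 3 * M := by rw [hMdef]; ring
      rw [this]
      nlinarith
    have hlog : (1 / 12 : ℝ) ≤ Real.log (7 / 4 / (8 / 5)) := by
      have := Real.one_sub_inv_le_log_of_pos (x := (7 / 4 / (8 / 5) : ℝ)) (by norm_num)
      norm_num at this ⊢
      linarith
    have h0 : 0 ≤ Real.log (3 * lBoundConst * q * (|T| + 4)) := by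
      refine Real.log_nonneg ?_
      have : 3 * lBoundConst * q * (|T| + 4) = 3 * M := by rw [hMdef]; ring
      linarith
    rw [div_le_iff₀ (by linarith)]
    nlinarith
  · rw [mem_sphere_iff_norm] at hz
    have hzre : 1 / 4 ≤ z.re := by
      have := (Complex.abs_re_le_norm (z - c))
      rw [hz, Complex.sub_re, hre] at this
      linarith [(abs_le.1 this).1]
    refine (norm_LFunction_le hχ hzre).trans ?_
    rw [hMdef]
    gcongr
    have := norm_le_norm_add_norm_sub' z c
    rw [hz] at this
    linarith
  · obtain ⟨t, ht, rfl⟩ := Finset.mem_map.1 hu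
    have h := hF t ht
    simp only [Function.Embedding.coeFn_mk]
    have he : (1 / 2 + t * I : ℂ) - c = ((-(3 / 2) : ℝ) : ℂ) + ((t - T : ℝ) : ℂ) * I := by
      rw [hc]; push_cast; ring
    rw [he, Complex.norm_add_mul_I, Real.sqrt_le_iff]
    refine ⟨by norm_num, ?_⟩
    have := sq_le_sq' (abs_le.1 h).1 (abs_le.1 h).2
    nlinarith

theorem UpperZero.card_le (v : Finset (UpperZero χ)) (F : Finset ℝ)
    (hF : ∀ z ∈ v, z.ordinate ∈ F) : (v.card : ℝ) ≤ ∑ t ∈ F, (zeroMultiplicity χ t : ℝ) := by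
  classical
  rw [Finset.card_eq_sum_card_fiberwise (f := UpperZero.ordinate) (t := F) fun z hz => hF z hz]
  push_cast
  refine Finset.sum_le_sum fun t _ => ?_
  have : (v.filter fun z => z.ordinate = t).card ≤ (Finset.range (zeroMultiplicity χ t)).card := by
    refine Finset.card_le_card_of_injOn (fun z => z.1.2) (fun z hz => ?_) fun z hz w hw h => ?_
    · have h1 : z.ordinate = t := (Finset.mem_filter.1 hz).2
      have h2 := z.2.2
      rw [Finset.mem_coe, Finset.mem_range, ← h1]
      exact h2
    · have h1 : z.ordinate = t := (Finset.mem_filter.1 hz).2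
      have h2 : w.ordinate = t := (Finset.mem_filter.1 hw).2
      exact Subtype.ext (Prod.ext (h1.trans h2.symm) h)
  rw [Finset.card_range] at this
  exact_mod_cast this

theorem UpperZero.ordinate_pos (z : UpperZero χ) : 0 < z.ordinate := z.2.1

/-- There are `O(log (q k))` zeros with ordinate between `k` and `k + 1`. -/
theorem summable_one_div_ordinate (hχ : χ ≠ 1) :
    Summable fun z : UpperZero χ => 1 / (1 / 4 + z.ordinate ^ 2) := by
  classical
  have hC := one_le_lBoundConst
  have hq : (1 : ℝ) ≤ q := by exact_mod_cast NeZero.one_le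
  set A : ℝ := 3 * lBoundConst * q with hA
  have hA0 : 0 < A := by positivity
  set B : ℕ → ℝ := fun k => 960 * A * (k + 1 : ℝ) ^ (-(1 / 2 : ℝ) - 1) with hB
  have hBs : Summable B := (summable_nat_add_one_rpow (by norm_num)).mul_left _
  have hB0 : ∀ k, 0 ≤ B k := fun k => by positivity
  refine summable_of_sum_le (c := ∑' k, B k) (fun z => by positivity) fun u => ?_
  rw [← Finset.sum_fiberwise_of_maps_to (t := u.image fun z => ⌊z.ordinate⌋₊)
    (g := fun z => ⌊z.ordinate⌋₊) fun z hz => Finset.mem_image_of_mem _ hz]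
  refine (Finset.sum_le_sum fun k _ => ?_).trans (hBs.sum_le_tsum _ fun k _ => hB0 k)
  set v := u.filter fun z => ⌊z.ordinate⌋₊ = k with hv
  have hzk : ∀ z ∈ v, (k : ℝ) ≤ z.ordinate ∧ z.ordinate < k + 1 := fun z hz => by
    have h := (Finset.mem_filter.1 hz).2
    rw [← h]
    exact ⟨Nat.floor_le z.ordinate_pos.le, Nat.lt_floor_add_one _⟩
  have hcard : (v.card : ℝ) ≤ 12 * Real.log (A * (k + 5)) := by
    refine (UpperZero.card_le v (v.image UpperZero.ordinate)
      fun z hz => Finset.mem_image_of_mem _ hz).trans ?_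
    refine (sum_zeroMultiplicity_le hχ (k + 1 / 2) _ fun t ht => ?_).trans ?_
    · obtain ⟨z, hz, rfl⟩ := Finset.mem_image.1 ht
      have := hzk z hz
      rw [abs_le]
      constructor <;> linarith
    · have : |(k : ℝ) + 1 / 2| = k + 1 / 2 := abs_of_nonneg (by positivity)
      rw [this]
      refine mul_le_mul_of_nonneg_left (Real.log_le_log (by positivity) ?_) (by norm_num)
      exact mul_le_mul_of_nonneg_left (by linarith) hA0.le
  have hterm : ∀ z ∈ v, 1 / (1 / 4 + z.ordinate ^ 2) ≤ 8 / (k + 1 : ℝ) ^ 2 := fun z hz => by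
    have h := (hzk z hz).1
    have hk : (0 : ℝ) ≤ k := Nat.cast_nonneg k
    rw [div_le_div_iff₀ (by positivity) (by positivity)]
    nlinarith [mul_self_le_mul_self hk h, sq_nonneg ((k : ℝ) - 1)]
  calc ∑ z ∈ v, 1 / (1 / 4 + z.ordinate ^ 2) ≤ ∑ z ∈ v, 8 / (k + 1 : ℝ) ^ 2 :=
        Finset.sum_le_sum hterm
    _ = v.card * (8 / (k + 1 : ℝ) ^ 2) := by rw [Finset.sum_const, nsmul_eq_mul]
    _ ≤ (120 * A * (k + 1 : ℝ) ^ (1 / 2 : ℝ)) * (8 / (k + 1 : ℝ) ^ 2) := by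
        gcongr
        refine hcard.trans ?_
        have h1 := Real.log_le_rpow_div (x := A * (k + 5)) (ε := 1 / 2) (by positivity)
          (by norm_num)
        have hA1 : 1 ≤ 5 * A := by
          have := one_le_mul_of_one_le_of_one_le hC hq
          rw [hA]; nlinarith
        have h2 : (A * (k + 5 : ℝ)) ^ (1 / 2 : ℝ) ≤ 5 * A * (k + 1 : ℝ) ^ (1 / 2 : ℝ) := by
          calc (A * (k + 5 : ℝ)) ^ (1 / 2 : ℝ) ≤ ((5 * A) * (k + 1 : ℝ)) ^ (1 / 2 : ℝ) := by
                refine Real.rpow_le_rpow (by positivity) ?_ (by norm_num)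
                nlinarith [mul_nonneg hA0.le (Nat.cast_nonneg (α := ℝ) k)]
            _ = (5 * A) ^ (1 / 2 : ℝ) * (k + 1 : ℝ) ^ (1 / 2 : ℝ) :=
                Real.mul_rpow (by positivity) (by positivity)
            _ ≤ _ := by
                gcongr
                exact Real.rpow_le_self_of_one_le hA1 (by norm_num)
        linarith
    _ = B k := by
        have hk : (0 : ℝ) < k + 1 := by positivity
        have : (k + 1 : ℝ) ^ (-(1 / 2 : ℝ) - 1) = (k + 1 : ℝ) ^ (1 / 2 : ℝ) / (k + 1 : ℝ) ^ 2 := by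
          rw [← Real.rpow_natCast, ← Real.rpow_sub hk]
          norm_num
        rw [hB]
        simp only
        rw [this]
        ring

theorem sum_zeroMultiplicity_div_le_bPlus (hχ : χ ≠ 1) (F : Finset ℝ) (hF : ∀ t ∈ F, 0 < t) :
    ∑ t ∈ F, (zeroMultiplicity χ t : ℝ) * (1 / (1 / 4 + t ^ 2)) ≤ bPlus χ := by
  classical
  let e : (Σ t : F, Fin (zeroMultiplicity χ t)) ↪ UpperZero χ :=
    ⟨fun p => ⟨(p.1.1, p.2.1), hF _ p.1.2, p.2.2⟩, by
      rintro ⟨⟨t, ht⟩, n⟩ ⟨⟨s, hs⟩, m⟩ h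
      have h := congrArg Subtype.val h
      obtain ⟨rfl, h2⟩ := Prod.ext_iff.1 h
      have := Fin.ext h2
      subst this
      rfl⟩
  have h := (summable_one_div_ordinate hχ).sum_le_tsum (Finset.univ.map e)
    fun z _ => by positivity
  refine le_trans (le_of_eq ?_) h
  rw [Finset.sum_map, Fintype.sum_sigma, ← Finset.sum_coe_sort]
  refine Finset.sum_congr rfl fun t _ => ?_
  have : ∀ n : Fin (zeroMultiplicity χ t), (e ⟨t, n⟩).ordinate = t.1 := fun n => rfl
  simp [this]

end ZeroCount

/-! ### Polar coordinates and logarithms of analytic functions -/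

theorem circleAverage_eq_integral_neg_pi_pi (f : ℂ → ℝ) (c : ℂ) (R : ℝ) :
    Real.circleAverage f c R =
      (2 * Real.pi)⁻¹ * ∫ θ in Set.Ioo (-Real.pi) Real.pi, f (circleMap c R θ) := by
  rw [Real.circleAverage_eq_integral_add (-Real.pi), smul_eq_mul,
    intervalIntegral.integral_comp_add_right (fun θ => f (circleMap c R θ)),
    ← integral_Ioc_eq_integral_Ioo,
    ← intervalIntegral.integral_of_le (by linarith [Real.pi_pos])]
  congr 2 <;> ring

theorem CircleIntegrable.integrableOn_Ioo {f : ℂ → ℝ} {c : ℂ} {R : ℝ}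
    (hf : CircleIntegrable f c R) :
    IntegrableOn (fun θ => f (circleMap c R θ)) (Set.Ioo (-Real.pi) Real.pi) := by
  have hper : Function.Periodic (fun θ => f (circleMap c R θ)) (2 * Real.pi) := fun θ => by
    simp [periodic_circleMap c R θ]
  have h := hper.intervalIntegrable₀ Real.two_pi_pos.ne' hf (-Real.pi) Real.pi
  rw [intervalIntegrable_iff_integrableOn_Ioo_of_le (by linarith [Real.pi_pos])] at h
  exact h

theorem lintegral_eq_lintegral_circleMap {g : ℂ → ENNReal} (hg : Measurable g) (c : ℂ) :
    ∫⁻ z, g z = ∫⁻ r in Set.Ioi (0 : ℝ), ENNReal.ofReal r *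
      ∫⁻ θ in Set.Ioo (-Real.pi) Real.pi, g (circleMap c r θ) := by
  have hm : Measurable fun p : ℝ × ℝ => g (circleMap c p.1 p.2) :=
    hg.comp (by unfold circleMap; fun_prop)
  rw [← lintegral_add_left_eq_self g c, ← Complex.lintegral_comp_polarCoord_symm,
    polarCoord_target, Measure.volume_eq_prod, ← Measure.prod_restrict,
    lintegral_prod _ (by
      simp only [Complex.polarCoord_symm_apply]
      fun_prop)]
  refine lintegral_congr fun r => ?_
  have hmr : Measurable fun θ => g (circleMap c r θ) := hm.comp measurable_prodMk_left
  rw [← lintegral_const_mul _ hmr]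
  refine lintegral_congr fun θ => ?_
  rw [Complex.polarCoord_symm_apply, smul_eq_mul, circleMap, Complex.exp_mul_I]
  push_cast
  rfl

/-- Among the circles of radius between `R` and `R + 1`, one carries at most its fair share of the
integral of `g` over the plane. -/
theorem exists_lintegral_circleMap_le {g : ℂ → ENNReal} (hg : Measurable g) (c : ℂ) {R : ℝ}
    (hR : 0 < R) : ∃ r ∈ Set.Icc R (R + 1), ENNReal.ofReal R *
      ∫⁻ θ in Set.Ioo (-Real.pi) Real.pi, g (circleMap c r θ) ≤ ∫⁻ z, g z := by
  have hm : Measurable fun p : ℝ × ℝ => g (circleMap c p.1 p.2) :=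
    hg.comp (by unfold circleMap; fun_prop)
  have hvol : (volume (Set.Icc R (R + 1))) = 1 := by simp
  obtain ⟨r, hr, h⟩ := exists_le_setLAverage (μ := volume) (s := Set.Icc R (R + 1))
    (f := fun r => ENNReal.ofReal R * ∫⁻ θ in Set.Ioo (-Real.pi) Real.pi, g (circleMap c r θ))
    (by rw [hvol]; exact one_ne_zero) (by rw [hvol]; exact ENNReal.one_ne_top)
    (hm.lintegral_prod_right'.const_mul _).aemeasurable
  refine ⟨r, hr, h.trans ?_⟩
  rw [setLAverage_eq, hvol, div_one, lintegral_eq_lintegral_circleMap hg c]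
  calc _ ≤ ∫⁻ r in Set.Icc R (R + 1), ENNReal.ofReal r *
        ∫⁻ θ in Set.Ioo (-Real.pi) Real.pi, g (circleMap c r θ) := by
        refine setLIntegral_mono' measurableSet_Icc fun x hx => ?_
        gcongr
        exact hx.1
    _ ≤ _ := lintegral_mono_set fun x hx => hR.trans_le hx.1

/-- A pointwise lower bound on a circle, up to a nonnegative error of small integral, gives a lower
bound for the circle average. -/
theorem le_circleAverage_of_lintegral_le {F g : ℂ → ℝ} {h : ℝ → ℝ} {c : ℂ} {R K : ℝ}
    (hF : CircleIntegrable F c R) (hg : Measurable g) (hg0 : ∀ z, 0 ≤ g z) (hK : 0 ≤ K)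
    (hI : ∫⁻ θ in Set.Ioo (-Real.pi) Real.pi, ENNReal.ofReal (g (circleMap c R θ)) ≤
      ENNReal.ofReal K)
    (hh : Continuous h) (hpt : ∀ θ, h θ - g (circleMap c R θ) ≤ F (circleMap c R θ)) :
    (2 * Real.pi)⁻¹ * ((∫ θ in (-Real.pi)..Real.pi, h θ) - K) ≤ Real.circleAverage F c R := by
  have hgm : Measurable fun θ => g (circleMap c R θ) := hg.comp (by unfold circleMap; fun_prop)
  have hgi : IntegrableOn (fun θ => g (circleMap c R θ)) (Set.Ioo (-Real.pi) Real.pi) := by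
    refine ⟨hgm.aestronglyMeasurable, ?_⟩
    rw [hasFiniteIntegral_iff_ofReal (ae_of_all _ fun θ => hg0 _)]
    exact hI.trans_lt ENNReal.ofReal_lt_top
  have hgle : ∫ θ in Set.Ioo (-Real.pi) Real.pi, g (circleMap c R θ) ≤ K := by
    rw [integral_eq_lintegral_of_nonneg_ae (ae_of_all _ fun θ => hg0 _) hgm.aestronglyMeasurable]
    exact ENNReal.toReal_le_of_le_ofReal hK hI
  have hhi : IntegrableOn h (Set.Ioo (-Real.pi) Real.pi) :=
    (hh.integrableOn_Icc (a := -Real.pi) (b := Real.pi)).mono_set Set.Ioo_subset_Icc_self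
  rw [circleAverage_eq_integral_neg_pi_pi,
    intervalIntegral.integral_of_le (by linarith [Real.pi_pos]), integral_Ioc_eq_integral_Ioo]
  refine mul_le_mul_of_nonneg_left ?_ (inv_nonneg.2 Real.two_pi_pos.le)
  calc _ ≤ (∫ θ in Set.Ioo (-Real.pi) Real.pi, h θ) -
        ∫ θ in Set.Ioo (-Real.pi) Real.pi, g (circleMap c R θ) := by linarith
    _ = ∫ θ in Set.Ioo (-Real.pi) Real.pi, (h θ - g (circleMap c R θ)) :=
        (integral_sub hhi hgi).symm
    _ ≤ _ := integral_mono (hhi.sub hgi) hF.integrableOn_Ioo hpt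

theorem log_norm_le_circleAverage {f : ℂ → ℂ} {c : ℂ} {R : ℝ} (hR : 0 < R)
    (hf : AnalyticOnNhd ℂ f (Metric.closedBall c R)) (hc : f c ≠ 0) :
    Real.log ‖f c‖ ≤ Real.circleAverage (fun z => Real.log ‖f z‖) c R := by
  rw [← abs_of_pos hR] at hf
  rw [hf.circleAverage_log_norm hR.ne' hc]
  refine le_add_of_nonneg_left (finsum_nonneg fun u => ?_)
  by_cases hu : u ∈ Metric.closedBall c |R|
  · refine mul_nonneg (by exact_mod_cast MeromorphicOn.AnalyticOnNhd.divisor_nonneg hf u) ?_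
    rcases eq_or_ne u c with rfl | hne
    · simp
    · refine Real.log_nonneg ?_
      have h0 : 0 < ‖c - u‖ := norm_pos_iff.2 (sub_ne_zero.2 hne.symm)
      rw [← div_eq_mul_inv, one_le_div h0]
      rwa [Metric.mem_closedBall, abs_of_pos hR, dist_comm, dist_eq_norm] at hu
  · rw [Function.locallyFinsuppWithin.apply_eq_zero_of_notMem _ hu]
    simp

/-- Jensen's formula bounds the mean of `log⁺ (1 / |f|)` on circles about a point where `f` is not
small. -/
theorem circleAverage_posLog_inv_le {f : ℂ → ℂ} {c : ℂ} {R K : ℝ} (hR : 0 < R)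
    (hf : AnalyticOnNhd ℂ f (Metric.closedBall c R)) (hc : f c ≠ 0) (hK : 1 ≤ K)
    (hb : ∀ z ∈ Metric.closedBall c R, ‖f z‖ ≤ K) :
    CircleIntegrable (fun z => Real.posLog ‖f z‖⁻¹) c R ∧
    Real.circleAverage (fun z => Real.posLog ‖f z‖⁻¹) c R ≤ Real.log K - Real.log ‖f c‖ := by
  have hmero : MeromorphicOn f (Metric.sphere c |R|) := by
    rw [abs_of_pos hR]
    exact (hf.mono Metric.sphere_subset_closedBall).meromorphicOn
  have h1 := hmero.circleIntegrable_posLog_norm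
  have h2 := hmero.circleIntegrable_log_norm
  have he : (fun z => Real.posLog ‖f z‖⁻¹) =
      fun z => Real.posLog ‖f z‖ - Real.log ‖f z‖ := by
    ext z
    rw [← Real.posLog_sub_posLog_inv]
    ring
  rw [he]
  refine ⟨h1.sub h2, ?_⟩
  rw [Real.circleAverage_fun_sub h1 h2]
  have h3 : Real.circleAverage (fun z => Real.posLog ‖f z‖) c R ≤ Real.log K := by
    refine Real.circleAverage_mono_on_of_le_circle h1 fun z hz => ?_
    rw [abs_of_pos hR] at hz
    rw [Real.posLog_apply]
    refine max_le (Real.log_nonneg hK) ?_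
    rcases (norm_nonneg (f z)).eq_or_lt with h | h
    · rw [← h, Real.log_zero]
      exact Real.log_nonneg hK
    · exact Real.log_le_log h (hb z (Metric.sphere_subset_closedBall hz))
  linarith [log_norm_le_circleAverage hR hf hc]

theorem lintegral_closedBall_posLog_inv_le {f : ℂ → ℂ} (hf : Differentiable ℂ f) {c : ℂ} {R K : ℝ}
    (hR : 0 < R) (hc : f c ≠ 0) (hK : 1 ≤ K) (hb : ∀ z ∈ Metric.closedBall c R, ‖f z‖ ≤ K) :
    ∫⁻ z in Metric.closedBall c R, ENNReal.ofReal (Real.posLog ‖f z‖⁻¹) ≤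
      ENNReal.ofReal (2 * Real.pi * R ^ 2 * (Real.log K - Real.log ‖f c‖)) := by
  have hB : 0 ≤ Real.log K - Real.log ‖f c‖ := by
    rw [sub_nonneg]
    exact Real.log_le_log (norm_pos_iff.2 hc) (hb c (Metric.mem_closedBall_self hR.le))
  set B := Real.log K - Real.log ‖f c‖ with hBdef
  have hm : Measurable fun z => ENNReal.ofReal (Real.posLog ‖f z‖⁻¹) :=
    (Real.continuous_posLog.measurable.comp hf.continuous.norm.measurable.inv).ennreal_ofReal
  rw [← lintegral_indicator measurableSet_closedBall,
    lintegral_eq_lintegral_circleMap (hm.indicator measurableSet_closedBall) c]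
  have hcirc : ∀ r ∈ Set.Ioc (0 : ℝ) R, ∫⁻ θ in Set.Ioo (-Real.pi) Real.pi,
      ENNReal.ofReal (Real.posLog ‖f (circleMap c r θ)‖⁻¹) ≤ ENNReal.ofReal (2 * Real.pi * B) := by
    intro r hr
    have hsub : Metric.closedBall c r ⊆ Metric.closedBall c R :=
      Metric.closedBall_subset_closedBall hr.2
    obtain ⟨hi, hle⟩ := circleAverage_posLog_inv_le hr.1
      ((hf.differentiableOn.analyticOnNhd isOpen_univ).mono (Set.subset_univ _)) hc hK
      fun z hz => hb z (hsub hz)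
    rw [← ofReal_integral_eq_lintegral_ofReal hi.integrableOn_Ioo
      (ae_of_all _ fun θ => Real.posLog_nonneg)]
    refine ENNReal.ofReal_le_ofReal ?_
    rw [circleAverage_eq_integral_neg_pi_pi, inv_mul_le_iff₀ Real.two_pi_pos] at hle
    exact hle
  calc _ ≤ ∫⁻ r in Set.Ioi (0 : ℝ), (Set.Ioc (0 : ℝ) R).indicator
        (fun _ => ENNReal.ofReal R * ENNReal.ofReal (2 * Real.pi * B)) r := by
        refine setLIntegral_mono' measurableSet_Ioi fun r hr => ?_
        have hr0 : (0 : ℝ) < r := hr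
        by_cases hrR : r ≤ R
        · rw [Set.indicator_of_mem (Set.mem_Ioc.2 ⟨hr0, hrR⟩)]
          gcongr
          refine le_trans (lintegral_mono fun θ => ?_) (hcirc r ⟨hr0, hrR⟩)
          exact Set.indicator_le_self _ _ _
        · have : ∀ θ, (Metric.closedBall c R).indicator
              (fun z => ENNReal.ofReal (Real.posLog ‖f z‖⁻¹)) (circleMap c r θ) = 0 := fun θ => by
            refine Set.indicator_of_notMem (fun h => hrR ?_) _
            have h2 := circleMap_mem_sphere c hr0.le θ
            rw [Metric.mem_sphere] at h2
            rwa [Metric.mem_closedBall, h2] at h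
          simp [this]
    _ ≤ ∫⁻ r, (Set.Ioc (0 : ℝ) R).indicator
        (fun _ => ENNReal.ofReal R * ENNReal.ofReal (2 * Real.pi * B)) r :=
        setLIntegral_le_lintegral _ _
    _ = ENNReal.ofReal (2 * Real.pi * R ^ 2 * B) := by
        rw [lintegral_indicator measurableSet_Ioc, setLIntegral_const, Real.volume_Ioc, sub_zero,
          ← ENNReal.ofReal_mul hR.le, ← ENNReal.ofReal_mul (by positivity)]
        congr 1
        ring

/-! ### The self-dual product of completed `L`-functions -/

namespace DirichletCharacter

theorem gammaFactor_inv {n : ℕ} (χ : DirichletCharacter ℂ n) (s : ℂ) :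
    gammaFactor χ⁻¹ s = gammaFactor χ s := by
  have h : χ⁻¹.Even ↔ χ.Even := by
    simp only [DirichletCharacter.Even, MulChar.inv_apply_eq_inv', inv_eq_one]
  by_cases hχ : χ.Even
  · rw [hχ.gammaFactor_def, (h.2 hχ).gammaFactor_def]
  · rw [gammaFactor, gammaFactor, if_neg hχ, if_neg (h.not.2 hχ)]

theorem gammaFactor_ne_zero {n : ℕ} (χ : DirichletCharacter ℂ n) {s : ℂ} (hs : 0 < s.re) :
    gammaFactor χ s ≠ 0 := by
  rw [gammaFactor]
  split_ifs
  · exact Gammaℝ_ne_zero_of_re_pos hs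
  · exact Gammaℝ_ne_zero_of_re_pos (by rw [add_re, one_re]; linarith)

theorem differentiableAt_Gammaℝ {s : ℂ} (hs : 0 < s.re) : DifferentiableAt ℂ Gammaℝ s := by
  have h := (differentiable_Gammaℝ_inv s).inv (inv_ne_zero (Gammaℝ_ne_zero_of_re_pos hs))
  have he : (fun s => (Gammaℝ s)⁻¹)⁻¹ = Gammaℝ := funext fun s => by simp
  rwa [he] at h

theorem differentiableAt_gammaFactor {n : ℕ} (χ : DirichletCharacter ℂ n) {s : ℂ}
    (hs : 0 < s.re) : DifferentiableAt ℂ (gammaFactor χ) s := by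
  unfold gammaFactor
  split_ifs
  · exact differentiableAt_Gammaℝ hs
  · refine DifferentiableAt.comp (g := Gammaℝ) (f := fun s => s + 1) s (differentiableAt_Gammaℝ ?_)
      (by fun_prop)
    rw [add_re, one_re]; linarith

/-- The Archimedean factors are bounded below on a bounded part of the half-plane `1/2 ≤ Re s`,
and above at `2`, uniformly in the character. -/
theorem exists_le_norm_gammaFactor (B : ℝ) : ∃ g : ℝ, 0 < g ∧ g ≤ 1 ∧ ∃ G : ℝ,
    ∀ {n : ℕ} (χ : DirichletCharacter ℂ n), (∀ s : ℂ, 1 / 2 ≤ s.re → ‖s‖ ≤ B →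
      g ≤ ‖gammaFactor χ s‖) ∧ ‖gammaFactor χ 2‖ ≤ G := by
  have hK : IsCompact ({s : ℂ | 1 / 2 ≤ s.re} ∩ Metric.closedBall 0 B) :=
    (isCompact_closedBall 0 B).inter_left (isClosed_le continuous_const continuous_re)
  have hpos : ∀ s ∈ {s : ℂ | 1 / 2 ≤ s.re} ∩ Metric.closedBall 0 B, 0 < s.re := fun s hs =>
    lt_of_lt_of_le (by norm_num) hs.1
  have hc1 : ContinuousOn (fun s => ‖Gammaℝ s‖)
      ({s : ℂ | 1 / 2 ≤ s.re} ∩ Metric.closedBall 0 B) := fun s hs =>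
    (differentiableAt_Gammaℝ (hpos s hs)).continuousAt.norm.continuousWithinAt
  have hc2 : ContinuousOn (fun s => ‖Gammaℝ (s + 1)‖)
      ({s : ℂ | 1 / 2 ≤ s.re} ∩ Metric.closedBall 0 B) := fun s hs => by
    refine ContinuousAt.continuousWithinAt (ContinuousAt.norm ?_)
    refine ContinuousAt.comp (g := Gammaℝ) (differentiableAt_Gammaℝ ?_).continuousAt (by fun_prop)
    rw [add_re, one_re]; linarith [hpos s hs]
  obtain ⟨g1, h1, hg1⟩ := hK.exists_forall_le' hc1 (a := 0)
    fun s hs => norm_pos_iff.2 (Gammaℝ_ne_zero_of_re_pos (hpos s hs))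
  obtain ⟨g2, h2, hg2⟩ := hK.exists_forall_le' hc2 (a := 0)
    fun s hs => norm_pos_iff.2 (Gammaℝ_ne_zero_of_re_pos (by
      rw [add_re, one_re]; linarith [hpos s hs]))
  refine ⟨min 1 (min g1 g2), by positivity, min_le_left _ _, max ‖Gammaℝ 2‖ ‖Gammaℝ (2 + 1)‖,
    fun χ => ⟨fun s hs hB => ?_, ?_⟩⟩
  · have hmem : s ∈ {s : ℂ | 1 / 2 ≤ s.re} ∩ Metric.closedBall 0 B :=
      ⟨hs, mem_closedBall_zero_iff.2 hB⟩
    rw [gammaFactor]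
    split_ifs
    · exact ((min_le_right _ _).trans (min_le_left _ _)).trans (hg1 s hmem)
    · exact ((min_le_right _ _).trans (min_le_right _ _)).trans (hg2 s hmem)
  · rw [gammaFactor]
    split_ifs
    · exact le_max_left _ _
    · exact le_max_right _ _

theorem IsPrimitive.inv {N : ℕ} {ψ : DirichletCharacter ℂ N} (hψ : ψ.IsPrimitive) :
    ψ⁻¹.IsPrimitive :=
  (conductor_inv ψ).trans hψ

variable {N : ℕ} [NeZero N]

/-- `L(s, ψ) L(s, ψ⁻¹)`. -/
noncomputable def lPair (ψ : DirichletCharacter ℂ N) (s : ℂ) : ℂ :=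
  LFunction ψ s * LFunction ψ⁻¹ s

/-- `Λ(s, ψ) Λ(s, ψ⁻¹)`, which the functional equation maps to itself. -/
noncomputable def completedPair (ψ : DirichletCharacter ℂ N) (s : ℂ) : ℂ :=
  completedLFunction ψ s * completedLFunction ψ⁻¹ s

variable {ψ : DirichletCharacter ℂ N}

theorem differentiable_lPair (h1 : ψ ≠ 1) : Differentiable ℂ (lPair ψ) :=
  (differentiable_LFunction h1).mul (differentiable_LFunction (inv_ne_one.2 h1))

theorem differentiable_completedPair (h1 : ψ ≠ 1) : Differentiable ℂ (completedPair ψ) :=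
  (differentiable_completedLFunction h1).mul (differentiable_completedLFunction (inv_ne_one.2 h1))

theorem completedPair_eq {s : ℂ} (hs : 0 < s.re) :
    completedPair ψ s = gammaFactor ψ s ^ 2 * lPair ψ s := by
  have h0 : s ≠ 0 := by rintro rfl; simp at hs
  have hg := gammaFactor_ne_zero ψ hs
  rw [completedPair, lPair, LFunction_eq_completed_div_gammaFactor ψ s (.inl h0),
    LFunction_eq_completed_div_gammaFactor ψ⁻¹ s (.inl h0), gammaFactor_inv]
  field_simp

theorem one_div_nine_le_norm_lPair {s : ℂ} (hs : 2 ≤ s.re) : 1 / 9 ≤ ‖lPair ψ s‖ := by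
  rw [lPair, norm_mul]
  have h1 := one_third_le_norm_LFunction (χ := ψ) hs
  have h2 := one_third_le_norm_LFunction (χ := ψ⁻¹) hs
  calc (1 / 9 : ℝ) = 1 / 3 * (1 / 3) := by norm_num
    _ ≤ _ := mul_le_mul h1 h2 (by norm_num) (norm_nonneg _)

theorem norm_lPair_le (h1 : ψ ≠ 1) {s : ℂ} (hs : 1 / 4 ≤ s.re) :
    ‖lPair ψ s‖ ≤ (lBoundConst * N * ‖s‖) ^ 2 := by
  rw [lPair, norm_mul, sq]
  exact mul_le_mul (norm_LFunction_le h1 hs) (norm_LFunction_le (inv_ne_one.2 h1) hs)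
    (norm_nonneg _) ((norm_nonneg _).trans (norm_LFunction_le h1 hs))

theorem completedPair_two_ne_zero : completedPair ψ 2 ≠ 0 := by
  rw [completedPair_eq (by norm_num)]
  refine mul_ne_zero (pow_ne_zero _ (gammaFactor_ne_zero ψ (by norm_num))) fun h => ?_
  have := one_div_nine_le_norm_lPair (ψ := ψ) (s := 2) (by norm_num)
  rw [h, norm_zero] at this
  norm_num at this

/-- The functional equation of `Λ(s, ψ) Λ(s, ψ⁻¹)`. That the constant has modulus `1` follows by
applying the equation twice. -/
theorem IsPrimitive.exists_completedPair_one_sub (hψ : ψ.IsPrimitive) : ∃ W : ℂ, ‖W‖ = 1 ∧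
    ∀ s, completedPair ψ (1 - s) = (N : ℂ) ^ (2 * s - 1) * W * completedPair ψ s := by
  have hN : (N : ℂ) ≠ 0 := Nat.cast_ne_zero.2 (NeZero.ne N)
  set W := rootNumber ψ * rootNumber ψ⁻¹ with hW
  have key : ∀ s, completedPair ψ (1 - s) = (N : ℂ) ^ (2 * s - 1) * W * completedPair ψ s := by
    intro s
    rw [completedPair, hψ.completedLFunction_one_sub, hψ.inv.completedLFunction_one_sub, inv_inv,
      show (2 * s - 1 : ℂ) = (s - 1 / 2) + (s - 1 / 2) by ring, cpow_add _ _ hN, completedPair, hW]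
    ring
  refine ⟨W, ?_, key⟩
  have h1 := key (1 - 2)
  rw [sub_sub_cancel, key 2] at h1
  have h2 : (N : ℂ) ^ (2 * (1 - 2 : ℂ) - 1) * (N : ℂ) ^ (2 * 2 - 1 : ℂ) = 1 := by
    rw [← cpow_add _ _ hN]
    norm_num
  have h3 : completedPair ψ 2 * 1 = completedPair ψ 2 * W ^ 2 := by
    calc completedPair ψ 2 * 1 = _ := by rw [mul_one, h1]
      _ = ((N : ℂ) ^ (2 * (1 - 2 : ℂ) - 1) * (N : ℂ) ^ (2 * 2 - 1 : ℂ)) *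
          (W ^ 2 * completedPair ψ 2) := by ring
      _ = _ := by rw [h2]; ring
  have h4 := mul_left_cancel₀ completedPair_two_ne_zero h3
  have h5 : ‖W‖ ^ 2 = 1 := by rw [← norm_pow, ← h4, norm_one]
  exact (pow_eq_one_iff_of_nonneg (norm_nonneg _) two_ne_zero).1 h5

/-- There are no zeros with `Re s ≥ 1`, hence by the functional equation none with `Re s ≤ 0`. -/
theorem re_eq_half_of_completedPair_eq_zero (hGRH : GRH) (hψ : ψ.IsPrimitive) (h1 : ψ ≠ 1) {s : ℂ}
    (hs : completedPair ψ s = 0) : s.re = 1 / 2 := by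
  have key : ∀ s, completedPair ψ s = 0 → 0 < s.re → s.re = 1 / 2 := by
    intro s hs h0
    rw [completedPair_eq h0] at hs
    have hs := (mul_eq_zero.1 hs).resolve_left (pow_ne_zero _ (gammaFactor_ne_zero ψ h0))
    have hlt : s.re < 1 := by
      by_contra! hge
      exact mul_ne_zero (LFunction_ne_zero_of_one_le_re ψ (.inl h1) hge)
        (LFunction_ne_zero_of_one_le_re ψ⁻¹ (.inl (inv_ne_one.2 h1)) hge) hs
    rcases mul_eq_zero.1 hs with h | h
    · exact hGRH N ψ s h h0 hlt
    · exact hGRH N ψ⁻¹ s h h0 hlt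
  rcases lt_or_ge 0 s.re with h0 | h0
  · exact key s hs h0
  · obtain ⟨W, -, hW⟩ := hψ.exists_completedPair_one_sub
    have h := key (1 - s) (by rw [hW, hs, mul_zero]) (by rw [sub_re, one_re]; linarith)
    rw [sub_re, one_re] at h
    linarith

theorem analyticAt_completedPair (h1 : ψ ≠ 1) (s : ℂ) : AnalyticAt ℂ (completedPair ψ) s :=
  (differentiable_completedPair h1).analyticAt s

theorem analyticOrderAt_ne_top_of_differentiable {f : ℂ → ℂ} (hf : Differentiable ℂ f) {c : ℂ}
    (hc : f c ≠ 0) (z : ℂ) : analyticOrderAt f z ≠ ⊤ := by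
  have han : AnalyticOnNhd ℂ f Set.univ := hf.differentiableOn.analyticOnNhd isOpen_univ
  refine han.analyticOrderAt_ne_top_of_isPreconnected isPreconnected_univ (Set.mem_univ c)
    (Set.mem_univ z) ?_
  rw [(han c (Set.mem_univ c)).analyticOrderAt_eq_zero.2 hc]
  simp

theorem analyticOrderAt_LFunction_ne_top (h1 : ψ ≠ 1) (z : ℂ) :
    analyticOrderAt (LFunction ψ) z ≠ ⊤ :=
  analyticOrderAt_ne_top_of_differentiable (differentiable_LFunction h1) (c := 2)
    (LFunction_ne_zero_of_one_le_re ψ (.inl h1) (by norm_num)) z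

/-- The zeros of `Λ(s, ψ) Λ(s, ψ⁻¹)` on the critical line are those of `L(s, ψ)` together with
those of `L(s, ψ⁻¹)`, the Archimedean factors being analytic and nonzero there. -/
theorem analyticOrderNatAt_completedPair (h1 : ψ ≠ 1) (t : ℝ) :
    analyticOrderNatAt (completedPair ψ) (1 / 2 + t * I) =
      zeroMultiplicity ψ t + zeroMultiplicity ψ⁻¹ t := by
  set s : ℂ := 1 / 2 + t * I with hs
  have hre : 0 < s.re := by simp [hs]
  have hopen : IsOpen {z : ℂ | 0 < z.re} := isOpen_lt continuous_const continuous_re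
  have hga : AnalyticAt ℂ (fun z => gammaFactor ψ z ^ 2) s := by
    have : DifferentiableOn ℂ (gammaFactor ψ) {z : ℂ | 0 < z.re} := fun z hz =>
      (differentiableAt_gammaFactor ψ hz).differentiableWithinAt
    exact ((this.analyticOnNhd hopen) s hre).pow 2
  have hev : completedPair ψ =ᶠ[𝓝 s] (fun z => gammaFactor ψ z ^ 2) * lPair ψ := by
    filter_upwards [hopen.mem_nhds hre] with z hz using completedPair_eq hz
  have ha1 := (differentiable_LFunction h1).analyticAt s
  have ha2 := (differentiable_LFunction (inv_ne_one.2 h1)).analyticAt s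
  have hord : analyticOrderAt (completedPair ψ) s =
      analyticOrderAt (LFunction ψ) s + analyticOrderAt (LFunction ψ⁻¹) s := by
    rw [analyticOrderAt_congr hev, analyticOrderAt_mul hga ((differentiable_lPair h1).analyticAt s),
      hga.analyticOrderAt_eq_zero.2 (pow_ne_zero _ (gammaFactor_ne_zero ψ hre)), zero_add]
    exact analyticOrderAt_mul ha1 ha2
  rw [analyticOrderNatAt, hord, ENat.toNat_add (analyticOrderAt_LFunction_ne_top h1 s)
    (analyticOrderAt_LFunction_ne_top (inv_ne_one.2 h1) s)]
  rfl

theorem IsPrimitive.analyticOrderNatAt_completedPair_neg (hψ : ψ.IsPrimitive) (h1 : ψ ≠ 1)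
    (t : ℝ) : analyticOrderNatAt (completedPair ψ) (1 / 2 + (-t : ℝ) * I) =
      analyticOrderNatAt (completedPair ψ) (1 / 2 + t * I) := by
  obtain ⟨W, hW1, hW⟩ := hψ.exists_completedPair_one_sub
  have hN : (N : ℂ) ≠ 0 := Nat.cast_ne_zero.2 (NeZero.ne N)
  have hW0 : W ≠ 0 := by rintro rfl; simp at hW1
  set s : ℂ := 1 / 2 + t * I with hs
  have h1s : (1 / 2 + (-t : ℝ) * I : ℂ) = 1 - s := by rw [hs]; push_cast; ring
  have hd : deriv (fun z : ℂ => 1 - z) s ≠ 0 := by simp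
  have hcomp := analyticOrderAt_comp_of_deriv_ne_zero (f := completedPair ψ) (z₀ := s)
    (g := fun z : ℂ => 1 - z) (by fun_prop) hd
  have hpa : AnalyticAt ℂ (fun z : ℂ => (N : ℂ) ^ (2 * z - 1) * W) s := by
    have : Differentiable ℂ (fun z : ℂ => (N : ℂ) ^ (2 * z - 1) * W) := by
      refine Differentiable.mul_const (Differentiable.const_cpow (by fun_prop) (.inl hN)) _
    exact this.analyticAt s
  have hfun : completedPair ψ ∘ (fun z : ℂ => 1 - z) =
      (fun z : ℂ => (N : ℂ) ^ (2 * z - 1) * W) * completedPair ψ := funext fun z => hW z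
  rw [h1s, analyticOrderNatAt, analyticOrderNatAt, ← hcomp, hfun,
    analyticOrderAt_mul hpa (analyticAt_completedPair h1 s), hpa.analyticOrderAt_eq_zero.2
      (mul_ne_zero (by rw [cpow_def_of_ne_zero hN]; exact exp_ne_zero _) hW0), zero_add]

end DirichletCharacter

/-! ### A lower bound for the number of low-lying zeros -/

namespace DirichletCharacter

/-- Two discs around the places where a circle of radius between `1000` and `1001` meets the strip
`1/2 ≤ Re s ≤ 2`, for circles about `2` and about `-1`. -/
def crossingDiscs : Set ℂ :=
  Metric.closedBall (2 + (2001 / 2 : ℝ) * I) (7 / 4) ∪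
    Metric.closedBall (2 + (-(2001 / 2) : ℝ) * I) (7 / 4)

theorem measurableSet_crossingDiscs : MeasurableSet crossingDiscs :=
  measurableSet_closedBall.union measurableSet_closedBall

theorem mem_crossingDiscs {z : ℂ} {R : ℝ} (hR : R ∈ Set.Icc (1000 : ℝ) 1001)
    (h1 : 1 / 2 ≤ z.re) (h2 : z.re ≤ 2) (h3 : R ^ 2 - 9 ≤ z.im ^ 2) (h4 : z.im ^ 2 ≤ R ^ 2) :
    z ∈ crossingDiscs := by
  obtain ⟨hR1, hR2⟩ := hR
  have hup : |z.im| ≤ R := abs_le_of_sq_le_sq h4 (by linarith)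
  have hlo : R - 1 / 100 ≤ |z.im| := by
    refine le_of_sq_le_sq ?_ (abs_nonneg _)
    rw [sq_abs]
    nlinarith
  have hdist : ∀ y : ℝ, |z.im - y| ≤ 51 / 100 →
      z ∈ Metric.closedBall (2 + (y : ℝ) * I) (7 / 4) := by
    intro y hy
    have he : z - (2 + (y : ℝ) * I) = ((z.re - 2 : ℝ) : ℂ) + ((z.im - y : ℝ) : ℂ) * I := by
      apply Complex.ext <;> simp
    rw [Metric.mem_closedBall, dist_eq_norm, he, Complex.norm_add_mul_I, Real.sqrt_le_iff]
    refine ⟨by norm_num, ?_⟩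
    have := sq_le_sq' (abs_le.1 hy).1 (abs_le.1 hy).2
    nlinarith
  rcases abs_cases z.im with ⟨h, _⟩ | ⟨h, _⟩ <;> rw [h] at hup hlo
  · refine Or.inl (hdist _ ?_)
    rw [abs_le]; constructor <;> linarith
  · refine Or.inr (hdist _ ?_)
    rw [abs_le]; constructor <;> linarith

variable {N : ℕ} [NeZero N] {ψ : DirichletCharacter ℂ N}

/-- `log⁺ (1 / |L(s, ψ) L(s, ψ⁻¹)|)` on the crossing discs, and `0` elsewhere. -/
noncomputable def crossingLoss (ψ : DirichletCharacter ℂ N) (s : ℂ) : ℝ :=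
  crossingDiscs.indicator (fun z => Real.posLog ‖lPair ψ z‖⁻¹) s

theorem crossingLoss_nonneg (s : ℂ) : 0 ≤ crossingLoss ψ s :=
  Set.indicator_nonneg (fun _ _ => Real.posLog_nonneg) s

theorem measurable_crossingLoss (h1 : ψ ≠ 1) : Measurable (crossingLoss ψ) :=
  (Real.continuous_posLog.measurable.comp
    (differentiable_lPair h1).continuous.norm.measurable.inv).indicator measurableSet_crossingDiscs

theorem posLog_inv_norm_lPair_le {s : ℂ} (hs : 2 ≤ s.re ∨ s ∈ crossingDiscs) :
    Real.posLog ‖lPair ψ s‖⁻¹ ≤ Real.log 9 + crossingLoss ψ s := by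
  have h9 : 0 ≤ Real.log 9 := Real.log_nonneg (by norm_num)
  rcases hs with hs | hs
  · refine le_add_of_le_of_nonneg ?_ (crossingLoss_nonneg s)
    have h := one_div_nine_le_norm_lPair (ψ := ψ) hs
    rw [Real.posLog_apply]
    refine max_le h9 (Real.log_le_log (inv_pos.2 (by linarith)) ?_)
    exact inv_le_of_inv_le₀ (by norm_num) (by linarith)
  · rw [crossingLoss, Set.indicator_of_mem hs]
    linarith

/-- The size `log (1005 C N)` of the logarithms of `L`-functions of conductor `N` in play. -/
noncomputable def logScale (N : ℕ) : ℝ := Real.log (1005 * lBoundConst * N)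

theorem logScale_eq (N : ℕ) [NeZero N] :
    logScale N = Real.log (1005 * lBoundConst) + Real.log N := by
  have := one_le_lBoundConst
  rw [logScale, Real.log_mul (by positivity) (by exact_mod_cast NeZero.ne N)]

theorem three_le_logScale (N : ℕ) [NeZero N] : 3 ≤ logScale N := by
  have hC := one_le_lBoundConst
  have hN : (1 : ℝ) ≤ N := by exact_mod_cast NeZero.one_le
  rw [logScale, Real.le_log_iff_exp_le (by positivity)]
  have h1 : Real.exp 3 ≤ 27 := by
    have h := Real.exp_one_lt_d9.le
    have : Real.exp 3 = Real.exp 1 ^ 3 := by rw [← Real.exp_nat_mul]; norm_num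
    rw [this]
    calc Real.exp 1 ^ 3 ≤ 3 ^ 3 := by gcongr; linarith
      _ = 27 := by norm_num
  have h2 : 1 ≤ lBoundConst * N := one_le_mul_of_one_le_of_one_le hC hN
  nlinarith

theorem lintegral_closedBall_posLog_inv_lPair_le (h1 : ψ ≠ 1) {y : ℝ} (hy : |y| = 2001 / 2) :
    ∫⁻ z in Metric.closedBall (2 + y * I) (7 / 4), ENNReal.ofReal (Real.posLog ‖lPair ψ z‖⁻¹) ≤
      ENNReal.ofReal (20 * Real.pi * logScale N) := by
  have hC := one_le_lBoundConst
  have hN : (1 : ℝ) ≤ N := by exact_mod_cast NeZero.one_le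
  have hCN : 1 ≤ lBoundConst * N := one_le_mul_of_one_le_of_one_le hC hN
  set c : ℂ := 2 + y * I with hc
  have hre : c.re = 2 := by simp [hc]
  have hc9 := one_div_nine_le_norm_lPair (ψ := ψ) (s := c) hre.ge
  have hcn : ‖c‖ ≤ 2 + 2001 / 2 := by
    refine (norm_add_le _ _).trans ?_
    simp [hy]
  refine (lintegral_closedBall_posLog_inv_le (differentiable_lPair h1) (by norm_num)
    (fun h => by rw [h, norm_zero] at hc9; norm_num at hc9) (K := (1005 * lBoundConst * N) ^ 2)
    ?_ fun z hz => ?_).trans (ENNReal.ofReal_le_ofReal ?_)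
  · exact one_le_pow₀ (by nlinarith)
  · rw [Metric.mem_closedBall, dist_eq_norm] at hz
    have hzre : 1 / 4 ≤ z.re := by
      have := (Complex.abs_re_le_norm (z - c)).trans hz
      rw [Complex.sub_re, hre] at this
      linarith [(abs_le.1 this).1]
    refine (norm_lPair_le h1 hzre).trans (pow_le_pow_left₀ (by positivity) ?_ 2)
    have : ‖z‖ ≤ 1005 := by
      have := norm_le_norm_add_norm_sub' z c
      linarith
    nlinarith
  · have hlog : -Real.log ‖lPair ψ c‖ ≤ logScale N := by
      refine le_trans ?_ (three_le_logScale N)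
      rw [← Real.log_inv]
      have h3 : ‖lPair ψ c‖⁻¹ ≤ Real.exp 3 := by
        have h9 : (9 : ℝ) ≤ Real.exp 3 := by
          have : Real.exp 3 = Real.exp 1 ^ 3 := by rw [← Real.exp_nat_mul]; norm_num
          rw [this]
          calc (9 : ℝ) ≤ (27 / 10) ^ 3 := by norm_num
            _ ≤ _ := by gcongr; linarith [Real.exp_one_gt_d9]
        exact (inv_le_of_inv_le₀ (by norm_num) (by linarith)).trans h9
      exact (Real.log_le_iff_le_exp (inv_pos.2 (by linarith))).2 h3
    have hpow : Real.log ((1005 * lBoundConst * N) ^ 2) = 2 * logScale N := by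
      rw [Real.log_pow, logScale]; norm_num
    rw [hpow]
    have := three_le_logScale N
    have hpi := Real.pi_pos
    nlinarith [mul_pos hpi (by linarith : 0 < logScale N)]

/-- Averaging over the radius shows that some circle of radius about `1000` passes the critical
strip at places where `L(s, ψ) L(s, ψ⁻¹)` is not too small in the mean. -/
theorem exists_lintegral_crossingLoss_le (h1 : ψ ≠ 1) : ∃ R ∈ Set.Icc (1000 : ℝ) 1001,
    ∫⁻ θ in Set.Ioo (-Real.pi) Real.pi, ENNReal.ofReal (crossingLoss ψ (circleMap 2 R θ) +
      crossingLoss ψ (1 - circleMap 2 R θ)) ≤ ENNReal.ofReal (2 * Real.pi * logScale N) := by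
  have hm := (measurable_crossingLoss h1).ennreal_ofReal
  have hm2 : Measurable fun z => ENNReal.ofReal (crossingLoss ψ (1 - z)) :=
    hm.comp (by fun_prop)
  have hpi := Real.pi_pos
  have hA := three_le_logScale N
  have hA0 : 0 ≤ Real.pi * logScale N := by positivity
  have hE : ∫⁻ z, ENNReal.ofReal (crossingLoss ψ z) ≤
      ENNReal.ofReal (40 * Real.pi * logScale N) := by
    have : (fun z => ENNReal.ofReal (crossingLoss ψ z)) = crossingDiscs.indicator
        fun z => ENNReal.ofReal (Real.posLog ‖lPair ψ z‖⁻¹) := by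
      ext z
      rw [crossingLoss]
      by_cases hz : z ∈ crossingDiscs <;> simp [hz]
    rw [this, lintegral_indicator measurableSet_crossingDiscs]
    refine (lintegral_union_le _ _ _).trans ((add_le_add
      (lintegral_closedBall_posLog_inv_lPair_le h1 (abs_of_pos (by norm_num)))
      (lintegral_closedBall_posLog_inv_lPair_le h1
        (by rw [abs_neg]; exact abs_of_pos (by norm_num)))).trans ?_)
    rw [← ENNReal.ofReal_add (by linarith) (by linarith)]
    exact ENNReal.ofReal_le_ofReal (by linarith)
  obtain ⟨R, hR, h⟩ := exists_lintegral_circleMap_le (g := fun z =>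
    ENNReal.ofReal (crossingLoss ψ z) + ENNReal.ofReal (crossingLoss ψ (1 - z)))
    (hm.add hm2) 2 (R := 1000) (by norm_num)
  refine ⟨R, ⟨hR.1, hR.2.trans (by norm_num)⟩, ?_⟩
  rw [lintegral_add_left hm,
    lintegral_sub_left_eq_self (fun z => ENNReal.ofReal (crossingLoss ψ z)) 1] at h
  have h80 : ENNReal.ofReal 1000 * ∫⁻ θ in Set.Ioo (-Real.pi) Real.pi,
      (ENNReal.ofReal (crossingLoss ψ (circleMap 2 R θ)) +
        ENNReal.ofReal (crossingLoss ψ (1 - circleMap 2 R θ))) ≤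
      ENNReal.ofReal 1000 * ENNReal.ofReal (2 * Real.pi * logScale N) := by
    refine h.trans ((add_le_add hE hE).trans ?_)
    rw [← ENNReal.ofReal_add (by linarith) (by linarith), ← ENNReal.ofReal_mul (by norm_num)]
    exact ENNReal.ofReal_le_ofReal (by linarith)
  rw [ENNReal.mul_le_mul_iff_right (by simp) ENNReal.ofReal_ne_top] at h80
  simpa only [ENNReal.ofReal_add (crossingLoss_nonneg _) (crossingLoss_nonneg _)] using h80

end DirichletCharacter

namespace DirichletCharacter

variable {N : ℕ} [NeZero N] {ψ : DirichletCharacter ℂ N}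

/-- At a zero of `L(s, ψ) L(s, ψ⁻¹)` the right-hand side is the junk value `log 0 = 0`, which the
hypothesis `g ≤ 1` makes harmless. -/
theorem le_log_norm_completedPair_of_half_le {g : ℝ} (hg0 : 0 < g) (hg1 : g ≤ 1) {s : ℂ}
    (hs : 1 / 2 ≤ s.re) (hg : g ≤ ‖gammaFactor ψ s‖) (hE : 2 ≤ s.re ∨ s ∈ crossingDiscs) :
    2 * Real.log g - Real.log 9 - crossingLoss ψ s ≤ Real.log ‖completedPair ψ s‖ := by
  have hl := posLog_inv_norm_lPair_le (ψ := ψ) hE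
  have hlg : Real.log g ≤ 0 := Real.log_nonpos hg0.le hg1
  have hpl : 0 ≤ Real.posLog ‖lPair ψ s‖⁻¹ := Real.posLog_nonneg
  rw [completedPair_eq (by linarith), norm_mul, norm_pow]
  by_cases h0 : lPair ψ s = 0
  · rw [h0, norm_zero, mul_zero, Real.log_zero]
    linarith
  · rw [Real.log_mul (pow_ne_zero _ (by linarith)) (norm_ne_zero_iff.2 h0), Real.log_pow]
    have h1 := Real.log_le_log hg0 hg
    have h2 := Real.posLog_sub_posLog_inv (x := ‖lPair ψ s‖)
    have h3 : 0 ≤ Real.posLog ‖lPair ψ s‖ := Real.posLog_nonneg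
    push_cast
    linarith

/-- On a circle of radius `R` about `2`, the functional equation makes `Λ(s, ψ) Λ(s, ψ⁻¹)` large on
the part to the left of the critical line. There `2 (1/2 - Re s)` exceeds
`R (cos² θ - cos θ) - 3`, which is nonpositive on the rest of the circle. -/
theorem IsPrimitive.le_log_norm_completedPair (hGRH : GRH) (hψ : ψ.IsPrimitive) (h1 : ψ ≠ 1)
    {g : ℝ} (hg0 : 0 < g) (hg1 : g ≤ 1)
    (hg : ∀ s : ℂ, 1 / 2 ≤ s.re → ‖s‖ ≤ 2000 → g ≤ ‖gammaFactor ψ s‖)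
    {R : ℝ} (hR : R ∈ Set.Icc (1000 : ℝ) 1001) (θ : ℝ) :
    (R * (Real.cos θ ^ 2 - Real.cos θ) - 3) * Real.log N + (2 * Real.log g - Real.log 9) -
      (crossingLoss ψ (circleMap 2 R θ) + crossingLoss ψ (1 - circleMap 2 R θ)) ≤
      Real.log ‖completedPair ψ (circleMap 2 R θ)‖ := by
  have hN : (1 : ℝ) ≤ N := by exact_mod_cast NeZero.one_le
  have hlogN : 0 ≤ Real.log N := Real.log_nonneg hN
  obtain ⟨hR1, hR2⟩ := id hR
  set s := circleMap 2 R θ with hs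
  set c := Real.cos θ with hc
  have hc1 : -1 ≤ c := Real.neg_one_le_cos θ
  have hsc : Real.sin θ ^ 2 + c ^ 2 = 1 := Real.sin_sq_add_cos_sq θ
  have hre : s.re = 2 + R * c := by simp [hs, circleMap, exp_ofReal_mul_I_re, hc]
  have him : s.im = R * Real.sin θ := by simp [hs, circleMap, exp_ofReal_mul_I_im]
  have him2 : s.im ^ 2 = R ^ 2 - (R * c) ^ 2 := by
    rw [him]
    linear_combination R ^ 2 * hsc
  have hsn : ‖s‖ ≤ 1003 := by
    have h := circleMap_mem_sphere (2 : ℂ) (by linarith : 0 ≤ R) θ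
    rw [mem_sphere_iff_norm, ← hs] at h
    have h2 := norm_le_norm_add_norm_sub' s 2
    rw [h] at h2
    have : ‖(2 : ℂ)‖ = 2 := by simp
    linarith
  have hl1 := crossingLoss_nonneg (ψ := ψ) s
  have hl2 := crossingLoss_nonneg (ψ := ψ) (1 - s)
  rcases le_or_gt (1 / 2) s.re with hhalf | hhalf
  · have hE : 2 ≤ s.re ∨ s ∈ crossingDiscs := by
      refine (le_or_gt 2 s.re).imp_right fun h2 => mem_crossingDiscs hR hhalf h2.le ?_ ?_
      · rw [him2]; nlinarith
      · rw [him2]; nlinarith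
    have h := le_log_norm_completedPair_of_half_le (ψ := ψ) hg0 hg1 hhalf
      (hg s hhalf (by linarith)) hE
    have hneg : R * (c ^ 2 - c) - 3 ≤ 0 := by
      have h3 : -(3 / 2) ≤ R * c := by linarith
      nlinarith [mul_nonneg (by linarith : 0 ≤ R * c + 3 / 2) (by linarith : 0 ≤ 1 + c),
        mul_nonneg (by linarith : (0 : ℝ) ≤ R) (sq_nonneg c), Real.cos_le_one θ]
    have := mul_nonpos_of_nonpos_of_nonneg hneg hlogN
    linarith
  · have hre' : (1 - s).re = -1 - R * c := by rw [sub_re, one_re, hre]; ring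
    have him' : (1 - s).im ^ 2 = R ^ 2 - (R * c) ^ 2 := by rw [sub_im, one_im, ← him2]; ring
    have hhalf' : 1 / 2 ≤ (1 - s).re := by rw [sub_re, one_re]; linarith
    have hE : 2 ≤ (1 - s).re ∨ 1 - s ∈ crossingDiscs := by
      refine (le_or_gt 2 (1 - s).re).imp_right fun h2 => mem_crossingDiscs hR hhalf' h2.le ?_ ?_
      · rw [him']; nlinarith
      · rw [him']; nlinarith
    have hsn' : ‖1 - s‖ ≤ 2000 := by
      refine (norm_sub_le _ _).trans ?_
      rw [norm_one]; linarith
    have h := le_log_norm_completedPair_of_half_le (ψ := ψ) hg0 hg1 hhalf' (hg _ hhalf' hsn') hE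
    obtain ⟨W, hW1, hW⟩ := hψ.exists_completedPair_one_sub
    have hne : completedPair ψ (1 - s) ≠ 0 := fun h0 => by
      have := re_eq_half_of_completedPair_eq_zero hGRH hψ h1 h0
      rw [sub_re, one_re] at this
      linarith
    have hfe := hW (1 - s)
    rw [sub_sub_cancel] at hfe
    have hNpos : (0 : ℝ) < N := by linarith
    have hpow : ‖(N : ℂ) ^ (2 * (1 - s) - 1)‖ = (N : ℝ) ^ (-3 - 2 * (R * c)) := by
      rw [norm_natCast_cpow_of_pos (by exact_mod_cast hNpos)]
      congr 1
      simp only [sub_re, mul_re, one_re, re_ofNat, im_ofNat, hre]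
      ring
    rw [hfe, norm_mul, norm_mul, hpow, hW1, mul_one,
      Real.log_mul (Real.rpow_pos_of_pos hNpos _).ne' (norm_ne_zero_iff.2 hne),
      Real.log_rpow hNpos]
    have hle : R * (c ^ 2 - c) - 3 ≤ -3 - 2 * (R * c) := by
      have hc0 : c ≤ 0 := by
        by_contra! hpos
        nlinarith
      nlinarith [mul_nonneg (by linarith : (0 : ℝ) ≤ R) (mul_nonneg_of_nonpos_of_nonpos hc0
        (by linarith : -1 - c ≤ 0))]
    have := mul_le_mul_of_nonneg_right hle hlogN
    linarith

theorem integral_cos_sq_sub_cos (a b k : ℝ) :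
    ∫ θ in (-Real.pi)..Real.pi, ((a * (Real.cos θ ^ 2 - Real.cos θ) - 3) * b + k) =
      2 * Real.pi * ((a / 2 - 3) * b + k) := by
  have h1 : ∫ θ in (-Real.pi)..Real.pi, Real.cos θ ^ 2 = Real.pi := by
    rw [integral_cos_sq]; simp
  have h2 : ∫ θ in (-Real.pi)..Real.pi, Real.cos θ = 0 := by simp
  have hi1 : IntervalIntegrable (fun θ => Real.cos θ ^ 2) volume (-Real.pi) Real.pi :=
    (by fun_prop : Continuous fun θ => Real.cos θ ^ 2).intervalIntegrable _ _
  have hi2 : IntervalIntegrable (fun θ => Real.cos θ) volume (-Real.pi) Real.pi :=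
    Real.continuous_cos.intervalIntegrable _ _
  have he : (fun θ => (a * (Real.cos θ ^ 2 - Real.cos θ) - 3) * b + k) =
      fun θ => a * b * (Real.cos θ ^ 2 - Real.cos θ) + (k - 3 * b) := funext fun θ => by ring
  rw [he, intervalIntegral.integral_add ((hi1.sub hi2).const_mul _) (by simp),
    intervalIntegral.integral_const_mul, intervalIntegral.integral_sub hi1 hi2, h1, h2]
  simp only [intervalIntegral.integral_const, smul_eq_mul]
  ring

theorem IsPrimitive.exists_le_circleAverage_log_norm_completedPair (hGRH : GRH)
    (hψ : ψ.IsPrimitive) (h1 : ψ ≠ 1) {g : ℝ} (hg0 : 0 < g) (hg1 : g ≤ 1)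
    (hg : ∀ s : ℂ, 1 / 2 ≤ s.re → ‖s‖ ≤ 2000 → g ≤ ‖gammaFactor ψ s‖) :
    ∃ R ∈ Set.Icc (1000 : ℝ) 1001, 497 * Real.log N + (2 * Real.log g - Real.log 9) - logScale N ≤
      Real.circleAverage (fun z => Real.log ‖completedPair ψ z‖) 2 R := by
  obtain ⟨R, hR, hI⟩ := exists_lintegral_crossingLoss_le h1
  refine ⟨R, hR, ?_⟩
  have hA := three_le_logScale N
  have hlogN : 0 ≤ Real.log N := Real.log_natCast_nonneg N
  have hm := measurable_crossingLoss h1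
  have hana : AnalyticOnNhd ℂ (completedPair ψ) (Metric.sphere 2 |R|) := fun z _ =>
    analyticAt_completedPair h1 z
  have h := le_circleAverage_of_lintegral_le (c := 2) (R := R)
    (K := 2 * Real.pi * logScale N)
    (g := fun z => crossingLoss ψ z + crossingLoss ψ (1 - z))
    (h := fun θ => (R * (Real.cos θ ^ 2 - Real.cos θ) - 3) * Real.log N +
      (2 * Real.log g - Real.log 9))
    hana.meromorphicOn.circleIntegrable_log_norm (hm.add (hm.comp (by fun_prop)))
    (fun z => add_nonneg (crossingLoss_nonneg _) (crossingLoss_nonneg _))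
    (by have := Real.pi_pos; positivity) hI (by fun_prop)
    (fun θ => hψ.le_log_norm_completedPair hGRH h1 hg0 hg1 hg hR θ)
  refine le_trans ?_ h
  rw [integral_cos_sq_sub_cos, ← mul_sub, inv_mul_cancel_left₀ Real.two_pi_pos.ne']
  nlinarith [hR.1]

theorem sum_zeroMultiplicity_le_bPlus_add (h1 : ψ ≠ 1) (F : Finset ℝ)
    (hF : ∀ t ∈ F, 0 < t ∧ t ≤ 1001) :
    ∑ t ∈ F, (analyticOrderNatAt (completedPair ψ) (1 / 2 + t * I) : ℝ) ≤
      1002002 * (bPlus ψ + bPlus ψ⁻¹) := by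
  have hle := add_le_add (sum_zeroMultiplicity_div_le_bPlus h1 F fun t ht => (hF t ht).1)
    (sum_zeroMultiplicity_div_le_bPlus (inv_ne_one.2 h1) F fun t ht => (hF t ht).1)
  rw [← Finset.sum_add_distrib] at hle
  rw [← div_le_iff₀' (by norm_num), Finset.sum_div]
  refine le_trans (Finset.sum_le_sum fun t ht => ?_) hle
  obtain ⟨h0, h2⟩ := hF t ht
  rw [analyticOrderNatAt_completedPair h1, ← add_mul, ← Nat.cast_add, div_eq_mul_one_div]
  refine mul_le_mul_of_nonneg_left ?_ (Nat.cast_nonneg _)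
  refine one_div_le_one_div_of_le (by positivity) ?_
  nlinarith

theorem zeroMultiplicity_zero_le (h1 : ψ ≠ 1) : (zeroMultiplicity ψ 0 : ℝ) ≤ 12 * logScale N := by
  have hC := one_le_lBoundConst
  have hN : (1 : ℝ) ≤ N := by exact_mod_cast NeZero.one_le
  have h := sum_zeroMultiplicity_le h1 0 {0} (by simp)
  rw [Finset.sum_singleton] at h
  refine h.trans (mul_le_mul_of_nonneg_left (Real.log_le_log ?_ ?_) (by norm_num))
  · simp only [abs_zero, zero_add]; positivity
  · simp only [abs_zero, zero_add]
    nlinarith [mul_pos (by linarith : 0 < lBoundConst) (by linarith : (0 : ℝ) < N)]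

/-- Zeros with negative ordinate are reflected by the functional equation; a zero at `1/2` is not
seen by `b₊` and is bounded separately. -/
theorem IsPrimitive.sum_analyticOrderNatAt_completedPair_le (hψ : ψ.IsPrimitive) (h1 : ψ ≠ 1)
    (F : Finset ℝ) (hF : ∀ t ∈ F, |t| ≤ 1001) :
    ∑ t ∈ F, (analyticOrderNatAt (completedPair ψ) (1 / 2 + t * I) : ℝ) ≤
      24 * logScale N + 2004004 * (bPlus ψ + bPlus ψ⁻¹) := by
  classical
  set m : ℝ → ℝ := fun t => (analyticOrderNatAt (completedPair ψ) (1 / 2 + t * I) : ℝ) with hm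
  have hA := three_le_logScale N
  have hpos := sum_zeroMultiplicity_le_bPlus_add h1 (F.filter (0 < ·)) fun t ht => by
    obtain ⟨h, h0⟩ := Finset.mem_filter.1 ht
    exact ⟨h0, (le_abs_self t).trans (hF t h)⟩
  have hneg := sum_zeroMultiplicity_le_bPlus_add h1 ((F.filter (· < 0)).image (- ·)) fun t ht => by
    obtain ⟨u, hu, rfl⟩ := Finset.mem_image.1 ht
    obtain ⟨h, h0⟩ := Finset.mem_filter.1 hu
    exact ⟨neg_pos.2 h0, (neg_le_abs u).trans (hF u h)⟩
  rw [Finset.sum_image fun x _ y _ h => neg_injective h] at hneg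
  have hzero : ∑ t ∈ F.filter (0 = ·), m t ≤ 24 * logScale N := by
    calc ∑ t ∈ F.filter (0 = ·), m t ≤ ∑ t ∈ {0}, m t := by
          refine Finset.sum_le_sum_of_subset_of_nonneg (fun t ht => ?_)
            fun _ _ _ => Nat.cast_nonneg _
          rw [Finset.mem_singleton]
          exact (Finset.mem_filter.1 ht).2.symm
      _ = zeroMultiplicity ψ 0 + zeroMultiplicity ψ⁻¹ 0 := by
          rw [Finset.sum_singleton, hm]
          simp only
          rw [analyticOrderNatAt_completedPair h1, Nat.cast_add]
      _ ≤ 24 * logScale N := by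
          linarith [zeroMultiplicity_zero_le h1, zeroMultiplicity_zero_le (inv_ne_one.2 h1)]
  have hsplit : ∑ t ∈ F, m t = ∑ t ∈ F.filter (0 < ·), m t + (∑ t ∈ F.filter (0 = ·), m t +
      ∑ t ∈ F.filter (· < 0), m t) := by
    rw [← Finset.sum_filter_add_sum_filter_not F (0 < ·)]
    congr 1
    rw [← Finset.sum_filter_add_sum_filter_not (F.filter fun t => ¬ 0 < t) (0 = ·),
      Finset.filter_filter, Finset.filter_filter]
    congr 1
    · refine Finset.sum_congr (Finset.filter_congr fun t _ => ?_) fun _ _ => rfl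
      exact ⟨fun h => h.2, fun h => ⟨fun h0 => h0.ne h, h⟩⟩
    · refine Finset.sum_congr (Finset.filter_congr fun t _ => ?_) fun _ _ => rfl
      exact ⟨fun h => lt_of_le_of_ne (not_lt.1 h.1) (Ne.symm h.2), fun h => ⟨h.not_gt, h.ne'⟩⟩
  have hneg' : ∑ t ∈ F.filter (· < 0), m t ≤ 1002002 * (bPlus ψ + bPlus ψ⁻¹) := by
    refine le_trans (le_of_eq (Finset.sum_congr rfl fun t _ => ?_)) hneg
    rw [hm]
    simp only
    rw [hψ.analyticOrderNatAt_completedPair_neg h1]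
  rw [hsplit]
  linarith

end DirichletCharacter

namespace DirichletCharacter

variable {N : ℕ} [NeZero N] {ψ : DirichletCharacter ℂ N}

/-- In Jensen's formula a zero on the critical line has distance at least `3/2` from the centre `2`,
so its weight `log (R / |2 - u|)` is at most `log 1001 < 7`. -/
theorem IsPrimitive.circleAverage_log_norm_completedPair_le (hGRH : GRH) (hψ : ψ.IsPrimitive)
    (h1 : ψ ≠ 1) {R : ℝ} (hR : R ∈ Set.Icc (1000 : ℝ) 1001) :
    Real.circleAverage (fun z => Real.log ‖completedPair ψ z‖) 2 R ≤
      7 * (24 * logScale N + 2004004 * (bPlus ψ + bPlus ψ⁻¹)) +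
        Real.log ‖completedPair ψ 2‖ := by
  classical
  obtain ⟨hR1, hR2⟩ := hR
  have hRpos : 0 < R := by linarith
  have han : AnalyticOnNhd ℂ (completedPair ψ) (Metric.closedBall 2 |R|) := fun z _ =>
    analyticAt_completedPair h1 z
  rw [han.circleAverage_log_norm hRpos.ne' completedPair_two_ne_zero]
  refine add_le_add_left ?_ _
  set D := MeromorphicOn.divisor (completedPair ψ) (Metric.closedBall 2 |R|) with hD
  have hfin : (Function.support D).Finite := D.finiteSupport (isCompact_closedBall 2 |R|)
  have hmem : ∀ u ∈ hfin.toFinset, u ∈ Metric.closedBall (2 : ℂ) |R| ∧ u.re = 1 / 2 := by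
    intro u hu
    have hu0 : D u ≠ 0 := by simpa using hu
    have huB : u ∈ Metric.closedBall (2 : ℂ) |R| := by
      by_contra h
      exact hu0 (Function.locallyFinsuppWithin.apply_eq_zero_of_notMem _ h)
    refine ⟨huB, ?_⟩
    rw [hD, divisor_eq_analyticOrderNatAt han huB] at hu0
    exact re_eq_half_of_completedPair_eq_zero hGRH hψ h1
      (apply_eq_zero_of_analyticOrderNatAt_ne_zero (by exact_mod_cast hu0))
  have heta : ∀ u ∈ hfin.toFinset, (1 / 2 + (u.im : ℝ) * I : ℂ) = u := fun u hu => by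
    have h := (hmem u hu).2
    apply Complex.ext <;> simp [h]
  rw [finsum_eq_sum_of_support_subset (s := hfin.toFinset) _ (by
    intro u hu
    rw [Set.Finite.coe_toFinset]
    intro h0
    simp [h0] at hu)]
  have hsum : ∑ u ∈ hfin.toFinset, (D u : ℝ) * Real.log (R * ‖2 - u‖⁻¹) ≤
      7 * ∑ u ∈ hfin.toFinset, (analyticOrderNatAt (completedPair ψ) u : ℝ) := by
    rw [Finset.mul_sum]
    refine Finset.sum_le_sum fun u hu => ?_
    obtain ⟨huB, hre⟩ := hmem u hu
    rw [hD, divisor_eq_analyticOrderNatAt han huB, Int.cast_natCast, mul_comm]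
    refine mul_le_mul_of_nonneg_right ?_ (Nat.cast_nonneg _)
    have hdist : 3 / 2 ≤ ‖2 - u‖ := by
      have := Complex.re_le_norm (2 - u)
      rw [Complex.sub_re, hre] at this
      norm_num at this
      linarith
    have hle : R * ‖2 - u‖⁻¹ ≤ Real.exp 7 := by
      have h7 : (1001 : ℝ) ≤ Real.exp 7 := by
        have : Real.exp 7 = Real.exp 1 ^ 7 := by rw [← Real.exp_nat_mul]; norm_num
        rw [this]
        calc (1001 : ℝ) ≤ (27 / 10) ^ 7 := by norm_num
          _ ≤ _ := by gcongr; linarith [Real.exp_one_gt_d9]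
      refine le_trans (mul_le_of_le_one_right hRpos.le (inv_le_one_of_one_le₀ ?_)) (hR2.trans h7)
      linarith
    exact (Real.log_le_iff_le_exp (by positivity)).2 hle
  refine hsum.trans (mul_le_mul_of_nonneg_left ?_ (by norm_num))
  have hinj : Set.InjOn Complex.im (hfin.toFinset : Set ℂ) := fun u hu v hv h =>
    Complex.ext ((hmem u hu).2.trans (hmem v hv).2.symm) h
  refine le_trans (le_of_eq ?_) (hψ.sum_analyticOrderNatAt_completedPair_le h1
    (hfin.toFinset.image Complex.im) fun t ht => ?_)
  · rw [Finset.sum_image hinj]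
    exact Finset.sum_congr rfl fun u hu => by rw [heta u hu]
  · obtain ⟨u, hu, rfl⟩ := Finset.mem_image.1 ht
    have h := (hmem u hu).1
    rw [Metric.mem_closedBall, dist_eq_norm, abs_of_pos hRpos] at h
    have h2 := Complex.abs_im_le_norm (u - 2)
    simp only [Complex.sub_im, Complex.im_ofNat, sub_zero] at h2
    linarith

theorem log_norm_completedPair_two_le (h1 : ψ ≠ 1) {G : ℝ} (hG1 : 1 ≤ G)
    (hG : ‖gammaFactor ψ 2‖ ≤ G) :
    Real.log ‖completedPair ψ 2‖ ≤ 2 * Real.log G + 2 * logScale N := by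
  have hC := one_le_lBoundConst
  have hN : (1 : ℝ) ≤ N := by exact_mod_cast NeZero.one_le
  have hCN : 1 ≤ lBoundConst * N := one_le_mul_of_one_le_of_one_le hC hN
  have h2 : ‖lPair ψ 2‖ ≤ (1005 * lBoundConst * N) ^ 2 := by
    refine (norm_lPair_le h1 (by norm_num)).trans (pow_le_pow_left₀ (by positivity) ?_ 2)
    have : ‖(2 : ℂ)‖ = 2 := by simp
    rw [this]
    nlinarith
  have h3 : ‖completedPair ψ 2‖ ≤ G ^ 2 * (1005 * lBoundConst * N) ^ 2 := by
    rw [completedPair_eq (by norm_num), norm_mul, norm_pow]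
    gcongr
  refine (Real.log_le_log (norm_pos_iff.2 completedPair_two_ne_zero) h3).trans (le_of_eq ?_)
  rw [Real.log_mul (by positivity) (by positivity), Real.log_pow, Real.log_pow, logScale]
  norm_num

/-- Comparing the two evaluations of the mean of `log |Λ(s, ψ) Λ(s, ψ⁻¹)|` on a large circle: the
functional equation gives about `(R / 2) log N`, while a zero contributes at most `7` and the
possible zero at `1/2` has order `O(log N)` with a constant that does not depend on `R`. -/
theorem exists_mul_log_sub_le_bPlus_add (hGRH : GRH) : ∃ c : ℝ, 0 < c ∧ ∃ C : ℝ,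
    ∀ (N : ℕ) [NeZero N] (ψ : DirichletCharacter ℂ N), ψ.IsPrimitive → ψ ≠ 1 →
      c * Real.log N - C ≤ bPlus ψ + bPlus ψ⁻¹ := by
  obtain ⟨g, hg0, hg1, G, hgG⟩ := exists_le_norm_gammaFactor 2000
  set K := Real.log (1005 * lBoundConst) with hK
  refine ⟨326 / 14028028, by norm_num,
    (Real.log 9 - 2 * Real.log g + 2 * Real.log (max 1 G) + 171 * K) / 14028028, ?_⟩
  intro N _ ψ hψ h1
  have hlogN : 0 ≤ Real.log N := Real.log_natCast_nonneg N
  obtain ⟨R, hR, hlow⟩ := hψ.exists_le_circleAverage_log_norm_completedPair hGRH h1 hg0 hg1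
    (hgG ψ).1
  have hup := hψ.circleAverage_log_norm_completedPair_le hGRH h1 hR
  have htwo := log_norm_completedPair_two_le h1 (le_max_left 1 G)
    ((hgG ψ).2.trans (le_max_right 1 G))
  rw [logScale_eq] at hlow hup htwo
  rw [← hK] at hlow hup htwo
  -- `326 = 497 - 1 - 7 * 24 - 2`, and `K` is lost `1 + 7 * 24 + 2 = 171` times.
  have : 326 * Real.log N - (Real.log 9 - 2 * Real.log g + 2 * Real.log (max 1 G) + 171 * K) ≤
      14028028 * (bPlus ψ + bPlus ψ⁻¹) := by linarith
  linarith

end DirichletCharacter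

/-! ### Imprimitive characters -/

namespace DirichletCharacter

variable {d q : ℕ} [NeZero d] [NeZero q]

/-- On the critical line a character and the primitive character inducing it have the same zeros:
the Euler factors by which their `L`-functions differ do not vanish there. -/
theorem zeroMultiplicity_changeLevel (hd : d ∣ q) {ψ : DirichletCharacter ℂ d} (h1 : ψ ≠ 1)
    (t : ℝ) : zeroMultiplicity (changeLevel hd ψ) t = zeroMultiplicity ψ t := by
  set s : ℂ := 1 / 2 + t * I with hs
  have hfun : LFunction (changeLevel hd ψ) =
      LFunction ψ * fun s : ℂ => ∏ p ∈ q.primeFactors, (1 - ψ p * (p : ℂ) ^ (-s)) :=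
    funext fun z => LFunction_changeLevel hd ψ (.inl h1)
  have hdiff : Differentiable ℂ fun s : ℂ => ∏ p ∈ q.primeFactors, (1 - ψ p * (p : ℂ) ^ (-s)) := by
    refine Differentiable.fun_finsetProd fun p hp => ?_
    have hp0 : (p : ℂ) ≠ 0 := Nat.cast_ne_zero.2 (Nat.prime_of_mem_primeFactors hp).ne_zero
    exact (differentiable_const _).sub
      ((Differentiable.const_cpow (by fun_prop) (.inl hp0)).const_mul _)
  have hne : ∏ p ∈ q.primeFactors, (1 - ψ p * (p : ℂ) ^ (-s)) ≠ 0 := by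
    refine Finset.prod_ne_zero_iff.2 fun p hp h => ?_
    have hprime := Nat.prime_of_mem_primeFactors hp
    have h2 : ‖ψ p * (p : ℂ) ^ (-s)‖ = 1 := by rw [← sub_eq_zero.1 h, norm_one]
    rw [norm_mul, norm_natCast_cpow_of_pos hprime.pos] at h2
    have hre : (-s).re = -(1 / 2) := by simp [hs]
    have h3 : (p : ℝ) ^ (-s).re < 1 := by
      rw [hre]
      exact Real.rpow_lt_one_of_one_lt_of_neg (by exact_mod_cast hprime.one_lt) (by norm_num)
    have h4 := DirichletCharacter.norm_le_one ψ (p : ZMod d)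
    have h5 : 0 ≤ (p : ℝ) ^ (-s).re := by positivity
    nlinarith [norm_nonneg (ψ p)]
  have hL := (differentiable_LFunction h1).analyticAt s
  rw [zeroMultiplicity, zeroMultiplicity, analyticOrderNatAt, analyticOrderNatAt, hfun,
    analyticOrderAt_mul hL (hdiff.analyticAt s),
    (hdiff.analyticAt s).analyticOrderAt_eq_zero.2 hne, add_zero]

theorem bPlus_changeLevel (hd : d ∣ q) {ψ : DirichletCharacter ℂ d} (h1 : ψ ≠ 1) :
    bPlus (changeLevel hd ψ) = bPlus ψ := by
  let e : UpperZero (changeLevel hd ψ) ≃ UpperZero ψ :=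
    Equiv.subtypeEquivRight fun p => by rw [zeroMultiplicity_changeLevel hd h1]
  exact e.tsum_eq fun z => 1 / (1 / 4 + z.ordinate ^ 2)

theorem bPlus_nonneg (χ : DirichletCharacter ℂ q) : 0 ≤ bPlus χ :=
  tsum_nonneg fun _ => by positivity

theorem bPlus_add_bPlus_inv_ge {c C : ℝ} (hc : ∀ (N : ℕ) [NeZero N] (ψ : DirichletCharacter ℂ N),
    ψ.IsPrimitive → ψ ≠ 1 → c * Real.log N - C ≤ bPlus ψ + bPlus ψ⁻¹)
    {χ : DirichletCharacter ℂ q} (hχ : χ ≠ 1) :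
    c * Real.log χ.conductor - C ≤ bPlus χ + bPlus χ⁻¹ := by
  have : NeZero χ.conductor := ⟨conductor_ne_zero χ⟩
  have hd := χ.conductor_dvd_level
  have he := χ.changeLevel_primitiveCharacter
  have h1 : χ.primitiveCharacter ≠ 1 := fun h => hχ (by rw [← he, h, map_one])
  have hinv : changeLevel hd χ.primitiveCharacter⁻¹ = χ⁻¹ := by rw [map_inv, he]
  have h := hc _ _ χ.primitiveCharacter_isPrimitive h1
  rwa [← bPlus_changeLevel hd h1, ← bPlus_changeLevel hd (inv_ne_one.2 h1), he, hinv] at h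

/-! ### Counting characters -/

open scoped Classical in
theorem card_filter_conductor_le (q : ℕ) [NeZero q] (Q : ℕ) :
    (Finset.univ.filter fun χ : DirichletCharacter ℂ q => χ.conductor ≤ Q).card ≤ Q ^ 2 := by
  let g : ℕ → Finset (DirichletCharacter ℂ q) := fun d =>
    if h : d ∣ q then Set.Finite.toFinset (Set.toFinite (Set.range (changeLevel (R := ℂ) h))) else ∅
  have hg : ∀ d ∈ Finset.Icc 1 Q, (g d).card ≤ Q := by
    intro d hd
    obtain ⟨h1, h2⟩ := Finset.mem_Icc.1 hd
    have : NeZero d := ⟨by omega⟩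
    by_cases h : d ∣ q
    · simp only [g, dif_pos h]
      rw [← Set.ncard_eq_toFinset_card, ← Set.image_univ]
      refine (Set.ncard_image_le Set.finite_univ).trans ?_
      rw [Set.ncard_univ, card_eq_totient_of_hasEnoughRootsOfUnity]
      exact (Nat.totient_le d).trans h2
    · simp [g, h]
  calc _ ≤ ((Finset.Icc 1 Q).biUnion g).card := by
        refine Finset.card_le_card fun χ hχ => ?_
        have h := (Finset.mem_filter.1 hχ).2
        rw [Finset.mem_biUnion]
        refine ⟨χ.conductor, Finset.mem_Icc.2 ⟨Nat.pos_of_ne_zero (conductor_ne_zero χ), h⟩, ?_⟩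
        simp only [g, dif_pos χ.conductor_dvd_level, Set.Finite.mem_toFinset]
        exact ⟨_, χ.changeLevel_primitiveCharacter⟩
    _ ≤ (Finset.Icc 1 Q).card * Q := Finset.card_biUnion_le_card_mul _ _ _ hg
    _ = Q ^ 2 := by rw [Nat.card_Icc]; simp [sq]

end DirichletCharacter

section OddOneOut

variable {q : ℕ} [NeZero q] {a : Fin 3 → (ZMod q)ˣ}

theorem ne_one_of_mem_oddOneOut {i : Fin 3} {χ : DirichletCharacter ℂ q}
    (hχ : χ ∈ oddOneOut a i) : χ ≠ 1 := by
  rintro rfl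
  obtain ⟨j, hj⟩ : ∃ j : Fin 3, j ≠ i := exists_ne i
  have h := mem_oddOneOut.1 hχ j hj
  rw [MulChar.one_apply (a j).isUnit, MulChar.one_apply (a i).isUnit] at h
  norm_num at h

theorem inv_mem_oddOneOut {i : Fin 3} {χ : DirichletCharacter ℂ q} (hχ : χ ∈ oddOneOut a i) :
    χ⁻¹ ∈ oddOneOut a i := by
  rw [mem_oddOneOut] at *
  intro j hj
  rw [MulChar.inv_apply_eq_inv', MulChar.inv_apply_eq_inv', hχ j hj, inv_neg]

/-- Orthogonality: `(1 - χ(u)) (1 - χ(w))`, where `u` and `w` are the quotients of the other two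
residues by `a i`, is `4` on `H_i` and `0` elsewhere. -/
theorem IsSpecialTriple.four_mul_card_oddOneOut (ha : IsSpecialTriple a) (i : Fin 3) :
    4 * (oddOneOut a i).card = q.totient := by
  classical
  obtain ⟨j, k, hj, hk, hjk, hall⟩ : ∃ j k : Fin 3, j ≠ i ∧ k ≠ i ∧ j ≠ k ∧
      ∀ l, l ≠ i → l = j ∨ l = k := by
    revert i; decide
  have hsq : ∀ l, (a l * (a i)⁻¹) ^ 2 = 1 := fun l => by
    rw [mul_pow, ha.2 l i, inv_pow, mul_inv_cancel]
  have hne : ∀ l, l ≠ i → a l * (a i)⁻¹ ≠ 1 := fun l hl h =>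
    hl (ha.1 (mul_inv_eq_one.1 h))
  have hχ : ∀ (χ : DirichletCharacter ℂ q) l,
      χ (a l : ZMod q) = χ ((a l * (a i)⁻¹ : (ZMod q)ˣ) : ZMod q) * χ (a i : ZMod q) := by
    intro χ l
    rw [← map_mul, ← Units.val_mul, inv_mul_cancel_right]
  have hχ1 : ∀ (χ : DirichletCharacter ℂ q) l,
      χ ((a l * (a i)⁻¹ : (ZMod q)ˣ) : ZMod q) = 1 ∨
      χ ((a l * (a i)⁻¹ : (ZMod q)ˣ) : ZMod q) = -1 := by
    intro χ l
    rw [← mul_self_eq_one_iff, ← map_mul, ← Units.val_mul, ← sq, hsq l, Units.val_one, map_one]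
  obtain ⟨u, hu⟩ : ∃ u, u = a j * (a i)⁻¹ := ⟨_, rfl⟩
  obtain ⟨w, hw⟩ : ∃ w, w = a k * (a i)⁻¹ := ⟨_, rfl⟩
  have huw : u * w ≠ 1 := fun h => by
    have h2 : u * w = u * u := by rw [h, ← sq, hu, hsq j]
    have h3 := mul_left_cancel h2
    rw [hu, hw] at h3
    exact hjk (ha.1 (mul_right_cancel h3)).symm
  have hmem : ∀ χ : DirichletCharacter ℂ q, (1 - χ (u : ZMod q)) * (1 - χ (w : ZMod q)) =
      if χ ∈ oddOneOut a i then 4 else 0 := by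
    intro χ
    have hi0 : χ (a i : ZMod q) ≠ 0 := MulChar.apply_ne_zero_iff.2 (a i).isUnit
    have hiff : ∀ l, χ (a l : ZMod q) = -χ (a i : ZMod q) ↔
        χ ((a l * (a i)⁻¹ : (ZMod q)ˣ) : ZMod q) = -1 := fun l => by
      rw [hχ χ l, ← neg_one_mul, mul_left_inj' hi0]
    have hm : χ ∈ oddOneOut a i ↔ χ (u : ZMod q) = -1 ∧ χ (w : ZMod q) = -1 := by
      rw [mem_oddOneOut, hu, hw, ← hiff j, ← hiff k]
      refine ⟨fun h => ⟨h j hj, h k hk⟩, fun h l hl => ?_⟩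
      rcases hall l hl with rfl | rfl
      exacts [h.1, h.2]
    rcases hχ1 χ j with h1 | h1 <;> rcases hχ1 χ k with h2 | h2 <;>
      rw [← hu] at h1 <;> rw [← hw] at h2 <;> simp only [hm, h1, h2] <;> norm_num
  have hsum := Finset.sum_congr rfl
    fun χ (_ : χ ∈ (Finset.univ : Finset (DirichletCharacter ℂ q))) => hmem χ
  have hexp : ∀ χ : DirichletCharacter ℂ q, (1 - χ (u : ZMod q)) * (1 - χ (w : ZMod q)) =
      χ 1 - χ (u : ZMod q) - χ (w : ZMod q) + χ ((u * w : (ZMod q)ˣ) : ZMod q) := fun χ => by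
    rw [Units.val_mul, map_mul, map_one]; ring
  have hcast : ∀ {v : (ZMod q)ˣ}, v ≠ 1 → (v : ZMod q) ≠ 1 := fun hv h => hv (Units.val_eq_one.1 h)
  simp only [hexp, Finset.sum_add_distrib, Finset.sum_sub_distrib,
    DirichletCharacter.sum_characters_eq, if_true, if_neg (hcast (hu ▸ hne j hj)),
    if_neg (hcast (hw ▸ hne k hk)), if_neg (hcast huw)] at hsum
  rw [Finset.sum_ite_mem, Finset.univ_inter, Finset.sum_const, nsmul_eq_mul] at hsum
  have : ((4 * (oddOneOut a i).card : ℕ) : ℂ) = (q.totient : ℕ) := by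
    push_cast
    linear_combination -hsum
  exact_mod_cast this

end OddOneOut

/-! ### The size of Euler's function -/

theorem Nat.le_totient_sq_of_odd {n : ℕ} (hn : Odd n) : n ≤ n.totient ^ 2 := by
  induction n using Nat.recOnPosPrimePosCoprime with
  | zero => simp
  | one => simp
  | prime_pow p k hp hk =>
    have hp3 : 3 ≤ p := by
      have h2 : p ≠ 2 := by
        rintro rfl
        exact (Nat.not_even_iff_odd.2 hn) (Nat.even_pow.2 ⟨even_two, hk.ne'⟩)
      have := hp.two_le
      omega
    rw [Nat.totient_prime_pow hp hk]
    obtain ⟨r, rfl⟩ : ∃ r, p = r + 1 := ⟨p - 1, by omega⟩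
    obtain ⟨m, rfl⟩ : ∃ m, k = m + 1 := ⟨k - 1, by omega⟩
    simp only [Nat.add_sub_cancel]
    have hr : 2 ≤ r := by omega
    calc (r + 1) ^ (m + 1) = (r + 1) ^ m * (r + 1) := pow_succ _ _
      _ ≤ ((r + 1) ^ m) ^ 2 * r ^ 2 :=
          Nat.mul_le_mul (Nat.le_self_pow two_ne_zero _) (by nlinarith)
      _ = _ := by ring
  | coprime a b _ _ hab iha ihb =>
    rw [Nat.totient_mul hab, mul_pow]
    obtain ⟨h1, h2⟩ := Nat.odd_mul.1 hn
    exact Nat.mul_le_mul (iha h1) (ihb h2)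

theorem Nat.le_two_mul_totient_sq (n : ℕ) : n ≤ 2 * n.totient ^ 2 := by
  rcases eq_or_ne n 0 with rfl | hn
  · simp
  obtain ⟨k, m, hm, rfl⟩ := Nat.exists_eq_two_pow_mul_odd hn
  have hcop : (2 ^ k).Coprime m := Nat.Coprime.pow_left k (Nat.coprime_two_left.2 hm)
  have h1 := Nat.le_totient_sq_of_odd hm
  have h2 : 2 ^ k ≤ 2 * (2 ^ k).totient ^ 2 := by
    rcases k with _ | k
    · simp
    · rw [Nat.totient_prime_pow Nat.prime_two (Nat.succ_pos k)]
      simp only [Nat.succ_sub_one]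
      calc 2 ^ (k + 1) = 2 * 2 ^ k := by ring
        _ ≤ 2 * (2 ^ k) ^ 2 := Nat.mul_le_mul_left 2 (Nat.le_self_pow two_ne_zero _)
        _ = _ := by ring
  rw [Nat.totient_mul hcop, mul_pow]
  calc 2 ^ k * m ≤ (2 * (2 ^ k).totient ^ 2) * m.totient ^ 2 := Nat.mul_le_mul h2 h1
    _ = _ := by ring

/-! ### The variances -/

/-- At most `q ^ (1/4)` characters have conductor at most `q ^ (1/8)`; all other members of `H_i`
contribute at least a multiple of `log q`. -/
theorem le_raceVariance {c C : ℝ} (hc0 : 0 ≤ c)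
    (hc : ∀ (N : ℕ) [NeZero N] (ψ : DirichletCharacter ℂ N),
      ψ.IsPrimitive → ψ ≠ 1 → c * Real.log N - C ≤ bPlus ψ + bPlus ψ⁻¹)
    {q : ℕ} [NeZero q] {a : Fin 3 → (ZMod q)ˣ} (ha : IsSpecialTriple a) (i : Fin 3)
    (hC : 0 ≤ c / 8 * Real.log q - C) :
    16 * (((q.totient : ℝ) / 4 - (q : ℝ) ^ (1 / 4 : ℝ)) * (c / 8 * Real.log q - C)) ≤
      raceVariance a i := by
  classical
  have hq : (0 : ℝ) < q := by exact_mod_cast NeZero.pos q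
  set H := oddOneOut a i with hH
  set Q : ℕ := ⌊(q : ℝ) ^ (1 / 8 : ℝ)⌋₊ with hQ
  have hsym : ∑ χ ∈ H, bPlus χ⁻¹ = ∑ χ ∈ H, bPlus χ :=
    Finset.sum_nbij' (·⁻¹) (·⁻¹) (fun χ h => inv_mem_oddOneOut h) (fun χ h => inv_mem_oddOneOut h)
      (by simp) (by simp) (by simp)
  have hcard : (H.card : ℝ) = q.totient / 4 := by
    have : (4 * H.card : ℝ) = q.totient := by exact_mod_cast ha.four_mul_card_oddOneOut i
    linarith
  have hsmall : ((H.filter fun χ => χ.conductor ≤ Q).card : ℝ) ≤ (q : ℝ) ^ (1 / 4 : ℝ) := by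
    have h1 : (H.filter fun χ => χ.conductor ≤ Q).card ≤ Q ^ 2 :=
      (Finset.card_le_card (Finset.filter_subset_filter _ (Finset.subset_univ H))).trans
        (DirichletCharacter.card_filter_conductor_le q Q)
    calc ((H.filter fun χ => χ.conductor ≤ Q).card : ℝ) ≤ (Q : ℝ) ^ 2 := by exact_mod_cast h1
      _ ≤ ((q : ℝ) ^ (1 / 8 : ℝ)) ^ 2 := by
          gcongr
          exact Nat.floor_le (by positivity)
      _ = (q : ℝ) ^ (1 / 4 : ℝ) := by
          rw [← Real.rpow_natCast, ← Real.rpow_mul hq.le]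
          norm_num
  have hbig : (q.totient : ℝ) / 4 - (q : ℝ) ^ (1 / 4 : ℝ) ≤
      ((H.filter fun χ => ¬ χ.conductor ≤ Q).card : ℝ) := by
    have := Finset.card_filter_add_card_filter_not (s := H) fun χ => χ.conductor ≤ Q
    have h2 : ((H.filter fun χ => χ.conductor ≤ Q).card : ℝ) +
        (H.filter fun χ => ¬ χ.conductor ≤ Q).card = H.card := by exact_mod_cast this
    linarith
  have hterm : ∀ χ ∈ H.filter fun χ => ¬ χ.conductor ≤ Q,
      c / 8 * Real.log q - C ≤ bPlus χ + bPlus χ⁻¹ := by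
    intro χ hχ
    obtain ⟨hχH, hcond⟩ := Finset.mem_filter.1 hχ
    refine le_trans ?_ (DirichletCharacter.bPlus_add_bPlus_inv_ge hc (ne_one_of_mem_oddOneOut hχH))
    have h1 : (q : ℝ) ^ (1 / 8 : ℝ) ≤ χ.conductor := (Nat.lt_of_floor_lt (not_le.1 hcond)).le
    have h2 := Real.log_le_log (by positivity) h1
    rw [Real.log_rpow hq] at h2
    nlinarith
  calc 16 * (((q.totient : ℝ) / 4 - (q : ℝ) ^ (1 / 4 : ℝ)) * (c / 8 * Real.log q - C))
      ≤ 16 * ((H.filter fun χ => ¬ χ.conductor ≤ Q).card * (c / 8 * Real.log q - C)) := by gcongr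
    _ = 16 * ∑ χ ∈ H.filter fun χ => ¬ χ.conductor ≤ Q, (c / 8 * Real.log q - C) := by
        rw [Finset.sum_const, nsmul_eq_mul]
    _ ≤ 16 * ∑ χ ∈ H.filter fun χ => ¬ χ.conductor ≤ Q, (bPlus χ + bPlus χ⁻¹) := by
        gcongr with χ hχ
        exact hterm χ hχ
    _ ≤ 16 * ∑ χ ∈ H, (bPlus χ + bPlus χ⁻¹) := by
        refine mul_le_mul_of_nonneg_left (Finset.sum_le_sum_of_subset_of_nonneg
          (Finset.filter_subset _ _) fun χ _ _ => ?_) (by norm_num)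
        exact add_nonneg (DirichletCharacter.bPlus_nonneg χ) (DirichletCharacter.bPlus_nonneg χ⁻¹)
    _ = raceVariance a i := by
        rw [Finset.sum_add_distrib, hsym, raceVariance]
        ring

theorem rpow_one_fourth_le_totient {q : ℕ} (hq : (2 : ℝ) ^ 14 ≤ q) :
    (q : ℝ) ^ (1 / 4 : ℝ) ≤ q.totient / 8 := by
  have hq0 : (0 : ℝ) < q := lt_of_lt_of_le (by norm_num) hq
  set x : ℝ := (q : ℝ) ^ (1 / 4 : ℝ) with hx
  have hx0 : 0 ≤ x := by positivity
  have hx4 : x ^ 4 = q := by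
    rw [hx, ← Real.rpow_natCast, ← Real.rpow_mul hq0.le]
    norm_num
  have h1 : (q : ℝ) ≤ 2 * (q.totient : ℝ) ^ 2 := by exact_mod_cast Nat.le_two_mul_totient_sq q
  have hx2 : 128 ≤ x ^ 2 := by
    refine le_of_sq_le_sq ?_ (by positivity)
    rw [← pow_mul, hx4]
    norm_num at hq ⊢
    linarith
  refine le_of_sq_le_sq ?_ (by positivity)
  nlinarith [mul_self_nonneg x]

/-- Under GRH the variances are at least of order `φ(q) log q`. -/
theorem exists_totient_mul_log_le_raceVariance (hGRH : GRH) : ∃ c : ℝ, 0 < c ∧ ∃ q₀ : ℝ,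
    ∀ (q : ℕ) [NeZero q], q₀ < q → ∀ a : Fin 3 → (ZMod q)ˣ, IsSpecialTriple a → ∀ i,
      c * (q.totient * Real.log q) ≤ raceVariance a i := by
  obtain ⟨c, hc0, C, hc⟩ := DirichletCharacter.exists_mul_log_sub_le_bPlus_add hGRH
  refine ⟨c / 8, by positivity, max (2 ^ 14) (Real.exp (16 * C / c)), fun q _ hq a ha i => ?_⟩
  obtain ⟨hq1, hq2⟩ := max_lt_iff.1 hq
  have hqpos : (0 : ℝ) < q := lt_trans (by norm_num) hq1
  have hlogq : 0 ≤ Real.log q := Real.log_natCast_nonneg q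
  have hlog : C ≤ c / 16 * Real.log q := by
    have h := (Real.lt_log_iff_exp_lt hqpos).2 hq2
    rw [div_lt_iff₀ hc0] at h
    linarith
  have hφ := rpow_one_fourth_le_totient hq1.le
  refine le_trans ?_ (le_raceVariance hc0.le hc ha i (by nlinarith))
  have h1 : (q.totient : ℝ) / 8 ≤ q.totient / 4 - (q : ℝ) ^ (1 / 4 : ℝ) := by linarith
  have h2 : c / 16 * Real.log q ≤ c / 8 * Real.log q - C := by linarith
  have h3 := mul_le_mul h1 h2 (by positivity) (le_trans (by positivity) h1)
  linarith

theorem mainTheorem3 (hGRH : GRH) :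
    (∃ q₀ : ℝ, 0 < q₀ ∧ ∀ (q : ℕ) [NeZero q], q₀ < q →
      ∀ a : Fin 3 → (ZMod q)ˣ, IsSpecialTriple a →
        ∀ i, max (2 ^ 20) (Nat.totient q : ℝ) ≤ raceVariance a i) ∧
    ∃ C : ℝ, 0 < C ∧ ∀ (q : ℕ) [NeZero q] (a : Fin 3 → (ZMod q)ˣ), IsSpecialTriple a →
      (∀ i, ∀ χ ∈ oddOneOut a i,
        Summable (fun z : UpperZero χ => 1 / (1 / 4 + z.ordinate ^ 2))) ∧
      ∀ {Ω : Type*} [MeasurableSpace Ω] (P : Measure Ω) [IsProbabilityMeasure P]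
        (Z : (χ : DirichletCharacter ℂ q) → UpperZero χ → Ω → ℂ),
        (∀ χ z, HasLaw (Z χ z) uniformCircle P) →
        iIndepFun (fun p : (Σ χ : DirichletCharacter ℂ q, UpperZero χ) => Z p.1 p.2) P →
        (∀ i, ∀ χ ∈ oddOneOut a i, ∀ᵐ ω ∂P,
          Tendsto (fun T : ℝ => charPartialSum (Z χ) T ω) atTop (𝓝 (charSum (Z χ) ω))) ∧
        ∀ {Ω' : Type*} [MeasurableSpace Ω'] (P' : Measure Ω') [IsProbabilityMeasure P']
          (Y : Fin 3 → Ω' → ℝ),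
          (∀ i, HasLaw (Y i) (gaussianReal 0 (raceVariance a i).toNNReal) P') →
          iIndepFun Y P' →
          ∀ i j k : Fin 3, i ≠ j → j ≠ k → i ≠ k →
            |P.real {ω | raceVariable a Z i ω > raceVariable a Z j ω ∧
                raceVariable a Z j ω > raceVariable a Z k ω} -
              P'.real {ω | Y i ω > Y j ω ∧ Y j ω > Y k ω}| ≤
              C / (Nat.totient q * Real.log q) := by
  obtain ⟨c, hc0, q₀, hV⟩ := exists_totient_mul_log_le_raceVariance hGRH
  set q₁ : ℝ := max q₀ (Real.exp (2 ^ 20 / c)) with hq₁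
  have hq₁1 : 1 ≤ q₁ := (Real.one_le_exp (by positivity)).trans (le_max_right _ _)
  have hlarge : ∀ (q : ℕ) [NeZero q], q₁ < q → (2 : ℝ) ^ 20 * q.totient ≤
      c * (q.totient * Real.log q) := by
    intro q _ hq
    have h := (Real.lt_log_iff_exp_lt (by linarith)).2 ((le_max_right _ _).trans_lt hq)
    rw [div_lt_iff₀ hc0] at h
    nlinarith [Nat.cast_nonneg (α := ℝ) q.totient]
  have hφ : ∀ (q : ℕ) [NeZero q], (1 : ℝ) ≤ q.totient := fun q _ => by
    exact_mod_cast Nat.totient_pos.2 (NeZero.pos q)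
  refine ⟨⟨q₁, by linarith, fun q _ hq a ha i => ?_⟩,
    max (2 ^ 42 / c) (q₁ * Real.log q₁), lt_max_of_lt_left (by positivity), fun q _ a ha => ?_⟩
  · refine le_trans (max_le ?_ ?_) (hV q ((le_max_left _ _).trans_lt hq) a ha i)
    · linarith [hlarge q hq, hφ q]
    · linarith [hlarge q hq, hφ q]
  · have hsum : ∀ i, ∀ χ ∈ oddOneOut a i,
        Summable (fun z : UpperZero χ => 1 / (1 / 4 + z.ordinate ^ 2)) := fun i χ hχ =>
      summable_one_div_ordinate (ne_one_of_mem_oddOneOut hχ)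
    refine ⟨hsum, fun P _ Z hZ hind => ?_⟩
    have hconv : ∀ i, ∀ χ ∈ oddOneOut a i, ∀ᵐ ω ∂P,
        Tendsto (fun T : ℝ => charPartialSum (Z χ) T ω) atTop (𝓝 (charSum (Z χ) ω)) :=
      fun i χ hχ => ae_tendsto_charPartialSum (hZ χ)
        (hind.precomp (g := fun z : UpperZero χ => (⟨χ, z⟩ : Σ χ : DirichletCharacter ℂ q,
          UpperZero χ)) sigma_mk_injective) (hsum i χ hχ)
    refine ⟨hconv, fun P' _ Y hY hYind i j k hij hjk hik => ?_⟩
    -- Three distinct units force `q ≥ 3`, so `log q` is positive.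
    have hq3 : 3 ≤ q := by
      have h := Fintype.card_le_of_injective a ha.1
      rw [Fintype.card_fin, ZMod.card_units_eq_totient] at h
      exact h.trans (Nat.totient_le q)
    have hq3' : (3 : ℝ) ≤ q := by exact_mod_cast hq3
    have hlog : 0 < Real.log q := Real.log_pos (by linarith)
    have hD : 0 < q.totient * Real.log q := mul_pos (by linarith [hφ q]) hlog
    rcases lt_or_ge q₁ q with hq | hq
    · have h1 : 1 ≤ c * (q.totient * Real.log q) := by linarith [hlarge q hq, hφ q]
      refine (abs_measureReal_ordered_sub_le hsum h1
        (hV q ((le_max_left _ _).trans_lt hq) a ha) hZ hind hconv hY hYind hij hjk hik).trans ?_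
      rw [← div_div]
      exact div_le_div_of_nonneg_right (le_max_left _ _) hD.le
    · have hle : q.totient * Real.log q ≤ q₁ * Real.log q₁ := by
        have h1 : (q.totient : ℝ) ≤ q₁ := le_trans (by exact_mod_cast Nat.totient_le q) hq
        have h2 := Real.log_le_log (by linarith) hq
        exact mul_le_mul h1 h2 hlog.le (by linarith)
      calc _ ≤ (1 : ℝ) := by
            rw [abs_le]
            constructor <;> linarith [measureReal_nonneg (μ := P) (s := {ω |
              raceVariable a Z i ω > raceVariable a Z j ω ∧
                raceVariable a Z j ω > raceVariable a Z k ω}),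
              measureReal_nonneg (μ := P') (s := {ω | Y i ω > Y j ω ∧ Y j ω > Y k ω}),
              measureReal_le_one (μ := P) (s := {ω |
              raceVariable a Z i ω > raceVariable a Z j ω ∧
                raceVariable a Z j ω > raceVariable a Z k ω}),
              measureReal_le_one (μ := P') (s := {ω | Y i ω > Y j ω ∧ Y j ω > Y k ω})]
        _ ≤ _ := (one_le_div hD).2 (hle.trans (le_max_right _ _))
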